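/- Let $N\ge 1$, $R,V,\varepsilon>0$, $\lambda\ge 0$, and assume the following. (v) $v\in C^2(\mathbb R;\mathbb R)$ is non-increasing, $v(0)=V$, $v(R)=0$. ($\Omega$) $\Omega\subseteq\mathbb R^N$ is the closure of a non-empty connected open set, $r_\Omega>0$, and, if $\partial\Omega\neq\emptyset$, the distance $d_{\partial\Omega}$ from $\partial\Omega$ is of class $C^2$ on the strip $S=\{x\in\Omega: d_{\partial\Omega}(x)<r_\Omega\}$ (that is, it coincides on $S$ with a $C^2$ function defined on an open set containing $S$). Let $n=\nabla d_{\partial\Omega}$ be the inward normal, defined on $S\supseteq\partial\Omega$. ($\eta$) $\eta\in C^3_c(\mathbb R^N;[0,\infty))$ and $\int\eta=1$. (g) $g\in (C^3\cap W^{3,\infty})(\mathbb R^N;S^{N-1})$, $\operatorname{div} g\in (W^{1,1}\cap W^{1,\infty})(\mathbb R^N;\mathbb R)$, and $g\cdot n\ge 0$ on $\partial\Omega$. ($\alpha$) $\alpha\in C^2(\mathbb R^N;[0,1])$, $\alpha(x)=0$ whenever $B(x,r_\Omega)\subseteq\Omega$, and $\alpha=1$ on $\partial\Omega$. ($\varphi$)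 $\varphi\in (C^3\cap W^{3,\infty})(\mathbb R;\mathbb R)$. Let $D=\mathbb R^N$ or $D=\Omega$ and, for $\rho\in L^1(\mathbb R^N;[0,R])$, put $$A_\rho(x)=\int_D\rho(y)\,\eta(x-y)\,\varphi\big((y-x)\cdot g(x)\big)\,dy,\qquad \mathcal I(\rho)=-\varepsilon\,\frac{\nabla A_\rho}{\sqrt{1+\|\nabla A_\rho\|^2}}.$$ Consider vector fields $\nu:\mathbb R^N\to\mathbb R^N$ with $\nu=g+\lambda\,\alpha\,n$ on $\Omega$ (the second term being $0$ in $\Omega\setminus S$), and the Cauchy problem $\partial_t\rho+\operatorname{div}\big(\rho\,v(\rho)\,(\nu(x)+\mathcal I(\rho))\big)=0$, $\rho(0,\cdot)=\rho_0$. Then the following hold. 1. $\mathcal I$ satisfies condition (I): it is continuous from $L^1(\mathbb R^N;[0,R])$ to $C^2(\mathbb R^N;\mathbb R^N)$; there are increasing locally bounded functions $C_I,C_I':[0,\infty)\to[0,\infty)$ and a constant $K_I$ such that, for all $r,r_1,r_2\in L^1(\mathbb R^N;[0,R])$, one has $\|\mathcal I(r)\|_{W^{1,\infty}}\le C_I(\|r\|_{L^1})$,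 $\|\operatorname{div}\mathcal I(r)\|_{L^1}\le C_I(\|r\|_{L^1})$, $\|\nabla\operatorname{div}\mathcal I(r)\|_{L^1}\le C_I'(\|r\|_{L^1})$, $\|\mathcal I(r_1)-\mathcal I(r_2)\|_{L^\infty}\le K_I\|r_1-r_2\|_{L^1}$, and $\|\mathcal I(r_1)-\mathcal I(r_2)\|_{L^1}+\|\operatorname{div}(\mathcal I(r_1)-\mathcal I(r_2))\|_{L^1}\le K_I\|r_1-r_2\|_{L^1}$. 2. Assume moreover that $d_{\partial\Omega}$ is of class $C^3$ on the closed strip $\{x\in\Omega: d_{\partial\Omega}(x)\le r_\Omega\}$ (this is no condition if $\partial\Omega=\emptyset$) and that either $\partial\Omega$ is compact, or $\alpha\in W^{2,1}\cap W^{2,\infty}$ and $d_{\partial\Omega}\in W^{3,1}\cap W^{3,\infty}$ on (the interior of) the strip $S$. Then $\nu$ can be chosen (outside $\Omega$) independently of $D$ so that it satisfies condition ($\nu$): $\nu\in C^2\cap W^{1,\infty}$ and $\operatorname{div}\nu\in W^{1,1}\cap W^{1,\infty}$ on $\mathbb R^N$. Hence the model satisfies the assumptions (v), ($\nu$), (I)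 of the existence theorem and of the stability theorem for this class of equations. 3. Let $\ell=\operatorname{diam}(\{0\}\cup\operatorname{spt}\eta)$ (which is $\operatorname{diam}(\operatorname{spt}\eta)$ if $0\in\operatorname{spt}\eta$), $\|\eta\|_{W^{1,1}}=\|\eta\|_{L^1}+\|\nabla\eta\|_{L^1}$ and $\|\varphi\|_{W^{1,\infty}}=\max(\|\varphi\|_{L^\infty},\|\varphi'\|_{L^\infty})$. If $\varphi'\ge 0$ and $$\lambda\ \ge\ \varepsilon\,R\,\|\eta\|_{W^{1,1}}\,\|\varphi\|_{W^{1,\infty}}\,\big(1+\ell\,\|\nabla g\|_{L^\infty}\big),$$ then, for every such $\nu$ that is bounded and of class $C^1$ on $\mathbb R^N$, the invariance property (P) holds: for every $T>0$, every $\rho_0\in L^1(\mathbb R^N;[0,R])$ with $\operatorname{spt}\rho_0\subseteq\Omega$ and every weak entropy (Kružkov) solution $\rho\in C^0([0,T];L^1(\mathbb R^N;[0,R]))$ of the Cauchy problem, $\operatorname{spt}\rho(t)\subseteq\Omega$ for all $t\in[0,T]$. -/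

import Mathlib

open MeasureTheory Set Filter Topology
open scoped ENNReal ContDiff

noncomputable section

namespace PedestrianTraffic

/-! ### Function spaces and differential operators -/

/-- `f ∈ W^{k,p}(μ)` for a function `f` of class `C^k` (at least on the open set carrying `μ`), the
only case needed below: its weak derivatives of order at most `k` are the classical ones. -/
def MemSobolev {X F : Type*} [NormedAddCommGroup X] [NormedSpace ℝ X] [MeasurableSpace X]
    [NormedAddCommGroup F] [NormedSpace ℝ F]
    (k : ℕ) (p : ℝ≥0∞) (f : X → F) (μ : Measure X) : Prop :=
  ∀ j ≤ k, MemLp (iteratedFDeriv ℝ j f) p μ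

/-- The norm `‖f‖_{W^{1,1}} = ‖f‖_{L¹} + ‖∇f‖_{L¹}` of a `C¹` function. -/
def normW11 {X F : Type*} [NormedAddCommGroup X] [NormedSpace ℝ X] [MeasureSpace X]
    [NormedAddCommGroup F] [NormedSpace ℝ F] (f : X → F) : ℝ≥0∞ :=
  eLpNorm f 1 volume + eLpNorm (fderiv ℝ f) 1 volume

/-- The norm `‖f‖_{W^{1,∞}} = max (‖f‖_{L^∞}, ‖∇f‖_{L^∞})` of a `C¹` function. -/
def normW1inf {X F : Type*} [NormedAddCommGroup X] [NormedSpace ℝ X] [MeasureSpace X]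
    [NormedAddCommGroup F] [NormedSpace ℝ F] (f : X → F) : ℝ≥0∞ :=
  max (eLpNorm f ∞ volume) (eLpNorm (fderiv ℝ f) ∞ volume)

variable {N : ℕ}

/-- The divergence of a vector field on `ℝ^N`. -/
def divergence (u : EuclideanSpace ℝ (Fin N) → EuclideanSpace ℝ (Fin N))
    (x : EuclideanSpace ℝ (Fin N)) : ℝ :=
  ∑ i : Fin N, (fderiv ℝ u x (EuclideanSpace.single i 1)) i

/-- Elements of `L¹(ℝ^N; [0,R])`. -/
def IsDensity (R : ℝ) (r : EuclideanSpace ℝ (Fin N) →₁[volume] ℝ) : Prop :=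
  ∀ᵐ x, r x ∈ Icc (0 : ℝ) R

/-- The (essential) support of an `L¹` function: the complement of the largest open set on which
it vanishes almost everywhere. -/
def spt (r : EuclideanSpace ℝ (Fin N) →₁[volume] ℝ) : Set (EuclideanSpace ℝ (Fin N)) :=
  {x | ∀ U ∈ 𝓝 x, ¬ ∀ᵐ y ∂(volume.restrict U), r y = 0}

/-! ### The general model and its assumptions -/

/-- Condition **(v)** on the speed law. -/
structure HypV (R V : ℝ) (v : ℝ → ℝ) : Prop where
  R_pos : 0 < R
  V_pos : 0 < V
  contDiff : ContDiff ℝ 2 v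
  antitone : Antitone v
  at_zero : v 0 = V
  at_R : v R = 0

/-- Condition **(ν)** on the preferred direction. -/
structure HypNu (ν : EuclideanSpace ℝ (Fin N) → EuclideanSpace ℝ (Fin N)) : Prop where
  contDiff : ContDiff ℝ 2 ν
  memW1inf : MemSobolev 1 ∞ ν volume
  div_memW11 : MemSobolev 1 1 (divergence ν) volume
  div_memW1inf : MemSobolev 1 ∞ (divergence ν) volume

/-- Condition **(I)** on the nonlocal operator, with (I.1), (I.2), (I.3). The space
`C²(ℝ^N; ℝ^N)` carries its usual topology: uniform convergence on compact sets of the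
derivatives of order at most two. -/
structure HypI (R : ℝ) (I : (EuclideanSpace ℝ (Fin N) →₁[volume] ℝ) →
    EuclideanSpace ℝ (Fin N) → EuclideanSpace ℝ (Fin N)) : Prop where
  contDiff : ∀ r, IsDensity R r → ContDiff ℝ 2 (I r)
  continuous : ∀ r₀, IsDensity R r₀ → ∀ K : Set (EuclideanSpace ℝ (Fin N)), IsCompact K →
    ∀ j ≤ 2, TendstoUniformlyOn (fun r => iteratedFDeriv ℝ j (I r)) (iteratedFDeriv ℝ j (I r₀))
      (𝓝[{r | IsDensity R r}] r₀) K
  I1 : ∃ C : ℝ → ℝ, MonotoneOn C (Ici 0) ∧ (∀ s, 0 ≤ s → 0 ≤ C s) ∧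
    ∀ r, IsDensity R r →
      normW1inf (I r) ≤ ENNReal.ofReal (C ‖r‖) ∧
      eLpNorm (divergence (I r)) 1 volume ≤ ENNReal.ofReal (C ‖r‖)
  I2 : ∃ C : ℝ → ℝ, MonotoneOn C (Ici 0) ∧ (∀ s, 0 ≤ s → 0 ≤ C s) ∧
    ∀ r, IsDensity R r →
      eLpNorm (fderiv ℝ (divergence (I r))) 1 volume ≤ ENNReal.ofReal (C ‖r‖)
  I3 : ∃ K : ℝ, ∀ r₁ r₂, IsDensity R r₁ → IsDensity R r₂ →
    eLpNorm (fun x => I r₁ x - I r₂ x) ∞ volume ≤ ENNReal.ofReal (K * ‖r₁ - r₂‖) ∧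
    eLpNorm (fun x => I r₁ x - I r₂ x) 1 volume
        + eLpNorm (divergence fun x => I r₁ x - I r₂ x) 1 volume
      ≤ ENNReal.ofReal (K * ‖r₁ - r₂‖)

/-- The common assumptions (v), (ν), (I) of the existence and of the stability theorem for
`∂ₜρ + div (ρ v(ρ) (ν(x) + I(ρ))) = 0`. -/
structure ModelAssumptions (R V : ℝ) (v : ℝ → ℝ)
    (ν : EuclideanSpace ℝ (Fin N) → EuclideanSpace ℝ (Fin N))
    (I : (EuclideanSpace ℝ (Fin N) →₁[volume] ℝ) →
      EuclideanSpace ℝ (Fin N) → EuclideanSpace ℝ (Fin N)) : Prop where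
  hv : HypV R V v
  hν : HypNu ν
  hI : HypI R I

/-- `ρ ∈ C⁰([0,T]; L¹(ℝ^N; [0,R]))` is a weak entropy solution on `[0,T]` of
`∂ₜρ + div (ρ v(ρ) (ν(x) + I(ρ))) = 0`, `ρ(0) = ρ₀`: a Kružkov solution of
`∂ₜρ + div (ρ v(ρ) w(t,x)) = 0` with `w(t,x) = ν(x) + I(ρ(t))(x)`. -/
structure IsWeakEntropySolution (R T : ℝ) (v : ℝ → ℝ)
    (ν : EuclideanSpace ℝ (Fin N) → EuclideanSpace ℝ (Fin N))
    (I : (EuclideanSpace ℝ (Fin N) →₁[volume] ℝ) →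
      EuclideanSpace ℝ (Fin N) → EuclideanSpace ℝ (Fin N))
    (ρ₀ : EuclideanSpace ℝ (Fin N) →₁[volume] ℝ)
    (ρ : ℝ → (EuclideanSpace ℝ (Fin N) →₁[volume] ℝ)) : Prop where
  continuousOn : ContinuousOn ρ (Icc 0 T)
  isDensity : ∀ t ∈ Icc 0 T, IsDensity R (ρ t)
  entropy : ∀ k : ℝ, ∀ ψ : ℝ × EuclideanSpace ℝ (Fin N) → ℝ,
    ContDiff ℝ ∞ ψ → HasCompactSupport ψ → (∀ t ≤ T, ∀ x, 0 ≤ ψ (t, x)) →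
    0 ≤ (∫ t in (0 : ℝ)..T, ∫ x,
          (|ρ t x - k| * deriv (fun s => ψ (s, x)) t
            + ((ρ t x * v (ρ t x) - k * v k)
                  * inner ℝ (ν x + I (ρ t) x) (gradient (fun y => ψ (t, y)) x)
                - k * v k * divergence (fun y => ν y + I (ρ t) y) x * ψ (t, x))
              * Real.sign (ρ t x - k)))
        + ∫ x, |ρ₀ x - k| * ψ (0, x)

/-- Property **(P)**: the model is invariant with respect to `Ω`. -/
def Invariant (R : ℝ) (v : ℝ → ℝ)
    (ν : EuclideanSpace ℝ (Fin N) → EuclideanSpace ℝ (Fin N))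
    (I : (EuclideanSpace ℝ (Fin N) →₁[volume] ℝ) →
      EuclideanSpace ℝ (Fin N) → EuclideanSpace ℝ (Fin N))
    (Ω : Set (EuclideanSpace ℝ (Fin N))) : Prop :=
  ∀ T : ℝ, 0 < T → ∀ ρ₀, IsDensity R ρ₀ → ∀ ρ, IsWeakEntropySolution R T v ν I ρ₀ ρ →
    spt ρ₀ ⊆ Ω → ∀ t ∈ Icc 0 T, spt (ρ t) ⊆ Ω

/-! ### The physical domain -/

/-- The distance `d_{∂Ω}` from the boundary is of class `C^k` on the set `S`: near `S` there is a
`C^k` function that coincides with it on `S`. -/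
def DistOfClass (k : ℕ) (Ω S : Set (EuclideanSpace ℝ (Fin N))) : Prop :=
  ∃ (U : Set (EuclideanSpace ℝ (Fin N))) (D : EuclideanSpace ℝ (Fin N) → ℝ),
    IsOpen U ∧ S ⊆ U ∧ ContDiffOn ℝ k D U ∧ ∀ x ∈ S, D x = Metric.infDist x (frontier Ω)

/-- Condition **(Ω)** with width `rΩ` of the strip along the walls. For `∂Ω = ∅` the strip is empty
and `rΩ` plays no role. -/
structure HypOmega (rΩ : ℝ) (Ω : Set (EuclideanSpace ℝ (Fin N))) : Prop where
  closure_open : ∃ O : Set (EuclideanSpace ℝ (Fin N)), IsOpen O ∧ IsConnected O ∧ Ω = closure O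
  rΩ_pos : 0 < rΩ
  dist_C2 : DistOfClass 2 Ω (Metric.thickening rΩ (frontier Ω) ∩ Ω)

/-- The inward normal `n = ∇ d_{∂Ω}`, on the strip in `Ω` (up to the boundary). -/
def inwardNormal (Ω : Set (EuclideanSpace ℝ (Fin N))) (x : EuclideanSpace ℝ (Fin N)) :
    EuclideanSpace ℝ (Fin N) :=
  gradientWithin (fun y => Metric.infDist y (frontier Ω)) Ω x

/-- Condition **(η)** on the convolution kernel. -/
structure HypEta (η : EuclideanSpace ℝ (Fin N) → ℝ) : Prop where
  contDiff : ContDiff ℝ 3 η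
  hasCompactSupport : HasCompactSupport η
  nonneg : ∀ x, 0 ≤ η x
  integral_eq_one : ∫ x, η x = 1

/-- Condition **(g)** on the optimal direction. -/
structure HypG (Ω : Set (EuclideanSpace ℝ (Fin N)))
    (g : EuclideanSpace ℝ (Fin N) → EuclideanSpace ℝ (Fin N)) : Prop where
  contDiff : ContDiff ℝ 2 g
  norm_eq_one : ∀ x, ‖g x‖ = 1
  fderiv_bounded : MemLp (fderiv ℝ g) ∞ volume
  div_memW11 : MemSobolev 1 1 (divergence g) volume
  div_memW1inf : MemSobolev 1 ∞ (divergence g) volume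
  inward : ∀ x ∈ frontier Ω, 0 ≤ inner ℝ (g x) (inwardNormal Ω x)

/-- Condition **(α)** on the function that confines the discomfort to the strip. -/
structure HypAlpha (rΩ : ℝ) (Ω : Set (EuclideanSpace ℝ (Fin N)))
    (α : EuclideanSpace ℝ (Fin N) → ℝ) : Prop where
  contDiff : ContDiff ℝ 2 α
  mem_Icc : ∀ x, α x ∈ Icc (0 : ℝ) 1
  eq_zero : ∀ x, Metric.ball x rΩ ⊆ Ω → α x = 0
  eq_one : ∀ x ∈ frontier Ω, α x = 1

/-- `ν = g + δ` on `Ω`, with the discomfort `δ = lam α n`. The normal `n` is available only in the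
strip inside `Ω` (elsewhere in `Ω` the factor `α` vanishes), so that `ν` is prescribed on `Ω`
and is, outside `Ω`, an extension. -/
def IsGPlusDiscomfort (lam : ℝ) (Ω : Set (EuclideanSpace ℝ (Fin N)))
    (g : EuclideanSpace ℝ (Fin N) → EuclideanSpace ℝ (Fin N))
    (α : EuclideanSpace ℝ (Fin N) → ℝ)
    (ν : EuclideanSpace ℝ (Fin N) → EuclideanSpace ℝ (Fin N)) : Prop :=
  ∀ x ∈ Ω, ν x = g x + (lam * α x) • inwardNormal Ω x

/-! ### The anisotropic nonlocal operator -/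

/-- The weighted average `x ↦ ∫_D ρ(y) η(x-y) φ((y-x)·g(x)) dy`. -/
def weightedAverage (η : EuclideanSpace ℝ (Fin N) → ℝ) (φ : ℝ → ℝ)
    (g : EuclideanSpace ℝ (Fin N) → EuclideanSpace ℝ (Fin N))
    (D : Set (EuclideanSpace ℝ (Fin N))) (ρ : EuclideanSpace ℝ (Fin N) →₁[volume] ℝ)
    (x : EuclideanSpace ℝ (Fin N)) : ℝ :=
  ∫ y in D, ρ y * η (x - y) * φ (inner ℝ (y - x) (g x))

/-- The operator `I(ρ) = -ε ∇A / √(1 + ‖∇A‖²)`, where `A` is the weighted average of `ρ` over `D`. -/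
def anisotropicI (ε : ℝ) (η : EuclideanSpace ℝ (Fin N) → ℝ) (φ : ℝ → ℝ)
    (g : EuclideanSpace ℝ (Fin N) → EuclideanSpace ℝ (Fin N))
    (D : Set (EuclideanSpace ℝ (Fin N))) (ρ : EuclideanSpace ℝ (Fin N) →₁[volume] ℝ)
    (x : EuclideanSpace ℝ (Fin N)) : EuclideanSpace ℝ (Fin N) :=
  -((ε / √(1 + ‖gradient (weightedAverage η φ g D ρ) x‖ ^ 2)) •
    gradient (weightedAverage η φ g D ρ) x)

end PedestrianTraffic

end

open PedestrianTraffic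

/-! Condition (I). The average `A_ρ` is an integral operator with kernel `k(x,y) = η(x-y)
φ((y-x)·g(x))`, which is `C³`, vanishes for `|x-y| > M` and has `x`-derivatives up to order three
bounded by one constant `C`: the factor `y - x` is unbounded, but only `|y-x| ≤ M` matters.
Differentiating under the integral, every derivative of `A_ρ` of order at most three is bounded at
`x` by `C ∫_{B(x,M)} |ρ|`. This local mass is at most `R |B_M|`, at most `‖ρ‖`, and by Tonelli its
integral over `x` is `|B_M| ‖ρ‖`, which gives the sup bounds and the `L¹` bounds at once. Now `I(ρ)
= Φ(∇A_ρ)` with `Φ` smooth, and the gradients of all densities lie in one fixed ball, where `Φ`,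
`DΦ`, `D²Φ` are bounded and `Φ`, `DΦ` are Lipschitz; `A_ρ` is linear in `ρ`, so the Lipschitz
estimates follow from the same bound applied to `ρ₁ - ρ₂` (`hypI_anisotropicI`).

Condition (ν). A Lipschitz integrable function equal to one on the boundary forces the boundary to
be bounded (`isBounded_of_memLp_one_of_eq_one`), so both alternatives reduce to a compact boundary.
The discomfort is then multiplied by a smooth cutoff equal to one on the compact closed strip, and
`ν` differs from `g` by a compactly supported `C²` field.

Invariance. Let `p` be a boundary point nearest to some interior point, and `n` the unit vector
pointing to it. Continuity of the gradient identifies `n` with the inward normal at `p`. In the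
directional derivative of `A_ρ` along `n` the term with `-φ' g·n` has a favourable sign and the
others are absorbed by the smallness condition, so `I(ρ)·n ≥ -λ` and `(ν + I(ρ))·n ≥ g·n + λ - λ ≥
0` at `p` (`neg_le_inner_anisotropicI`, `inner_velocity_nonneg`).

The entropy inequality with `k = 0`, for nonnegative densities, is a mass balance: a weighted mass
grows no faster than its flux. The weight is `χ = wallCutoff · ζ`, where the first factor drops from
one outside `Ω` to zero at depth `h` and `ζ` cuts off at radius `M`. At depth `d < h` the gradient
of the wall factor is a nonpositive multiple of `n` of size `O(1/h)`, while the velocity has inward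
component at least `-Λ d`; the product is bounded uniformly in `h` (`inner_gradient_wallCutoff_le`)
and lives on a strip whose volume tends to zero. The radial factor costs `O(1/M)`. The initial
weighted mass is at most `R` times the volume of the strip, because the boundary is a null set.
Letting `h → 0` and then `M → ∞` leaves no mass outside `Ω` (`invariant_of_inner_nonneg`).

The boundary facts needed (unique differentials on `Ω`, a null boundary) come from an interior
sphere condition, which is derived from `C¹` regularity of the distance alone. -/

set_option linter.unusedSectionVars false

/-! ### Families of functions with jointly continuous derivatives -/

/-- A family `f r`, `r ∈ P`, of `C^n` functions whose derivatives of order at most `n` are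
continuous in the parameter and the variable jointly. -/
structure JointContDiff {P E F : Type*} [TopologicalSpace P] [NormedAddCommGroup E]
    [NormedSpace ℝ E] [NormedAddCommGroup F] [NormedSpace ℝ F] (n : ℕ) (f : P → E → F) : Prop where
  contDiff : ∀ r, ContDiff ℝ n (f r)
  continuous : ∀ j ≤ n, Continuous fun p : P × E => iteratedFDeriv ℝ j (f p.1) p.2

namespace JointContDiff

universe u

variable {P : Type*} [TopologicalSpace P] {E F G H : Type u} [NormedAddCommGroup E]
  [NormedSpace ℝ E] [NormedAddCommGroup F] [NormedSpace ℝ F] [NormedAddCommGroup G]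
  [NormedSpace ℝ G] [NormedAddCommGroup H] [NormedSpace ℝ H] {n : ℕ}

theorem continuous_uncurry {f : P → E → F} (h : JointContDiff n f) :
    Continuous fun p : P × E => f p.1 p.2 := by
  have := h.continuous 0 (Nat.zero_le _)
  simp only [iteratedFDeriv_zero_eq_comp, Function.comp_apply] at this
  exact ((continuousMultilinearCurryFin0 ℝ E F).symm.comp_continuous_iff).1 this

theorem of_continuous {f : P → E → F} (h : Continuous fun p : P × E => f p.1 p.2) :
    JointContDiff 0 f where
  contDiff r := contDiff_zero.2 (h.comp (Continuous.prodMk_right r))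
  continuous j hj := by
    obtain rfl : j = 0 := by omega
    simp only [iteratedFDeriv_zero_eq_comp, Function.comp_apply]
    exact (continuousMultilinearCurryFin0 ℝ E F).symm.continuous.comp h

/-- Currying is an isometry between derivatives of order `j + 1` of `f` and derivatives of order `j`
of `fderiv ℝ f`. This recursive form carries all the inductions on the order below. -/
theorem succ_iff {f : P → E → F} :
    JointContDiff (n + 1) f ↔ Continuous (fun p : P × E => f p.1 p.2) ∧
      (∀ r, Differentiable ℝ (f r)) ∧ JointContDiff n fun r => fderiv ℝ (f r) := by
  constructor
  · intro h
    refine ⟨h.continuous_uncurry, fun r => (h.contDiff r).differentiable (by simp), ?_, ?_⟩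
    · intro r
      exact (h.contDiff r).fderiv_right (by norm_cast)
    · intro j hj
      have := h.continuous (j + 1) (by omega)
      simp only [iteratedFDeriv_succ_eq_comp_right, Function.comp_apply] at this
      exact ((continuousMultilinearCurryRightEquiv' ℝ j E F).symm.comp_continuous_iff).1 this
  · rintro ⟨h0, hd, h⟩
    refine ⟨fun r => ?_, ?_⟩
    · push_cast
      rw [contDiff_succ_iff_fderiv]
      exact ⟨hd r, by simp, h.contDiff r⟩
    · rintro (_ | j) hj
      · exact (of_continuous h0).continuous 0 le_rfl
      · simp only [iteratedFDeriv_succ_eq_comp_right, Function.comp_apply]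
        exact ((continuousMultilinearCurryRightEquiv' ℝ j E F).symm.comp_continuous_iff).2
          (h.continuous j (by omega))

theorem of_succ {f : P → E → F} (h : JointContDiff (n + 1) f) : JointContDiff n f :=
  ⟨fun r => (h.contDiff r).of_le (by norm_cast; omega), fun j hj => h.continuous j (by omega)⟩

theorem add {f g : P → E → F} (hf : JointContDiff n f) (hg : JointContDiff n g) :
    JointContDiff n fun r x => f r x + g r x where
  contDiff r := (hf.contDiff r).add (hg.contDiff r)
  continuous j hj := by
    have : ∀ p : P × E, iteratedFDeriv ℝ j (fun x => f p.1 x + g p.1 x) p.2 =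
        iteratedFDeriv ℝ j (f p.1) p.2 + iteratedFDeriv ℝ j (g p.1) p.2 := fun p =>
      iteratedFDeriv_add_apply ((hf.contDiff p.1).of_le (by exact_mod_cast hj)).contDiffAt
        ((hg.contDiff p.1).of_le (by exact_mod_cast hj)).contDiffAt
    simp only [this]
    exact (hf.continuous j hj).add (hg.continuous j hj)

/-- By the Leibniz rule the derivative is a sum of two expressions of the same kind, with other
codomains. The induction therefore generalizes the codomains, which is why all spaces share one
universe. -/
theorem bilinear (B : F →L[ℝ] G →L[ℝ] H) {f : P → E → F} {g : P → E → G}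
    (hf : JointContDiff n f) (hg : JointContDiff n g) :
    JointContDiff n fun r x => B (f r x) (g r x) := by
  induction n generalizing F G H with
  | zero =>
    refine of_continuous ?_
    exact (B.continuous.comp hf.continuous_uncurry).clm_apply hg.continuous_uncurry
  | succ n ih =>
    have hf' := succ_iff.1 hf
    have hg' := succ_iff.1 hg
    refine succ_iff.2 ⟨?_, fun r x => ?_, ?_⟩
    · exact (B.continuous.comp hf.continuous_uncurry).clm_apply hg.continuous_uncurry
    · exact (B.hasFDerivAt_of_bilinear (hf'.2.1 r x).hasFDerivAt
        (hg'.2.1 r x).hasFDerivAt).differentiableAt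
    · have : (fun r => fderiv ℝ fun x => B (f r x) (g r x)) = fun r x =>
          B.precompR E (f r x) (fderiv ℝ (g r) x) + B.precompL E (fderiv ℝ (f r) x) (g r x) := by
        ext1 r
        ext1 x
        exact B.fderiv_of_bilinear (hf'.2.1 r x) (hg'.2.1 r x)
      rw [this]
      exact (ih (B.precompR E) hf.of_succ hg'.2.2).add (ih (B.precompL E) hf'.2.2 hg.of_succ)

/-- The chain rule writes the derivative as a bilinear composition of `fderiv ℝ Φ ∘ f` and `fderiv ℝ
f`; induction handles the first factor, `bilinear` the product. -/
theorem comp {Φ : F → G} (hΦ : ContDiff ℝ n Φ) {f : P → E → F} (hf : JointContDiff n f) :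
    JointContDiff n fun r x => Φ (f r x) := by
  induction n generalizing G with
  | zero => exact of_continuous (hΦ.continuous.comp hf.continuous_uncurry)
  | succ n ih =>
    have hf' := succ_iff.1 hf
    have hd : Differentiable ℝ Φ := hΦ.differentiable (by simp)
    refine succ_iff.2 ⟨hΦ.continuous.comp hf.continuous_uncurry, fun r => ?_, ?_⟩
    · exact hd.comp (hf'.2.1 r)
    · have : (fun r => fderiv ℝ fun x => Φ (f r x)) = fun r x =>
          ContinuousLinearMap.compL ℝ E F G (fderiv ℝ Φ (f r x)) (fderiv ℝ (f r) x) := by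
        ext1 r
        ext1 x
        exact fderiv_comp x (hd _) (hf'.2.1 r x)
      rw [this]
      exact bilinear _ (ih (hΦ.fderiv_right (by norm_cast)) hf.of_succ) hf'.2.2

/-- Joint continuity at the points `(r₀, x)` is locally uniform convergence, and on a compact set
this is uniform convergence. -/
theorem tendstoUniformlyOn {f : P → E → F} (hf : JointContDiff n f) {j : ℕ} (hj : j ≤ n)
    {K : Set E} (hK : IsCompact K) (r₀ : P) :
    TendstoUniformlyOn (fun r => iteratedFDeriv ℝ j (f r)) (iteratedFDeriv ℝ j (f r₀))
      (𝓝 r₀) K := by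
  rw [← tendstoLocallyUniformlyOn_iff_tendstoUniformlyOn_of_compact hK,
    tendstoLocallyUniformlyOn_iff_forall_tendsto]
  intro x _
  have h1 : Tendsto (fun p : P × E => iteratedFDeriv ℝ j (f r₀) p.2) (𝓝 (r₀, x))
      (𝓝 (iteratedFDeriv ℝ j (f r₀) x)) :=
    ((hf.continuous j hj).comp ((Continuous.prodMk_right r₀).comp continuous_snd)).tendsto (r₀, x)
  have h2 := (hf.continuous j hj).tendsto (r₀, x)
  have h3 := (h1.prodMk_nhds h2).mono_right (nhds_le_uniformity _)
  refine h3.mono_left ?_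
  rw [nhds_prod_eq]
  exact Filter.prod_mono le_rfl nhdsWithin_le_nhds

end JointContDiff

/-! ### Integral operators with smooth, compactly supported kernels -/

section Kernel

universe u

variable {E F : Type u} [NormedAddCommGroup E] [NormedSpace ℝ E] [MeasureSpace E] [BorelSpace E]
  [FiniteDimensional ℝ E] [(volume : Measure E).IsAddHaarMeasure]
  [NormedAddCommGroup F] [NormedSpace ℝ F]

/-- `x ↦ ∫_D r(y) k(x,y) dy`. -/
noncomputable def kernelOperator (D : Set E) (k : E → E → F) (r : E →₁[volume] ℝ) (x : E) : F :=
  ∫ y in D, r y • k x y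

/-- The kernel `k` is `C^n`, with derivatives in `x` of order at most `n` bounded by `C`, and
`k x y` vanishes for `|x - y| > M`. -/
structure KernelBound (n : ℕ) (C M : ℝ) (k : E → E → F) : Prop where
  contDiff : ContDiff ℝ n fun p : E × E => k p.1 p.2
  bound : ∀ j ≤ n, ∀ x y, ‖iteratedFDeriv ℝ j (fun z => k z y) x‖ ≤ C
  eq_zero : ∀ x y, M < dist y x → k x y = 0

namespace KernelBound

variable {n : ℕ} {C M : ℝ} {D : Set E} {k : E → E → F}

theorem norm_le (h : KernelBound n C M k) (x y : E) : ‖k x y‖ ≤ C := by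
  simpa using h.bound 0 (Nat.zero_le _) x y

theorem C_nonneg (h : KernelBound n C M k) : 0 ≤ C := (norm_nonneg _).trans (h.norm_le 0 0)

theorem continuous_right (h : KernelBound n C M k) (x : E) : Continuous fun y => k x y :=
  h.contDiff.continuous.comp (Continuous.prodMk_right x)

theorem integrable (h : KernelBound n C M k) (r : E →₁[volume] ℝ) (x : E) :
    Integrable fun y => r y • k x y := by
  refine ((L1.integrable_coeFn r).norm.mul_const C).mono'
    ((L1.integrable_coeFn r).aestronglyMeasurable.smul
      (h.continuous_right x).aestronglyMeasurable) (Eventually.of_forall fun y => ?_)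
  rw [norm_smul]
  exact mul_le_mul_of_nonneg_left (h.norm_le x y) (norm_nonneg _)

/-- Keeping the local mass on the right, instead of the norm of `r`, leaves both uses open: a bound
of the supremum and, after integration in `x`, an `L¹` bound. -/
theorem norm_kernelOperator_le (h : KernelBound n C M k) (r : E →₁[volume] ℝ) (x : E) :
    ‖kernelOperator D k r x‖ ≤ C * ∫ y in Metric.closedBall x M, |r y| := by
  have hi := h.integrable r x
  calc ‖kernelOperator D k r x‖ ≤ ∫ y in D, ‖r y • k x y‖ := norm_integral_le_integral_norm _
    _ ≤ ∫ y, ‖r y • k x y‖ :=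
      setIntegral_le_integral hi.norm (Eventually.of_forall fun y => norm_nonneg _)
    _ ≤ ∫ y, (Metric.closedBall x M).indicator (fun y => C * |r y|) y := by
      refine integral_mono hi.norm
        (((L1.integrable_coeFn r).abs.const_mul C).indicator measurableSet_closedBall) fun y => ?_
      by_cases hy : y ∈ Metric.closedBall x M
      · rw [indicator_of_mem hy]
        simp only [norm_smul, Real.norm_eq_abs]
        rw [mul_comm]
        exact mul_le_mul_of_nonneg_right (h.norm_le x y) (abs_nonneg _)
      · rw [indicator_of_notMem hy]
        rw [Metric.mem_closedBall, not_le] at hy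
        simp [h.eq_zero x y hy]
    _ = C * ∫ y in Metric.closedBall x M, |r y| := by
      rw [integral_indicator measurableSet_closedBall, integral_const_mul]

theorem kernelOperator_sub (h : KernelBound n C M k) (r₁ r₂ : E →₁[volume] ℝ) (x : E) :
    kernelOperator D k (r₁ - r₂) x = kernelOperator D k r₁ x - kernelOperator D k r₂ x := by
  unfold kernelOperator
  rw [← integral_sub (h.integrable r₁ x).integrableOn (h.integrable r₂ x).integrableOn]
  refine integral_congr_ae (ae_restrict_of_ae ?_)
  filter_upwards [Lp.coeFn_sub r₁ r₂] with y hy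
  rw [hy, Pi.sub_apply, sub_smul]

/-- The constants `C` and `M` survive differentiation in `x`, so that estimates proved at order zero
pass to all orders. -/
theorem fderiv (h : KernelBound (n + 1) C M k) :
    KernelBound n C M fun x y => fderiv ℝ (fun z => k z y) x where
  contDiff := by
    have h1 : ContDiff ℝ (n + 1) (Function.uncurry fun (p : E × E) (z : E) => k z p.2) := by
      have : ContDiff ℝ (n + 1) fun q : (E × E) × E => (q.2, q.1.2) := by fun_prop
      have h2 := h.contDiff
      push_cast at h2
      exact h2.comp this
    exact h1.fderiv (g := fun p : E × E => p.1) contDiff_fst le_rfl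
  bound j hj x y := by
    rw [norm_iteratedFDeriv_fderiv]
    exact h.bound (j + 1) (by omega) x y
  eq_zero x y hxy := by
    have : (fun z => k z y) =ᶠ[𝓝 x] fun _ => 0 := by
      -- The strict inequality is an open condition, so the kernel vanishes near `x` and its
      -- derivative vanishes too.
      have ho : IsOpen {z | M < dist y z} := isOpen_lt continuous_const (by fun_prop)
      filter_upwards [ho.mem_nhds hxy] with z hz using h.eq_zero z y hz
    rw [this.fderiv_eq]
    simp

theorem hasFDerivAt_kernelOperator (h : KernelBound (n + 1) C M k) (r : E →₁[volume] ℝ) (x : E) :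
    HasFDerivAt (kernelOperator D k r)
      (kernelOperator D (fun x y => _root_.fderiv ℝ (fun z => k z y) x) r x) x := by
  have hk (y : E) : Differentiable ℝ fun z => k z y :=
    (h.contDiff.comp (contDiff_id.prodMk contDiff_const)).differentiable (by simp)
  refine hasFDerivAt_integral_of_dominated_of_fderiv_le (μ := volume.restrict D) (s := univ)
    (F' := fun x y => r y • _root_.fderiv ℝ (fun z => k z y) x)
    (bound := fun y => |r y| * C) univ_mem
    (Eventually.of_forall fun z => (h.integrable r z).integrableOn.aestronglyMeasurable)
    (h.integrable r x).integrableOn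
    (h.fderiv.integrable r x).integrableOn.aestronglyMeasurable ?_ ?_ ?_
  · refine Eventually.of_forall fun y z _ => ?_
    rw [norm_smul, Real.norm_eq_abs]
    exact mul_le_mul_of_nonneg_left (h.fderiv.norm_le z y) (abs_nonneg _)
  · exact ((L1.integrable_coeFn r).abs.mul_const C).integrableOn
  · exact Eventually.of_forall fun y z _ => ((hk y z).hasFDerivAt).const_smul (r y)

theorem fderiv_kernelOperator (h : KernelBound (n + 1) C M k) (r : E →₁[volume] ℝ) :
    _root_.fderiv ℝ (kernelOperator D k r) =
      kernelOperator D (fun x y => _root_.fderiv ℝ (fun z => k z y) x) r :=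
  funext fun x => (h.hasFDerivAt_kernelOperator r x).fderiv

theorem norm_iteratedFDeriv_kernelOperator_le (h : KernelBound n C M k) {j : ℕ} (hj : j ≤ n)
    (r : E →₁[volume] ℝ) (x : E) :
    ‖iteratedFDeriv ℝ j (kernelOperator D k r) x‖ ≤ C * ∫ y in Metric.closedBall x M, |r y| := by
  induction j generalizing F n with
  | zero => simpa using h.norm_kernelOperator_le r x
  | succ j ih =>
    obtain ⟨n, rfl⟩ : ∃ m, n = m + 1 := ⟨n - 1, by omega⟩
    rw [← norm_iteratedFDeriv_fderiv, h.fderiv_kernelOperator]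
    exact ih h.fderiv (by omega)

theorem setIntegral_abs_le_norm (r : E →₁[volume] ℝ) (s : Set E) : ∫ y in s, |r y| ≤ ‖r‖ := by
  rw [L1.norm_eq_integral_norm]
  exact setIntegral_le_integral (L1.integrable_coeFn r).abs
    (Eventually.of_forall fun y => abs_nonneg _)

theorem jointContDiff (h : KernelBound n C M k) : JointContDiff n (kernelOperator D k) := by
  have hc {n : ℕ} {F : Type u} [NormedAddCommGroup F] [NormedSpace ℝ F] {k : E → E → F}
      (h : KernelBound n C M k) : Continuous fun p : (E →₁[volume] ℝ) × E =>
        kernelOperator D k p.1 p.2 := by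
    -- Continuity in `x` by dominated convergence, and a Lipschitz constant in `r` that does not
    -- depend on `x`, give joint continuity.
    refine continuous_prod_of_continuous_lipschitzWith _ C.toNNReal (fun r => ?_) fun x => ?_
    · refine continuous_of_dominated (bound := fun y => |r y| * C)
        (fun x => (h.integrable r x).integrableOn.aestronglyMeasurable) (fun x => ?_)
        ((L1.integrable_coeFn r).abs.mul_const C).integrableOn ?_
      · refine Eventually.of_forall fun y => ?_
        rw [norm_smul, Real.norm_eq_abs]
        exact mul_le_mul_of_nonneg_left (h.norm_le x y) (abs_nonneg _)
      · refine Eventually.of_forall fun y => ?_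
        have : Continuous fun x => k x y := h.contDiff.continuous.comp (Continuous.prodMk_left y)
        exact this.const_smul (r y)
    · refine LipschitzWith.of_dist_le_mul fun r₁ r₂ => ?_
      rw [dist_eq_norm, dist_eq_norm, ← h.kernelOperator_sub, Real.coe_toNNReal _ h.C_nonneg]
      exact (h.norm_kernelOperator_le _ _).trans
        (mul_le_mul_of_nonneg_left (setIntegral_abs_le_norm _ _) h.C_nonneg)
  induction n generalizing F with
  | zero => exact JointContDiff.of_continuous (hc h)
  | succ n ih =>
    refine JointContDiff.succ_iff.2 ⟨hc h,
      fun r x => (h.hasFDerivAt_kernelOperator r x).differentiableAt, ?_⟩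
    simp only [h.fderiv_kernelOperator]
    exact ih h.fderiv

end KernelBound

end Kernel

/-! ### Pointwise bounds for derivatives of products and compositions -/

section PointwiseBounds

variable {E F G : Type*} [NormedAddCommGroup E] [NormedSpace ℝ E] [NormedAddCommGroup F]
  [NormedSpace ℝ F] [NormedAddCommGroup G] [NormedSpace ℝ G] {n : ℕ}

/-- The points where the essential bound holds form a closed set of full measure, which is dense and
hence everything. -/
theorem norm_le_of_memLp_top [MeasurableSpace E] [BorelSpace E] {μ : Measure E}
    [μ.IsOpenPosMeasure] {f : E → F} (hf : Continuous f) (h : MemLp f ∞ μ) (x : E) :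
    ‖f x‖ ≤ (eLpNorm f ∞ μ).toReal := by
  have hd : Dense {x | ‖f x‖ ≤ (eLpNorm f ∞ μ).toReal} := by
    refine Measure.dense_of_ae (μ := μ) ?_
    filter_upwards [ae_le_eLpNormEssSup (f := f) (μ := μ)] with y hy
    rw [← eLpNorm_exponent_top] at hy
    have := ENNReal.toReal_mono h.eLpNorm_ne_top hy
    simpa using this
  have hcl : IsClosed {x | ‖f x‖ ≤ (eLpNorm f ∞ μ).toReal} :=
    isClosed_le hf.norm continuous_const
  have hu := hcl.closure_eq.symm.trans hd.closure_eq
  exact hu.ge (mem_univ x)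

theorem norm_iteratedFDeriv_bilinear_le_of_forall_le (B : E →L[ℝ] F →L[ℝ] G) (hB : ‖B‖ ≤ 1)
    {D : Type*} [NormedAddCommGroup D] [NormedSpace ℝ D] {f : D → E} {g : D → F}
    (hf : ContDiff ℝ n f) (hg : ContDiff ℝ n g) {x : D} {a b : ℝ}
    (ha : ∀ j ≤ n, ‖iteratedFDeriv ℝ j f x‖ ≤ a) (hb : ∀ j ≤ n, ‖iteratedFDeriv ℝ j g x‖ ≤ b)
    {j : ℕ} (hj : j ≤ n) : ‖iteratedFDeriv ℝ j (fun y => B (f y) (g y)) x‖ ≤ 2 ^ n * a * b := by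
  have ha0 : 0 ≤ a := (norm_nonneg _).trans (ha 0 (Nat.zero_le _))
  have hb0 : 0 ≤ b := (norm_nonneg _).trans (hb 0 (Nat.zero_le _))
  calc _ ≤ ∑ i ∈ Finset.range (j + 1), (j.choose i : ℝ) * ‖iteratedFDeriv ℝ i f x‖ *
        ‖iteratedFDeriv ℝ (j - i) g x‖ :=
      B.norm_iteratedFDeriv_le_of_bilinear_of_le_one hf hg x (by exact_mod_cast hj) hB
    _ ≤ ∑ i ∈ Finset.range (j + 1), (j.choose i : ℝ) * a * b := by
      refine Finset.sum_le_sum fun i hi => ?_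
      have : i < j + 1 := Finset.mem_range.1 hi
      gcongr
      · exact ha i (by omega)
      · exact hb _ (by omega)
    _ = 2 ^ j * a * b := by
      rw [← Finset.sum_mul, ← Finset.sum_mul]
      congr 2
      exact_mod_cast Nat.sum_range_choose j
    _ ≤ _ := by
      gcongr
      norm_num

theorem norm_iteratedFDeriv_comp_le_of_forall_le {Φ : F → G} {f : E → F} (hΦ : ContDiff ℝ n Φ)
    (hf : ContDiff ℝ n f) {x : E} {c b : ℝ}
    (hc : ∀ j ≤ n, ‖iteratedFDeriv ℝ j Φ (f x)‖ ≤ c)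
    (hb1 : 1 ≤ b) (hb : ∀ j ≤ n, ‖iteratedFDeriv ℝ j f x‖ ≤ b) {j : ℕ} (hj : j ≤ n) :
    ‖iteratedFDeriv ℝ j (fun y => Φ (f y)) x‖ ≤ n.factorial * c * b ^ n := by
  have hc0 : 0 ≤ c := (norm_nonneg _).trans (hc 0 (Nat.zero_le _))
  -- The composition estimate asks for a bound of the `i`-th derivative by `b ^ i`; `b` itself
  -- suffices because `1 ≤ b` and `i ≠ 0`.
  refine (norm_iteratedFDeriv_comp_le hΦ hf (n := j) (by exact_mod_cast hj) x
    (fun i hi => hc i (hi.trans hj))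
    (fun i hi hij => (hb i (hij.trans hj)).trans (le_self_pow₀ hb1 (by omega)))).trans ?_
  gcongr

/-- The value is at most `M`, the first derivative has norm at most one, and the rest vanish; `M +
1` covers all orders. -/
theorem norm_iteratedFDeriv_const_sub_le (x y : E) {M : ℝ} (h : dist y x ≤ M) (j : ℕ) :
    ‖iteratedFDeriv ℝ j (fun z : E => y - z) x‖ ≤ M + 1 := by
  have hM : 0 ≤ M := dist_nonneg.trans h
  rcases j with _ | j
  · rw [norm_iteratedFDeriv_zero, ← dist_eq_norm]
    linarith
  · rw [← norm_iteratedFDeriv_fderiv]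
    have : fderiv ℝ (fun z : E => y - z) = fun _ => -ContinuousLinearMap.id ℝ E := by
      ext1 z
      rw [fderiv_const_sub, fderiv_fun_id]
    rw [this]
    rcases j with _ | j
    · rw [norm_iteratedFDeriv_zero, norm_neg]
      linarith [ContinuousLinearMap.norm_id_le (𝕜 := ℝ) (E := E)]
    · rw [iteratedFDeriv_succ_const]
      simp
      linarith

end PointwiseBounds

/-! ### The kernel of the anisotropic average -/

section AnisotropicKernel

variable {N : ℕ}

/-- The kernel `η(x-y) φ((y-x)·g(x))` of the weighted average. -/
noncomputable def anisotropicKernel (η : EuclideanSpace ℝ (Fin N) → ℝ) (φ : ℝ → ℝ)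
    (g : EuclideanSpace ℝ (Fin N) → EuclideanSpace ℝ (Fin N)) (x y : EuclideanSpace ℝ (Fin N)) :
    ℝ :=
  η (x - y) * φ (inner ℝ (y - x) (g x))

theorem weightedAverage_eq_kernelOperator (η : EuclideanSpace ℝ (Fin N) → ℝ) (φ : ℝ → ℝ)
    (g : EuclideanSpace ℝ (Fin N) → EuclideanSpace ℝ (Fin N)) (D : Set (EuclideanSpace ℝ (Fin N)))
    (r : EuclideanSpace ℝ (Fin N) →₁[volume] ℝ) :
    weightedAverage η φ g D r = kernelOperator D (anisotropicKernel η φ g) r := by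
  ext x
  simp [weightedAverage, kernelOperator, anisotropicKernel, mul_assoc]

theorem exists_kernelBound_anisotropicKernel {n : ℕ} {η : EuclideanSpace ℝ (Fin N) → ℝ}
    {φ : ℝ → ℝ} {g : EuclideanSpace ℝ (Fin N) → EuclideanSpace ℝ (Fin N)}
    (hη : ContDiff ℝ n η) (hηc : HasCompactSupport η) (hφ : ContDiff ℝ n φ)
    (hφW : MemSobolev n ∞ φ volume) (hg : ContDiff ℝ n g) (hgW : MemSobolev n ∞ g volume) :
    ∃ C M, KernelBound n C M (anisotropicKernel η φ g) := by
  obtain ⟨M, hM⟩ := hηc.isCompact.isBounded.subset_closedBall 0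
  have hηb : ∃ a, ∀ j ≤ n, ∀ x, ‖iteratedFDeriv ℝ j η x‖ ≤ a := by
    have : ∀ j ≤ n, ∃ a, ∀ x, ‖iteratedFDeriv ℝ j η x‖ ≤ a := fun j hj =>
      (hηc.iteratedFDeriv j).exists_bound_of_continuous
        (hη.continuous_iteratedFDeriv (by exact_mod_cast hj))
    choose! a ha using this
    refine ⟨∑ i ∈ Finset.range (n + 1), |a i|, fun j hj x => (ha j hj x).trans ?_⟩
    exact (le_abs_self _).trans (Finset.single_le_sum (f := fun i => |a i|)
      (fun i _ => abs_nonneg _) (Finset.mem_range.2 (by omega)))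
  have hsob {X F : Type} [NormedAddCommGroup X] [NormedSpace ℝ X] [MeasurableSpace X]
      [BorelSpace X] {μ : Measure X} [μ.IsOpenPosMeasure] [NormedAddCommGroup F]
      [NormedSpace ℝ F] {f : X → F} (hf : ContDiff ℝ n f) (h : MemSobolev n ∞ f μ) :
      ∃ a, ∀ j ≤ n, ∀ x, ‖iteratedFDeriv ℝ j f x‖ ≤ a := by
    refine ⟨∑ i ∈ Finset.range (n + 1), (eLpNorm (iteratedFDeriv ℝ i f) ∞ μ).toReal,
      fun j hj x => (norm_le_of_memLp_top
        (hf.continuous_iteratedFDeriv (by exact_mod_cast hj)) (h j hj) x).trans ?_⟩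
    exact Finset.single_le_sum (f := fun i => (eLpNorm (iteratedFDeriv ℝ i f) ∞ μ).toReal)
      (fun i _ => ENNReal.toReal_nonneg) (Finset.mem_range.2 (by omega))
  obtain ⟨a, ha⟩ := hηb
  obtain ⟨c, hc⟩ := hsob hφ hφW
  obtain ⟨b, hb⟩ := hsob hg hgW
  have ha0 : 0 ≤ a := (norm_nonneg _).trans (ha 0 (Nat.zero_le _) 0)
  have hc0 : 0 ≤ c := (norm_nonneg _).trans (hc 0 (Nat.zero_le _) 0)
  have hcd : ContDiff ℝ n fun p : EuclideanSpace ℝ (Fin N) × EuclideanSpace ℝ (Fin N) =>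
      anisotropicKernel η φ g p.1 p.2 := by
    have h1 : ContDiff ℝ n fun p : EuclideanSpace ℝ (Fin N) × EuclideanSpace ℝ (Fin N) =>
        (inner ℝ (p.2 - p.1) (g p.1) : ℝ) :=
      ContDiff.inner ℝ (by fun_prop) (hg.comp contDiff_fst)
    exact (hη.comp (by fun_prop)).mul (hφ.comp h1)
  have hz (x y) (h : M < dist y x) : anisotropicKernel η φ g x y = 0 := by
    have : η (x - y) = 0 := by
      by_contra hne
      have := hM (subset_tsupport η hne)
      rw [mem_closedBall_zero_iff, ← dist_eq_norm, dist_comm] at this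
      linarith
    rw [anisotropicKernel, this, zero_mul]
  -- From the inside out: Leibniz for the phase `(y - z)·g(z)`, the composition bound for `φ` of the
  -- phase (whence the maximum with `1`), and Leibniz for the product with `η`.
  refine ⟨2 ^ n * a * (n.factorial * c * (max 1 (2 ^ n * (M + 1) * b)) ^ n), M, hcd, ?_, hz⟩
  intro j hj x y
  -- The phase has no global bound. For distant `y` the kernel vanishes near `x`; otherwise `|y - x|
  -- ≤ M`.
  rcases lt_or_ge M (dist y x) with h | h
  · have : (fun z => anisotropicKernel η φ g z y) =ᶠ[𝓝 x] fun _ => 0 := by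
      have ho : IsOpen {z | M < dist y z} := isOpen_lt continuous_const (by fun_prop)
      filter_upwards [ho.mem_nhds h] with z hz' using hz z y hz'
    rw [(this.iteratedFDeriv ℝ j).eq_of_nhds]
    have : iteratedFDeriv ℝ j (fun _ : EuclideanSpace ℝ (Fin N) => (0 : ℝ)) x = 0 := by
      simp
    rw [this, norm_zero]
    positivity
  · have h1 : ContDiff ℝ n fun z => (inner ℝ (y - z) (g z) : ℝ) :=
      ContDiff.inner ℝ (by fun_prop) hg
    refine norm_iteratedFDeriv_bilinear_le_of_forall_le (ContinuousLinearMap.mul ℝ ℝ)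
      (ContinuousLinearMap.opNorm_mul_le ℝ ℝ) (f := fun z => η (z - y)) (by fun_prop)
      (hφ.comp h1) (fun i hi => ?_) (fun i hi => ?_) hj
    · rw [iteratedFDeriv_comp_sub]
      exact ha i hi _
    · refine norm_iteratedFDeriv_comp_le_of_forall_le hφ h1 (fun l hl => hc l hl _)
        (le_max_left _ _) (fun l hl => ?_) hi
      refine le_trans ?_ (le_max_right _ _)
      exact norm_iteratedFDeriv_bilinear_le_of_forall_le (innerSL ℝ) (norm_innerSL_le ..)
        (f := fun z => y - z) (by fun_prop) hg
        (fun m _ => norm_iteratedFDeriv_const_sub_le x y h m) (fun m hm => hb m hm x) hl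

end AnisotropicKernel

/-! ### Condition (I) for the nonlocal operator -/

section NonlocalOperator

variable {N : ℕ}

/-- The Riesz isomorphism from linear forms to vectors, which sends the derivative to the
gradient. -/
noncomputable def gradientIsometry (N : ℕ) :
    (EuclideanSpace ℝ (Fin N) →L[ℝ] ℝ) →ₗᵢ[ℝ] EuclideanSpace ℝ (Fin N) where
  toFun l := (InnerProductSpace.toDual ℝ (EuclideanSpace ℝ (Fin N))).symm l
  map_add' _ _ := map_add _ _ _
  map_smul' c l := by simp
  norm_map' l := LinearIsometryEquiv.norm_map _ _

theorem gradient_eq_gradientIsometry (f : EuclideanSpace ℝ (Fin N) → ℝ)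
    (x : EuclideanSpace ℝ (Fin N)) : gradient f x = gradientIsometry N (fderiv ℝ f x) := rfl

/-- The divergence as a linear function of the derivative. -/
noncomputable def traceCLM (N : ℕ) :
    (EuclideanSpace ℝ (Fin N) →L[ℝ] EuclideanSpace ℝ (Fin N)) →L[ℝ] ℝ :=
  ∑ i : Fin N, (EuclideanSpace.proj i : EuclideanSpace ℝ (Fin N) →L[ℝ] ℝ).comp
    (ContinuousLinearMap.apply ℝ (EuclideanSpace ℝ (Fin N)) (EuclideanSpace.single i (1 : ℝ)))

theorem divergence_eq_traceCLM (u : EuclideanSpace ℝ (Fin N) → EuclideanSpace ℝ (Fin N)) :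
    divergence u = fun x => traceCLM N (fderiv ℝ u x) := by
  ext x
  simp [divergence, traceCLM]

/-- `p ↦ -ε p / √(1 + ‖p‖²)`. -/
noncomputable def saturation (ε : ℝ) (p : EuclideanSpace ℝ (Fin N)) : EuclideanSpace ℝ (Fin N) :=
  -((ε / √(1 + ‖p‖ ^ 2)) • p)

theorem contDiff_saturation (ε : ℝ) {n : ℕ∞ω} :
    ContDiff ℝ n (saturation ε : EuclideanSpace ℝ (Fin N) → _) := by
  have h1 : ∀ p : EuclideanSpace ℝ (Fin N), 0 < 1 + ‖p‖ ^ 2 := fun p => by positivity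
  have h2 : ContDiff ℝ n fun p : EuclideanSpace ℝ (Fin N) => 1 + ‖p‖ ^ 2 :=
    contDiff_const.add (contDiff_id.norm_sq ℝ)
  have h3 : ContDiff ℝ n fun p : EuclideanSpace ℝ (Fin N) => √(1 + ‖p‖ ^ 2) :=
    h2.sqrt fun p => (h1 p).ne'
  exact ((contDiff_const.div h3 fun p => (Real.sqrt_pos.2 (h1 p)).ne').smul contDiff_id).neg

theorem norm_saturation_le {ε : ℝ} (hε : 0 ≤ ε) (p : EuclideanSpace ℝ (Fin N)) :
    ‖saturation ε p‖ ≤ ε := by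
  have h : ‖p‖ ≤ √(1 + ‖p‖ ^ 2) := Real.le_sqrt_of_sq_le (by linarith)
  have h0 : 0 < √(1 + ‖p‖ ^ 2) := Real.sqrt_pos.2 (by positivity)
  rw [saturation, norm_neg, norm_smul, Real.norm_eq_abs, abs_of_nonneg (by positivity),
    div_mul_eq_mul_div, div_le_iff₀ h0]
  gcongr

theorem exists_contDiff_bounds_on_closedBall {F G : Type*} [NormedAddCommGroup F]
    [NormedSpace ℝ F] [ProperSpace F] [NormedAddCommGroup G] [NormedSpace ℝ G] {Φ : F → G}
    (hΦ : ContDiff ℝ 2 Φ) (B : ℝ) :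
    ∃ L, 0 ≤ L ∧ (∀ p, ‖p‖ ≤ B → ‖Φ p‖ ≤ L) ∧ (∀ p, ‖p‖ ≤ B → ‖fderiv ℝ Φ p‖ ≤ L) ∧
      (∀ p, ‖p‖ ≤ B → ‖fderiv ℝ (fderiv ℝ Φ) p‖ ≤ L) ∧
      (∀ p q, ‖p‖ ≤ B → ‖q‖ ≤ B → ‖Φ p - Φ q‖ ≤ L * ‖p - q‖) ∧
      (∀ p q, ‖p‖ ≤ B → ‖q‖ ≤ B → ‖fderiv ℝ Φ p - fderiv ℝ Φ q‖ ≤ L * ‖p - q‖) := by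
  have hK : IsCompact (Metric.closedBall (0 : F) B) := isCompact_closedBall 0 B
  have h1 : ContDiff ℝ 1 (fderiv ℝ Φ) := hΦ.fderiv_right (by norm_num)
  obtain ⟨a, ha⟩ := hK.exists_bound_of_continuousOn hΦ.continuous.continuousOn
  obtain ⟨b, hb⟩ := hK.exists_bound_of_continuousOn h1.continuous.continuousOn
  obtain ⟨c, hc⟩ := hK.exists_bound_of_continuousOn
    (h1.continuous_fderiv one_ne_zero).continuousOn
  have hmem {p : F} (hp : ‖p‖ ≤ B) : p ∈ Metric.closedBall (0 : F) B := by simpa using hp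
  have hL : ∀ t ∈ [a, b, c], t ≤ max (max a b) (max c 0) := by
    intro t ht
    simp only [List.mem_cons, List.not_mem_nil, or_false] at ht
    rcases ht with rfl | rfl | rfl <;> simp
  have hL1 := hL a (by simp)
  have hL2 := hL b (by simp)
  have hL3 := hL c (by simp)
  refine ⟨max (max a b) (max c 0), by simp, fun p hp => (ha p (hmem hp)).trans hL1,
    fun p hp => (hb p (hmem hp)).trans hL2, fun p hp => (hc p (hmem hp)).trans hL3, ?_, ?_⟩
  · intro p q hp hq
    exact (convex_closedBall (0 : F) B).norm_image_sub_le_of_norm_fderiv_le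
      (fun z _ => hΦ.differentiable (by norm_num) z) (fun z hz => (hb z hz).trans hL2)
      (hmem hq) (hmem hp)
  · intro p q hp hq
    exact (convex_closedBall (0 : F) B).norm_image_sub_le_of_norm_fderiv_le
      (fun z _ => h1.differentiable one_ne_zero z) (fun z hz => (hc z hz).trans hL3)
      (hmem hq) (hmem hp)

section BallAverage

/-- Tonelli: `y ∈ B(x,M)` if and only if `x ∈ B(y,M)`, and all balls of radius `M` have the same
volume. -/
theorem lintegral_setIntegral_closedBall_abs (r : EuclideanSpace ℝ (Fin N) →₁[volume] ℝ) (M : ℝ) :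
    ∫⁻ x, ENNReal.ofReal (∫ y in Metric.closedBall x M, |r y|) =
      volume (Metric.closedBall (0 : EuclideanSpace ℝ (Fin N)) M) * ENNReal.ofReal ‖r‖ := by
  have h1 (x : EuclideanSpace ℝ (Fin N)) : ENNReal.ofReal (∫ y in Metric.closedBall x M, |r y|) =
      ∫⁻ y, (Metric.closedBall x M).indicator (fun y => ‖r y‖ₑ) y := by
    rw [lintegral_indicator measurableSet_closedBall]
    exact ofReal_integral_norm_eq_lintegral_enorm (L1.integrable_coeFn r).integrableOn
  have h2 (x y : EuclideanSpace ℝ (Fin N)) :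
      (Metric.closedBall x M).indicator (fun y => ‖r y‖ₑ) y =
        (Metric.closedBall y M).indicator (fun _ => ‖r y‖ₑ) x := by
    simp only [indicator, Metric.mem_closedBall, dist_comm x y]
  have hm : Measurable fun y => ‖r y‖ₑ := (Lp.stronglyMeasurable r).measurable.enorm
  simp only [h1]
  rw [lintegral_lintegral_swap]
  · simp only [h2]
    simp only [lintegral_indicator_const measurableSet_closedBall]
    have hv (y : EuclideanSpace ℝ (Fin N)) : volume (Metric.closedBall y M) =
        volume (Metric.closedBall (0 : EuclideanSpace ℝ (Fin N)) M) :=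
      Measure.addHaar_closedBall_center _ _ _
    simp only [hv]
    rw [lintegral_mul_const _ hm, mul_comm, L1.norm_eq_integral_norm,
      ofReal_integral_norm_eq_lintegral_enorm (L1.integrable_coeFn r)]
  · have : (Function.uncurry fun x y => (Metric.closedBall x M).indicator (fun y => ‖r y‖ₑ) y) =
        {p : EuclideanSpace ℝ (Fin N) × EuclideanSpace ℝ (Fin N) | dist p.2 p.1 ≤ M}.indicator
          fun p => ‖r p.2‖ₑ := by
      ext ⟨x, y⟩
      simp [indicator, Function.uncurry]
    rw [this]
    refine Measurable.aemeasurable ?_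
    exact (hm.comp measurable_snd).indicator
      (isClosed_le (by fun_prop) continuous_const).measurableSet

theorem eLpNorm_one_le_of_le_setIntegral {F : Type*} [NormedAddCommGroup F]
    (r : EuclideanSpace ℝ (Fin N) →₁[volume] ℝ) {M C : ℝ} (hC : 0 ≤ C)
    {f : EuclideanSpace ℝ (Fin N) → F}
    (hf : ∀ x, ‖f x‖ ≤ C * ∫ y in Metric.closedBall x M, |r y|) :
    eLpNorm f 1 volume ≤ ENNReal.ofReal
      (C * (volume (Metric.closedBall (0 : EuclideanSpace ℝ (Fin N)) M)).toReal * ‖r‖) := by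
  rw [eLpNorm_one_eq_lintegral_enorm]
  calc ∫⁻ x, ‖f x‖ₑ ≤ ∫⁻ x, ENNReal.ofReal C *
        ENNReal.ofReal (∫ y in Metric.closedBall x M, |r y|) := by
        refine lintegral_mono fun x => ?_
        rw [← ENNReal.ofReal_mul hC, ← ofReal_norm]
        exact ENNReal.ofReal_le_ofReal (hf x)
    _ = _ := by
      rw [lintegral_const_mul' _ _ ENNReal.ofReal_ne_top, lintegral_setIntegral_closedBall_abs,
        ENNReal.ofReal_mul (by positivity), ENNReal.ofReal_mul hC,
        ENNReal.ofReal_toReal measure_closedBall_lt_top.ne, mul_assoc]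

/-- A bound free of the norm of `r`: it confines the gradients of the averages of all densities to
one ball. -/
theorem setIntegral_closedBall_abs_le {R : ℝ} {r : EuclideanSpace ℝ (Fin N) →₁[volume] ℝ}
    (hr : IsDensity R r) (M : ℝ) (x : EuclideanSpace ℝ (Fin N)) :
    ∫ y in Metric.closedBall x M, |r y| ≤
      R * (volume (Metric.closedBall (0 : EuclideanSpace ℝ (Fin N)) M)).toReal := by
  calc ∫ y in Metric.closedBall x M, |r y| ≤ ∫ y in Metric.closedBall x M, R := by
        refine integral_mono_ae (L1.integrable_coeFn r).abs.integrableOn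
          (integrableOn_const measure_closedBall_lt_top.ne) (ae_restrict_of_ae ?_)
        filter_upwards [hr] with y hy
        rw [abs_of_nonneg hy.1]
        exact hy.2
    _ = _ := by
      rw [setIntegral_const, smul_eq_mul, mul_comm, Measure.real,
        Measure.addHaar_closedBall_center]

end BallAverage

variable {η : EuclideanSpace ℝ (Fin N) → ℝ} {φ : ℝ → ℝ}
  {g : EuclideanSpace ℝ (Fin N) → EuclideanSpace ℝ (Fin N)} {D : Set (EuclideanSpace ℝ (Fin N))}
  {C M R : ℝ}

theorem anisotropicI_eq_saturation (ε : ℝ) (r : EuclideanSpace ℝ (Fin N) →₁[volume] ℝ)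
    (x : EuclideanSpace ℝ (Fin N)) : anisotropicI ε η φ g D r x =
      saturation ε (gradient (weightedAverage η φ g D r) x) := rfl

theorem jointContDiff_gradient_weightedAverage
    (hk : KernelBound 3 C M (anisotropicKernel η φ g)) :
    JointContDiff 2 fun r => gradient (weightedAverage η φ g D r) := by
  have h := hk.jointContDiff (D := D)
  have h2 := (JointContDiff.succ_iff.1 h).2.2
  have h3 := h2.comp (Φ := gradientIsometry N)
    (gradientIsometry N).toContinuousLinearMap.contDiff
  simp only [← weightedAverage_eq_kernelOperator] at h3
  exact h3

theorem norm_iteratedFDeriv_gradient_weightedAverage_le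
    (hk : KernelBound 3 C M (anisotropicKernel η φ g)) (r : EuclideanSpace ℝ (Fin N) →₁[volume] ℝ)
    {j : ℕ} (hj : j ≤ 2) (x : EuclideanSpace ℝ (Fin N)) :
    ‖iteratedFDeriv ℝ j (gradient (weightedAverage η φ g D r)) x‖ ≤
      C * ∫ y in Metric.closedBall x M, |r y| := by
  have h := (hk.jointContDiff (D := D)).contDiff r
  have h1 : ContDiff ℝ 2 (fderiv ℝ (kernelOperator D (anisotropicKernel η φ g) r)) :=
    h.fderiv_right (by norm_num)
  have h2 := (gradientIsometry N).norm_iteratedFDeriv_comp_left (x := x) (i := j)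
    (h1.contDiffAt (x := x)) (by exact_mod_cast hj)
  rw [norm_iteratedFDeriv_fderiv] at h2
  have h3 : gradient (weightedAverage η φ g D r) =
      gradientIsometry N ∘ fderiv ℝ (kernelOperator D (anisotropicKernel η φ g) r) := by
    rw [weightedAverage_eq_kernelOperator]
    rfl
  rw [h3, h2]
  exact hk.norm_iteratedFDeriv_kernelOperator_le (by omega) r x

theorem gradient_weightedAverage_sub (hk : KernelBound 3 C M (anisotropicKernel η φ g))
    (r₁ r₂ : EuclideanSpace ℝ (Fin N) →₁[volume] ℝ) :
    gradient (weightedAverage η φ g D (r₁ - r₂)) = fun x =>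
      gradient (weightedAverage η φ g D r₁) x - gradient (weightedAverage η φ g D r₂) x := by
  ext1 x
  have h : weightedAverage η φ g D (r₁ - r₂) = fun x =>
      weightedAverage η φ g D r₁ x - weightedAverage η φ g D r₂ x := by
    ext x
    simp only [weightedAverage_eq_kernelOperator]
    exact hk.kernelOperator_sub r₁ r₂ x
  have hd (r : EuclideanSpace ℝ (Fin N) →₁[volume] ℝ) :
      DifferentiableAt ℝ (weightedAverage η φ g D r) x := by
    rw [weightedAverage_eq_kernelOperator]
    exact (hk.hasFDerivAt_kernelOperator r x).differentiableAt
  simp only [gradient_eq_gradientIsometry]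
  rw [h, fderiv_fun_sub (hd r₁) (hd r₂), map_sub]

theorem jointContDiff_anisotropicI (ε : ℝ) (hk : KernelBound 3 C M (anisotropicKernel η φ g)) :
    JointContDiff 2 (anisotropicI ε η φ g D) :=
  (jointContDiff_gradient_weightedAverage hk).comp (contDiff_saturation ε)

theorem fderiv_anisotropicI (ε : ℝ) (hk : KernelBound 3 C M (anisotropicKernel η φ g))
    (r : EuclideanSpace ℝ (Fin N) →₁[volume] ℝ) (x : EuclideanSpace ℝ (Fin N)) :
    fderiv ℝ (anisotropicI ε η φ g D r) x =
      (fderiv ℝ (saturation ε) (gradient (weightedAverage η φ g D r) x)).comp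
        (fderiv ℝ (gradient (weightedAverage η φ g D r)) x) :=
  fderiv_comp x ((contDiff_saturation ε (n := 1)).differentiable one_ne_zero _)
    (((jointContDiff_gradient_weightedAverage hk).contDiff r).differentiable (by norm_num) x)

theorem norm_fderiv_fderiv_anisotropicI_le (ε : ℝ)
    (hk : KernelBound 3 C M (anisotropicKernel η φ g))
    (r : EuclideanSpace ℝ (Fin N) →₁[volume] ℝ) (x : EuclideanSpace ℝ (Fin N)) :
    ‖fderiv ℝ (fderiv ℝ (anisotropicI ε η φ g D r)) x‖ ≤
      ‖fderiv ℝ (fderiv ℝ (saturation ε)) (gradient (weightedAverage η φ g D r) x)‖ *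
          ‖fderiv ℝ (gradient (weightedAverage η φ g D r)) x‖ ^ 2 +
        ‖fderiv ℝ (saturation ε) (gradient (weightedAverage η φ g D r) x)‖ *
          ‖fderiv ℝ (fderiv ℝ (gradient (weightedAverage η φ g D r))) x‖ := by
  set G := gradient (weightedAverage η φ g D r)
  have hG : ContDiff ℝ 2 G := (jointContDiff_gradient_weightedAverage hk).contDiff r
  have hG1 : ContDiff ℝ 1 (fderiv ℝ G) := hG.fderiv_right (by norm_num)
  have hΦ1 : ContDiff ℝ 1 (fderiv ℝ (saturation ε : EuclideanSpace ℝ (Fin N) → _)) :=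
    (contDiff_saturation ε (n := 2)).fderiv_right (by norm_num)
  have h1 : fderiv ℝ (anisotropicI ε η φ g D r) =
      fun x => (fderiv ℝ (saturation ε) (G x)).comp (fderiv ℝ G x) :=
    funext fun x => fderiv_anisotropicI ε hk r x
  have h2 : HasFDerivAt (fun x => fderiv ℝ (saturation ε) (G x))
      ((fderiv ℝ (fderiv ℝ (saturation ε)) (G x)).comp (fderiv ℝ G x)) x :=
    (hΦ1.differentiable one_ne_zero _).hasFDerivAt.comp x
      (hG.differentiable (by norm_num) x).hasFDerivAt
  have h3 := h2.clm_comp (hG1.differentiable one_ne_zero x).hasFDerivAt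
  rw [h1, h3.fderiv]
  refine (ContinuousLinearMap.opNorm_add_le _ _).trans ?_
  rw [add_comm]
  gcongr
  · refine (ContinuousLinearMap.opNorm_comp_le _ _).trans ?_
    calc _ ≤ ‖fderiv ℝ G x‖ *
          (‖fderiv ℝ (fderiv ℝ (saturation ε)) (G x)‖ * ‖fderiv ℝ G x‖) := by
          gcongr
          · refine ContinuousLinearMap.opNorm_le_bound _ (norm_nonneg (fderiv ℝ G x)) fun u => ?_
            rw [mul_comm]
            exact ContinuousLinearMap.opNorm_comp_le _ _
          · exact ContinuousLinearMap.opNorm_comp_le _ _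
      _ = _ := by ring
  · refine (ContinuousLinearMap.opNorm_comp_le _ _).trans ?_
    gcongr
    exact ContinuousLinearMap.opNorm_le_bound _ (norm_nonneg _) fun u =>
      ContinuousLinearMap.opNorm_comp_le _ _

/-- Everything is estimated pointwise by a constant times the local mass `S r x`, which is at most
`R * m`, at most `‖r‖`, and has integral `m * ‖r‖`. -/
theorem hypI_anisotropicI (hR : 0 ≤ R) (ε : ℝ)
    (hk : KernelBound 3 C M (anisotropicKernel η φ g)) :
    HypI R (anisotropicI ε η φ g D) := by
  have hC := hk.C_nonneg
  set m := (volume (Metric.closedBall (0 : EuclideanSpace ℝ (Fin N)) M)).toReal with hmdef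
  have hm : 0 ≤ m := ENNReal.toReal_nonneg
  set G := fun r => gradient (weightedAverage η φ g D r) with hGdef
  set S := fun (r : EuclideanSpace ℝ (Fin N) →₁[volume] ℝ) x =>
    ∫ y in Metric.closedBall x M, |r y| with hSdef
  have hS0 (r x) : 0 ≤ S r x := integral_nonneg fun y => abs_nonneg _
  have hSn (r x) : S r x ≤ ‖r‖ := KernelBound.setIntegral_abs_le_norm r _
  have hSR {r} (hr : IsDensity R r) (x) : S r x ≤ R * m := setIntegral_closedBall_abs_le hr M x
  have hG0 (r x) : ‖G r x‖ ≤ C * S r x := by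
    simpa using norm_iteratedFDeriv_gradient_weightedAverage_le (D := D) hk r (j := 0) (by simp) x
  have hG1 (r x) : ‖fderiv ℝ (G r) x‖ ≤ C * S r x := by
    have := norm_iteratedFDeriv_gradient_weightedAverage_le (D := D) hk r (j := 1) (by simp) x
    rwa [norm_iteratedFDeriv_one] at this
  have hG2 (r x) : ‖fderiv ℝ (fderiv ℝ (G r)) x‖ ≤ C * S r x := by
    have := norm_iteratedFDeriv_gradient_weightedAverage_le (D := D) hk r (j := 2) (by simp) x
    rwa [← norm_iteratedFDeriv_fderiv, norm_iteratedFDeriv_one] at this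
  have hGsub (r₁ r₂) : G (r₁ - r₂) = fun x => G r₁ x - G r₂ x :=
    gradient_weightedAverage_sub hk r₁ r₂
  have hGd (r) : Differentiable ℝ (G r) :=
    ((jointContDiff_gradient_weightedAverage hk).contDiff r).differentiable (by norm_num)
  -- Radius of the ball containing all gradients; the saturation has uniform `C²` bounds `L` there.
  set B := C * (R * m)
  have hB0 : 0 ≤ B := by positivity
  have hGB {r} (hr : IsDensity R r) (x) : C * S r x ≤ B :=
    mul_le_mul_of_nonneg_left (hSR hr x) hC
  obtain ⟨L, hL, hΦ0, hΦ1, hΦ2, hΦl, hΦl1⟩ := exists_contDiff_bounds_on_closedBall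
    (contDiff_saturation ε (N := N)) B
  have hI := jointContDiff_anisotropicI (D := D) ε hk
  have hId (r) : Differentiable ℝ (anisotropicI ε η φ g D r) :=
    (hI.contDiff r).differentiable (by norm_num)
  have hI1 {r} (hr : IsDensity R r) (x) :
      ‖fderiv ℝ (anisotropicI ε η φ g D r) x‖ ≤ L * C * S r x := by
    rw [fderiv_anisotropicI ε hk]
    refine (ContinuousLinearMap.opNorm_comp_le _ _).trans ?_
    rw [mul_assoc]
    gcongr
    · exact hΦ1 _ ((hG0 r x).trans (hGB hr x))
    · exact hG1 r x
  have hI2 {r} (hr : IsDensity R r) (x) :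
      ‖fderiv ℝ (fderiv ℝ (anisotropicI ε η φ g D r)) x‖ ≤ (L * B + L) * C * S r x := by
    refine (norm_fderiv_fderiv_anisotropicI_le ε hk r x).trans ?_
    have hb := (hG0 r x).trans (hGB hr x)
    calc _ ≤ L * (B * (C * S r x)) + L * (C * S r x) := by
          gcongr
          · exact hΦ2 _ hb
          · rw [sq]
            exact mul_le_mul ((hG1 r x).trans (hGB hr x)) (hG1 r x) (norm_nonneg _) hB0
          · exact hΦ1 _ hb
          · exact hG2 r x
      _ = _ := by ring
  have htr (u : EuclideanSpace ℝ (Fin N) → EuclideanSpace ℝ (Fin N)) (x) :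
      ‖divergence u x‖ ≤ ‖traceCLM N‖ * ‖fderiv ℝ u x‖ := by
    rw [divergence_eq_traceCLM]
    exact (traceCLM N).le_opNorm _
  refine ⟨fun r _ => hI.contDiff r, fun r₀ _ K hK j hj => ?_, ?_, ?_, ?_⟩
  · exact fun u hu => nhdsWithin_le_nhds (hI.tendstoUniformlyOn hj hK r₀ u hu)
  -- The constant part serves the two sup norms, the linear part the `L¹` norm of the divergence.
  · refine ⟨fun s => max L (L * B) + ‖traceCLM N‖ * (L * C) * m * s, fun s _ t _ hst => ?_,
      fun s hs => ?_, fun r hr => ⟨?_, ?_⟩⟩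
    · dsimp only
      gcongr
    · have : 0 ≤ max L (L * B) := le_max_of_le_left hL
      positivity
    · have hpos : 0 ≤ ‖traceCLM N‖ * (L * C) * m * ‖r‖ := by positivity
      refine max_le ?_ ?_
      · refine (eLpNormEssSup_le_of_ae_bound (C := L) (Eventually.of_forall fun x => ?_)).trans
          (ENNReal.ofReal_le_ofReal ?_)
        · exact hΦ0 _ ((hG0 r x).trans (hGB hr x))
        · exact (le_max_left L (L * B)).trans (le_add_of_nonneg_right hpos)
      · refine (eLpNormEssSup_le_of_ae_bound (C := L * B) (Eventually.of_forall fun x => ?_)).trans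
          (ENNReal.ofReal_le_ofReal ?_)
        · refine (hI1 hr x).trans ?_
          rw [mul_assoc]
          exact mul_le_mul_of_nonneg_left (hGB hr x) hL
        · exact (le_max_right L (L * B)).trans (le_add_of_nonneg_right hpos)
    · refine (eLpNorm_one_le_of_le_setIntegral (M := M) r (C := ‖traceCLM N‖ * (L * C))
        (by positivity) fun x => ?_).trans (ENNReal.ofReal_le_ofReal ?_)
      · refine (htr _ x).trans ?_
        rw [mul_assoc ‖traceCLM N‖]
        exact mul_le_mul_of_nonneg_left (hI1 hr x) (norm_nonneg (traceCLM N))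
      · exact le_add_of_nonneg_left (le_max_of_le_left hL)
  · refine ⟨fun s => ‖traceCLM N‖ * ((L * B + L) * C) * m * s, fun s _ t _ hst => ?_,
      fun s hs => ?_, fun r hr => ?_⟩
    · dsimp only
      gcongr
    · positivity
    · refine eLpNorm_one_le_of_le_setIntegral (M := M) r (by positivity) fun x => ?_
      have hd : DifferentiableAt ℝ (fderiv ℝ (anisotropicI ε η φ g D r)) x :=
        ((hI.contDiff r).fderiv_right (m := 1) (by norm_num)).differentiable one_ne_zero x
      have : fderiv ℝ (divergence (anisotropicI ε η φ g D r)) x =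
          (traceCLM N).comp (fderiv ℝ (fderiv ℝ (anisotropicI ε η φ g D r)) x) := by
        rw [divergence_eq_traceCLM]
        exact ((traceCLM N).hasFDerivAt.comp x hd.hasFDerivAt).fderiv
      rw [this, mul_assoc ‖traceCLM N‖]
      refine (ContinuousLinearMap.opNorm_comp_le _ _).trans ?_
      exact mul_le_mul_of_nonneg_left (hI2 hr x) (norm_nonneg (traceCLM N))
  · have hdiff {r₁ r₂} (h₁ : IsDensity R r₁) (h₂ : IsDensity R r₂) (x) :
        ‖anisotropicI ε η φ g D r₁ x - anisotropicI ε η φ g D r₂ x‖ ≤ L * C * S (r₁ - r₂) x := by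
      refine (hΦl _ _ ((hG0 r₁ x).trans (hGB h₁ x)) ((hG0 r₂ x).trans (hGB h₂ x))).trans ?_
      rw [mul_assoc]
      have := hG0 (r₁ - r₂) x
      rw [hGsub] at this
      exact mul_le_mul_of_nonneg_left this hL
    have hdiv {r₁ r₂} (h₁ : IsDensity R r₁) (h₂ : IsDensity R r₂) (x) :
        ‖fderiv ℝ (fun x => anisotropicI ε η φ g D r₁ x - anisotropicI ε η φ g D r₂ x) x‖ ≤
          (L + L * B) * C * S (r₁ - r₂) x := by
      rw [fderiv_fun_sub (hId r₁ x) (hId r₂ x), fderiv_anisotropicI ε hk,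
        fderiv_anisotropicI ε hk]
      have h0 := hG0 (r₁ - r₂) x
      have h1 := hG1 (r₁ - r₂) x
      rw [hGsub] at h0 h1
      rw [fderiv_fun_sub (hGd r₁ x) (hGd r₂ x)] at h1
      -- Difference of two products: linearity of `G` in `r` controls the first term, the Lipschitz
      -- bound for the derivative of the saturation the second.
      have hsplit : (fderiv ℝ (saturation ε) (G r₁ x)).comp (fderiv ℝ (G r₁) x) -
          (fderiv ℝ (saturation ε) (G r₂ x)).comp (fderiv ℝ (G r₂) x) =
          (fderiv ℝ (saturation ε) (G r₁ x)).comp (fderiv ℝ (G r₁) x - fderiv ℝ (G r₂) x) +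
          (fderiv ℝ (saturation ε) (G r₁ x) - fderiv ℝ (saturation ε) (G r₂ x)).comp
            (fderiv ℝ (G r₂) x) := by
        ext u
        simp
      refine (congrArg norm hsplit).le.trans ((norm_add_le _ _).trans ?_)
      have hb1 := (hG0 r₁ x).trans (hGB h₁ x)
      have hb2 := (hG0 r₂ x).trans (hGB h₂ x)
      calc _ ≤ L * (C * S (r₁ - r₂) x) + (L * (C * S (r₁ - r₂) x)) * B := by
            gcongr
            · refine (ContinuousLinearMap.opNorm_comp_le _ _).trans ?_
              gcongr
              exact hΦ1 _ hb1
            · refine (ContinuousLinearMap.opNorm_comp_le _ _).trans ?_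
              have := hS0 (r₁ - r₂) x
              gcongr
              · exact (hΦl1 _ _ hb1 hb2).trans (mul_le_mul_of_nonneg_left h0 hL)
              · exact (hG1 r₂ x).trans (hGB h₂ x)
        _ = _ := by ring
    refine ⟨L * C + (L * C * m + ‖traceCLM N‖ * ((L + L * B) * C) * m),
      fun r₁ r₂ h₁ h₂ => ⟨?_, ?_⟩⟩
    · refine (eLpNormEssSup_le_of_ae_bound (C := L * C * ‖r₁ - r₂‖)
        (Eventually.of_forall fun x => ?_)).trans (ENNReal.ofReal_le_ofReal ?_)
      · exact (hdiff h₁ h₂ x).trans (mul_le_mul_of_nonneg_left (hSn _ x) (by positivity))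
      · gcongr
        exact le_add_of_nonneg_right (by positivity)
    · have e1 := eLpNorm_one_le_of_le_setIntegral (M := M) (r₁ - r₂) (by positivity)
        (hdiff h₁ h₂)
      have e2 := eLpNorm_one_le_of_le_setIntegral (M := M) (r₁ - r₂)
        (C := ‖traceCLM N‖ * ((L + L * B) * C)) (by positivity) (f := divergence fun x =>
          anisotropicI ε η φ g D r₁ x - anisotropicI ε η φ g D r₂ x) (fun x =>
            (htr _ x).trans (by
              rw [mul_assoc ‖traceCLM N‖]
              exact mul_le_mul_of_nonneg_left (hdiv h₁ h₂ x) (norm_nonneg (traceCLM N))))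
      refine (add_le_add e1 e2).trans ?_
      rw [← ENNReal.ofReal_add (by positivity) (by positivity)]
      refine ENNReal.ofReal_le_ofReal ?_
      have : 0 ≤ L * C * ‖r₁ - r₂‖ := by positivity
      rw [← hmdef]
      linarith

end NonlocalOperator

/-! ### Distance from the complement and nearest boundary points -/

section DistanceToComplement

variable {N : ℕ} {Ω : Set (EuclideanSpace ℝ (Fin N))}

/-- Seen from inside, a nearest point of the complement can be taken on the boundary. The distance
from the complement has the advantage of vanishing outside `Ω`. -/
theorem infDist_frontier_eq_infDist_compl {x : EuclideanSpace ℝ (Fin N)} (hx : x ∈ Ω) :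
    Metric.infDist x (frontier Ω) = Metric.infDist x Ωᶜ := by
  rcases eq_or_ne Ω univ with rfl | hne
  · simp
  obtain ⟨p, hp, hxp⟩ := exists_mem_frontier_infDist_compl_eq_dist hx hne
  refine le_antisymm (hxp ▸ Metric.infDist_le_dist_of_mem hp) ?_
  rw [← Metric.infDist_closure (s := Ωᶜ)]
  refine Metric.infDist_le_infDist_of_subset ?_ ⟨p, hp⟩
  rw [← frontier_compl]
  exact frontier_subset_closure

theorem mem_interior_iff_infDist_compl_pos (hne : Ωᶜ.Nonempty) {x : EuclideanSpace ℝ (Fin N)} :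
    x ∈ interior Ω ↔ 0 < Metric.infDist x Ωᶜ := by
  rw [← Metric.infDist_closure, ← isClosed_closure.notMem_iff_infDist_pos hne.closure,
    closure_compl, notMem_compl_iff]

theorem infDist_compl_lipschitz (x y : EuclideanSpace ℝ (Fin N)) :
    Metric.infDist x Ωᶜ ≤ Metric.infDist y Ωᶜ + dist x y :=
  Metric.infDist_le_infDist_add_dist

/-- `n` is the unit vector pointing from the boundary point `p` to an interior point `p + d n`
of which `p` is a nearest boundary point. -/
structure IsNearestPoint (Ω : Set (EuclideanSpace ℝ (Fin N))) (p n : EuclideanSpace ℝ (Fin N))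
    (d : ℝ) : Prop where
  mem_frontier : p ∈ frontier Ω
  norm_eq_one : ‖n‖ = 1
  pos : 0 < d
  infDist_eq : Metric.infDist (p + d • n) Ωᶜ = d

theorem exists_isNearestPoint (hne : Ωᶜ.Nonempty) {x : EuclideanSpace ℝ (Fin N)}
    (hx : 0 < Metric.infDist x Ωᶜ) :
    ∃ p n, IsNearestPoint Ω p n (Metric.infDist x Ωᶜ) ∧ x = p + Metric.infDist x Ωᶜ • n := by
  have hxΩ : x ∈ Ω := interior_subset ((mem_interior_iff_infDist_compl_pos hne).2 hx)
  obtain ⟨p, hp, hxp⟩ := exists_mem_frontier_infDist_compl_eq_dist hxΩ (by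
    rintro rfl; simp at hne)
  have h : x = p + Metric.infDist x Ωᶜ • ((Metric.infDist x Ωᶜ)⁻¹ • (x - p)) := by
    rw [smul_smul, mul_inv_cancel₀ hx.ne', one_smul, add_sub_cancel]
  refine ⟨p, (Metric.infDist x Ωᶜ)⁻¹ • (x - p), ⟨hp, ?_, hx, by rw [← h]⟩, h⟩
  rw [norm_smul, ← dist_eq_norm, ← hxp, norm_inv, Real.norm_eq_abs, abs_of_pos hx,
    inv_mul_cancel₀ hx.ne']

namespace IsNearestPoint

variable {p n : EuclideanSpace ℝ (Fin N)} {d : ℝ}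

/-- A 1-Lipschitz function that gains exactly `d` over a segment of length `d` grows at unit speed
along it. -/
theorem infDist_segment (h : IsNearestPoint Ω p n d) {t : ℝ} (ht0 : 0 ≤ t) (htd : t ≤ d) :
    Metric.infDist (p + t • n) Ωᶜ = t := by
  have hp : Metric.infDist p Ωᶜ = 0 := by
    have hc : p ∈ closure Ωᶜ := by
      have := h.mem_frontier
      rw [← frontier_compl] at this
      exact frontier_subset_closure this
    exact Metric.infDist_zero_of_mem_closure hc
  refine le_antisymm ?_ ?_
  · have := infDist_compl_lipschitz (Ω := Ω) (p + t • n) p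
    rw [hp, dist_eq_norm, add_sub_cancel_left, norm_smul, h.norm_eq_one, Real.norm_eq_abs,
      abs_of_nonneg ht0] at this
    linarith
  · have := infDist_compl_lipschitz (Ω := Ω) (p + d • n) (p + t • n)
    rw [h.infDist_eq, dist_eq_norm, add_sub_add_left_eq_sub, ← sub_smul, norm_smul,
      h.norm_eq_one, Real.norm_eq_abs, abs_of_nonneg (by linarith)] at this
    linarith

/-- The gradient has norm at most one and component one along the unit vector `n`; equality in
Cauchy–Schwarz makes it `n`. -/
theorem gradient_infDist_segment (h : IsNearestPoint Ω p n d) {t : ℝ} (ht0 : 0 < t) (htd : t ≤ d)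
    (hd : DifferentiableAt ℝ (fun y => Metric.infDist y Ωᶜ) (p + t • n)) :
    gradient (fun y => Metric.infDist y Ωᶜ) (p + t • n) = n := by
  set e := fun y => Metric.infDist y Ωᶜ
  have hnorm : ‖gradient e (p + t • n)‖ ≤ 1 := by
    rw [gradient_eq_gradientIsometry, LinearIsometry.norm_map]
    exact_mod_cast norm_fderiv_le_of_lipschitz ℝ (Metric.lipschitz_infDist_pt (s := Ωᶜ))
  have hinner : inner ℝ (gradient e (p + t • n)) n = 1 := by
    have h1 : HasDerivAt (fun s : ℝ => p + s • n) n t := by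
      simpa using ((hasDerivAt_id t).smul_const n).const_add p
    have hd' : HasFDerivAt e (fderiv ℝ e (p + t • n)) (p + t • n) := hd.hasFDerivAt
    -- One-sided derivative: for `t = d` the distance along the ray is known only up to `t`.
    have h2 : HasDerivWithinAt (fun s : ℝ => e (p + s • n)) (fderiv ℝ e (p + t • n) n) (Iic t) t := by
      have := hd'.comp_hasDerivAt t h1
      exact this.hasDerivWithinAt
    have h3 : HasDerivWithinAt (fun s : ℝ => e (p + s • n)) 1 (Iic t) t := by
      refine (hasDerivWithinAt_id t (Iic t)).congr_of_eventuallyEq ?_ ?_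
      · filter_upwards [self_mem_nhdsWithin, nhdsWithin_le_nhds (lt_mem_nhds ht0)] with s hs hs0
        exact h.infDist_segment (le_of_lt hs0) (le_trans hs htd)
      · exact h.infDist_segment ht0.le htd
    have h4 := (uniqueDiffWithinAt_Iic t).eq_deriv _ h2 h3
    rw [inner_gradient_left]
    exact h4
  have : ‖gradient e (p + t • n) - n‖ ^ 2 ≤ 0 := by
    rw [norm_sub_sq_real, hinner, h.norm_eq_one]
    nlinarith [norm_nonneg (gradient e (p + t • n))]
  have h0 : ‖gradient e (p + t • n) - n‖ = 0 := by
    nlinarith [norm_nonneg (gradient e (p + t • n) - n)]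
  exact sub_eq_zero.1 (norm_eq_zero.1 h0)

end IsNearestPoint

end DistanceToComplement

/-! ### Geometry of a domain whose boundary distance is C¹ in a strip -/

section RegularStrip

variable {N : ℕ} {Ω U : Set (EuclideanSpace ℝ (Fin N))} {D : EuclideanSpace ℝ (Fin N) → ℝ} {r : ℝ}

/-- The function `D`, of class `C¹` on the open set `U`, coincides with the distance from the
boundary of the regular closed set `Ω` on the strip of width `r` inside `Ω`. -/
structure IsRegularStrip (r : ℝ) (Ω U : Set (EuclideanSpace ℝ (Fin N)))
    (D : EuclideanSpace ℝ (Fin N) → ℝ) : Prop where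
  pos : 0 < r
  isClosed : IsClosed Ω
  subset_closure : Ω ⊆ closure (interior Ω)
  isOpen : IsOpen U
  contDiffOn : ContDiffOn ℝ 1 D U
  subset : Metric.thickening r (frontier Ω) ∩ Ω ⊆ U
  eq_infDist : ∀ x ∈ Metric.thickening r (frontier Ω) ∩ Ω, D x = Metric.infDist x (frontier Ω)

namespace IsRegularStrip

theorem frontier_subset (h : IsRegularStrip r Ω U D) :
    frontier Ω ⊆ Metric.thickening r (frontier Ω) ∩ Ω := fun _ hp =>
  ⟨Metric.self_subset_thickening h.pos _ hp, h.isClosed.frontier_subset hp⟩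

theorem mem_thickening {x : EuclideanSpace ℝ (Fin N)} (h0 : 0 < Metric.infDist x Ωᶜ)
    (hr : Metric.infDist x Ωᶜ < r) : x ∈ Metric.thickening r (frontier Ω) ∩ Ω := by
  have hne : Ωᶜ.Nonempty := by
    by_contra hc
    rw [not_nonempty_iff_eq_empty.1 hc, Metric.infDist_empty] at h0
    exact lt_irrefl _ h0
  have hx : x ∈ Ω := interior_subset ((mem_interior_iff_infDist_compl_pos hne).2 h0)
  obtain ⟨p, n, hp, hxp⟩ := exists_isNearestPoint hne h0
  refine ⟨?_, hx⟩
  rw [Metric.mem_thickening_iff_infDist_lt ⟨p, hp.mem_frontier⟩,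
    infDist_frontier_eq_infDist_compl hx]
  exact hr

theorem eventuallyEq (h : IsRegularStrip r Ω U D) {x : EuclideanSpace ℝ (Fin N)}
    (h0 : 0 < Metric.infDist x Ωᶜ) (hr : Metric.infDist x Ωᶜ < r) :
    (fun y => Metric.infDist y Ωᶜ) =ᶠ[𝓝 x] D := by
  have hc : Continuous fun y : EuclideanSpace ℝ (Fin N) => Metric.infDist y Ωᶜ :=
    Metric.continuous_infDist_pt _
  filter_upwards [hc.continuousAt.eventually (lt_mem_nhds h0),
    hc.continuousAt.eventually (gt_mem_nhds hr)] with y hy0 hyr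
  have := mem_thickening hy0 hyr
  rw [h.eq_infDist y this, infDist_frontier_eq_infDist_compl this.2]

theorem contDiffAt (h : IsRegularStrip r Ω U D) {x : EuclideanSpace ℝ (Fin N)}
    (hx : x ∈ U) : ContDiffAt ℝ 1 D x :=
  h.contDiffOn.contDiffAt (h.isOpen.mem_nhds hx)

theorem contDiffAt_infDist (h : IsRegularStrip r Ω U D) {x : EuclideanSpace ℝ (Fin N)}
    (h0 : 0 < Metric.infDist x Ωᶜ) (hr : Metric.infDist x Ωᶜ < r) :
    ContDiffAt ℝ 1 (fun y => Metric.infDist y Ωᶜ) x :=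
  (h.contDiffAt (h.subset (mem_thickening h0 hr))).congr_of_eventuallyEq (h.eventuallyEq h0 hr)

/-- The gradient equals `n` on the segment issuing from `p` into `Ω`, and it is continuous up to
`p`. -/
theorem gradient_eq_of_isNearestPoint (h : IsRegularStrip r Ω U D)
    {p n : EuclideanSpace ℝ (Fin N)} {d : ℝ} (hp : IsNearestPoint Ω p n d) :
    gradient D p = n := by
  have hpU : p ∈ U := h.subset (h.frontier_subset hp.mem_frontier)
  have h1 : ContinuousAt (gradient D) p := by
    have : ContinuousAt (fderiv ℝ D) p := (h.contDiffAt hpU).continuousAt_fderiv one_ne_zero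
    exact (gradientIsometry N).continuous.continuousAt.comp this
  have h2 : Tendsto (fun t : ℝ => p + t • n) (𝓝[>] 0) (𝓝 p) := by
    have : Continuous fun t : ℝ => p + t • n := by fun_prop
    have := this.tendsto 0
    rw [zero_smul, add_zero] at this
    exact this.mono_left nhdsWithin_le_nhds
  have h3 : ∀ᶠ t : ℝ in 𝓝[>] 0, gradient D (p + t • n) = n := by
    filter_upwards [self_mem_nhdsWithin, nhdsWithin_le_nhds (gt_mem_nhds hp.pos),
      nhdsWithin_le_nhds (gt_mem_nhds h.pos)] with t ht0 htd htr
    have he := hp.infDist_segment (le_of_lt ht0) (le_of_lt htd)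
    have h0 : 0 < Metric.infDist (p + t • n) Ωᶜ := by rw [he]; exact ht0
    have hr : Metric.infDist (p + t • n) Ωᶜ < r := by rw [he]; exact htr
    refine Eq.trans ?_ (hp.gradient_infDist_segment ht0 (le_of_lt htd)
      ((h.contDiffAt_infDist h0 hr).differentiableAt one_ne_zero))
    rw [gradient_eq_gradientIsometry, gradient_eq_gradientIsometry,
      (h.eventuallyEq h0 hr).fderiv_eq]
  exact tendsto_nhds_unique ((h1.tendsto.comp h2).congr' h3) tendsto_const_nhds

/-- Interior sphere condition. -/
theorem exists_interior_ball (h : IsRegularStrip r Ω U D) {p : EuclideanSpace ℝ (Fin N)}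
    (hp : p ∈ frontier Ω) {s : ℝ} (hs0 : 0 < s) (hsr : s < r) :
    ∃ z, dist z p ≤ s ∧ s ≤ Metric.infDist z Ωᶜ := by
  set e := fun y => Metric.infDist y Ωᶜ with he
  have hec : Continuous e := Metric.continuous_infDist_pt _
  have hpc : p ∈ closure Ωᶜ := by
    rw [← frontier_compl] at hp
    exact frontier_subset_closure hp
  have hne : Ωᶜ.Nonempty := closure_nonempty_iff.1 ⟨p, hpc⟩
  have hep : e p = 0 := Metric.infDist_zero_of_mem_closure hpc
  obtain ⟨z, hz, hmax⟩ := (isCompact_closedBall p s).exists_isMaxOn ⟨p, by simp [hs0.le]⟩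
    hec.continuousOn
  refine ⟨z, hz, ?_⟩
  -- The centre `z` maximizes the distance over the ball around `p`; it is enough to reach depth
  -- almost `s` inside that ball, starting from an interior point `y` within `δ` of `p`.
  suffices hδ : ∀ δ ∈ Ioo 0 (min s 1), (1 - δ) * (s - δ) ≤ e z by
    have ht : Tendsto (fun δ : ℝ => (1 - δ) * (s - δ)) (𝓝[>] 0) (𝓝 s) := by
      have : Continuous fun δ : ℝ => (1 - δ) * (s - δ) := by fun_prop
      have := this.tendsto 0
      simp only [sub_zero, one_mul] at this
      exact this.mono_left nhdsWithin_le_nhds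
    refine le_of_tendsto ht ?_
    filter_upwards [Ioo_mem_nhdsGT (lt_min hs0 one_pos)] with δ hδ' using hδ δ hδ'
  rintro δ ⟨hδ0, hδ1⟩
  rw [lt_min_iff] at hδ1
  obtain ⟨y, hy, hyp⟩ := Metric.mem_closure_iff.1
    (h.subset_closure (h.isClosed.frontier_subset hp)) δ hδ0
  rw [dist_comm] at hyp
  have hey : 0 < e y := (mem_interior_iff_infDist_compl_pos hne).1 hy
  -- Penalized ascent in place of the gradient flow. A maximizer `w` inside the open ball could move
  -- along `n`, gaining depth at rate `1` against a penalty rate of at most `1 - δ`; hence `w` lies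
  -- on the sphere and has depth at least `(1 - δ) * (s - δ)`.
  obtain ⟨w, hw, hwmax⟩ := (isCompact_closedBall y (s - δ)).exists_isMaxOn
    (f := fun w => e w - (1 - δ) * dist w y) ⟨y, by simp [hδ1.1.le]⟩ (by fun_prop)
  have hwp : dist w p ≤ s := by
    have := dist_triangle w y p
    have : dist w y ≤ s - δ := hw
    linarith
  -- Comparison with `y`, where the penalty is zero; it keeps `w` in the interior of `Ω`.
  have hew : e y ≤ e w - (1 - δ) * dist w y := by
    have := hwmax (Metric.mem_closedBall_self (sub_nonneg.2 hδ1.1.le))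
    simpa using this
  have hew0 : 0 < e w := by
    have : 0 ≤ (1 - δ) * dist w y := mul_nonneg (by linarith) dist_nonneg
    linarith
  -- Here `s < r` enters: the distance is differentiable at `w`.
  have hewr : e w < r := by
    have := infDist_compl_lipschitz (Ω := Ω) w p
    have : e w ≤ e p + dist w p := this
    linarith
  rcases (show dist w y ≤ s - δ from hw).lt_or_eq with hlt | heq
  · exfalso
    obtain ⟨q, n, hq, hwq⟩ := exists_isNearestPoint hne hew0
    have hd : DifferentiableAt ℝ e w := (h.contDiffAt_infDist hew0 hewr).differentiableAt one_ne_zero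
    have hg : gradient e w = n := by
      have := hq.gradient_infDist_segment (t := e w) hew0 le_rfl (hwq ▸ hd)
      rwa [← hwq] at this
    have h1 : HasDerivAt (fun t : ℝ => e (w + t • n)) 1 0 := by
      have h2 : HasDerivAt (fun t : ℝ => w + t • n) n 0 := by
        simpa using ((hasDerivAt_id (0 : ℝ)).smul_const n).const_add w
      have hd' : HasFDerivAt e (fderiv ℝ e w) (w + (0 : ℝ) • n) := by
        simpa using hd.hasFDerivAt
      have := hd'.comp_hasDerivAt 0 h2
      rwa [← inner_gradient_left, hg, real_inner_self_eq_norm_sq, hq.norm_eq_one,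
        one_pow] at this
    have h3 : HasDerivAt (fun t : ℝ => e (w + t • n) - (1 - δ) * t) (1 - (1 - δ)) 0 := by
      have := h1.fun_sub ((hasDerivAt_id' (0 : ℝ)).const_mul (1 - δ))
      rwa [mul_one] at this
    have h4 : ∀ᶠ t : ℝ in 𝓝[>] 0, e (w + t • n) - (1 - δ) * t ≤ e w := by
      have hc : Continuous fun t : ℝ => dist (w + t • n) y := by fun_prop
      have hlt' : dist (w + (0 : ℝ) • n) y < s - δ := by simpa using hlt
      filter_upwards [self_mem_nhdsWithin,
        nhdsWithin_le_nhds (hc.continuousAt.eventually (gt_mem_nhds hlt'))] with t ht0 ht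
      have hm : e (w + t • n) - (1 - δ) * dist (w + t • n) y ≤ e w - (1 - δ) * dist w y :=
        hwmax (show w + t • n ∈ Metric.closedBall y (s - δ) from le_of_lt ht)
      have ht0' : (0 : ℝ) < t := ht0
      have htri : dist (w + t • n) y ≤ t + dist w y := by
        refine (dist_triangle _ w _).trans ?_
        rw [dist_eq_norm, add_sub_cancel_left, norm_smul, hq.norm_eq_one, mul_one,
          Real.norm_eq_abs, abs_of_pos ht0']
      have := mul_le_mul_of_nonneg_left htri (show 0 ≤ 1 - δ by linarith)
      linarith
    have h5 := h3.hasDerivWithinAt (s := Ioi 0)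
    rw [hasDerivWithinAt_iff_tendsto_slope' (by simp)] at h5
    have h6 : 1 - (1 - δ) ≤ 0 := by
      refine le_of_tendsto h5 ?_
      filter_upwards [h4, self_mem_nhdsWithin] with t ht ht0
      have ht0' : (0 : ℝ) < t := ht0
      rw [slope_def_field]
      refine div_nonpos_of_nonpos_of_nonneg ?_ (by linarith)
      simp only [zero_smul, add_zero, mul_zero, sub_zero]
      linarith
    linarith
  · have h1 : e w ≤ e z := hmax (show w ∈ Metric.closedBall p s from hwp)
    rw [heq] at hew
    linarith

/-- At a boundary point, `Ω` contains an open ball whose closure contains `p`, and convex sets with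
interior have unique differentials. This makes the one-sided gradient defining the normal
meaningful. -/
theorem uniqueDiffWithinAt (h : IsRegularStrip r Ω U D) {p : EuclideanSpace ℝ (Fin N)}
    (hp : p ∈ Ω) : UniqueDiffWithinAt ℝ Ω p := by
  by_cases hi : p ∈ interior Ω
  · exact uniqueDiffWithinAt_of_mem_nhds (mem_interior_iff_mem_nhds.1 hi)
  have hf : p ∈ frontier Ω := ⟨_root_.subset_closure hp, hi⟩
  have hr := h.pos
  obtain ⟨z, hz, hze⟩ := h.exists_interior_ball hf (half_pos h.pos) (by linarith)
  have hsub : Metric.ball z (r / 2) ⊆ Ω :=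
    (Metric.ball_subset_ball hze).trans Metric.ball_infDist_compl_subset
  refine (uniqueDiffWithinAt_convex (convex_ball z (r / 2)) ?_ ?_).mono hsub
  · rw [Metric.isOpen_ball.interior_eq]
    exact Metric.nonempty_ball.2 (by linarith)
  · rw [closure_ball _ (by linarith)]
    rwa [Metric.mem_closedBall, dist_comm]

theorem inwardNormal_eq (h : IsRegularStrip r Ω U D) {p : EuclideanSpace ℝ (Fin N)}
    (hp : p ∈ Metric.thickening r (frontier Ω) ∩ Ω) : inwardNormal Ω p = gradient D p := by
  have h1 : (fun y => Metric.infDist y (frontier Ω)) =ᶠ[𝓝[Ω] p] D := by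
    filter_upwards [self_mem_nhdsWithin,
      nhdsWithin_le_nhds (Metric.isOpen_thickening.mem_nhds hp.1)] with y hy hyt
    exact (h.eq_infDist y ⟨hyt, hy⟩).symm
  have h2 : fderivWithin ℝ (fun y => Metric.infDist y (frontier Ω)) Ω p = fderiv ℝ D p := by
    rw [h1.fderivWithin_eq (h.eq_infDist p hp).symm]
    exact fderivWithin_eq_fderiv (h.uniqueDiffWithinAt hp.2)
      ((h.contDiffAt (h.subset hp)).differentiableAt one_ne_zero)
  rw [inwardNormal, gradientWithin, h2]
  rfl

/-- Almost every point of a closed set is a density point of it. At each boundary point, however,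
small balls of radius `s` contain a ball of radius `s / 2` free of boundary points. -/
theorem volume_frontier (h : IsRegularStrip r Ω U D) : volume (frontier Ω) = 0 := by
  have hae := Besicovitch.ae_tendsto_measure_inter_div
    (volume : Measure (EuclideanSpace ℝ (Fin N))) (frontier Ω)
  rw [ae_restrict_iff' isClosed_frontier.measurableSet] at hae
  refine measure_mono_null (fun p hp => ?_) hae
  simp only [mem_compl_iff, mem_ofPred_eq, Classical.not_imp]
  refine ⟨hp, fun ht => ?_⟩
  -- Volume ratio of balls whose radii are in ratio one half.
  set c : ℝ≥0∞ := ENNReal.ofReal ((1 / 2) ^ N)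
  have hc0 : c ≠ 0 := by
    simp [c]
  have hc : 1 - c < 1 := ENNReal.sub_lt_self ENNReal.one_ne_top one_ne_zero hc0
  have hev : ∀ᶠ s in 𝓝[>] (0 : ℝ), volume (frontier Ω ∩ Metric.closedBall p s) /
      volume (Metric.closedBall p s) ≤ 1 - c := by
    filter_upwards [Ioo_mem_nhdsGT h.pos] with s hs
    obtain ⟨z, hz, hze⟩ := h.exists_interior_ball hp (half_pos hs.1) (by linarith [hs.1, hs.2])
    have hsub : Metric.ball z (s / 2) ⊆ interior Ω :=
      interior_maximal ((Metric.ball_subset_ball hze).trans Metric.ball_infDist_compl_subset)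
        Metric.isOpen_ball
    have hsub2 : Metric.ball z (s / 2) ⊆ Metric.closedBall p s := by
      refine Metric.ball_subset_closedBall.trans (Metric.closedBall_subset_closedBall' ?_)
      linarith
    have hB0 : volume (Metric.closedBall p s) ≠ 0 :=
      (Metric.measure_closedBall_pos volume p hs.1).ne'
    have hBt : volume (Metric.closedBall p s) ≠ ⊤ := measure_closedBall_lt_top.ne
    have hball : volume (Metric.ball z (s / 2)) = c * volume (Metric.closedBall p s) := by
      rw [Measure.addHaar_ball_of_pos _ _ (half_pos hs.1), Measure.addHaar_closedBall _ _ hs.1.le,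
        ← mul_assoc, ← ENNReal.ofReal_mul (by positivity)]
      congr 2
      rw [finrank_euclideanSpace_fin, ← mul_pow]
      congr 1
      ring
    have hle : frontier Ω ∩ Metric.closedBall p s ⊆
        Metric.closedBall p s \ Metric.ball z (s / 2) := fun y hy =>
      ⟨hy.2, fun hyz => hy.1.2 (hsub hyz)⟩
    rw [ENNReal.div_le_iff hB0 hBt]
    refine (measure_mono hle).trans ?_
    rw [measure_sdiff hsub2 Metric.isOpen_ball.measurableSet.nullMeasurableSet
      measure_ball_lt_top.ne, hball, ENNReal.sub_mul (fun _ _ => hBt), one_mul]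
  exact absurd (le_of_tendsto ht hev) (not_le.2 hc)

end IsRegularStrip

end RegularStrip

theorem PedestrianTraffic.HypOmega.exists_isRegularStrip {N : ℕ}
    {Ω : Set (EuclideanSpace ℝ (Fin N))} {r : ℝ} (h : HypOmega r Ω) :
    ∃ U D, IsRegularStrip r Ω U D := by
  obtain ⟨U, D, hU, hS, hD, heq⟩ := h.dist_C2
  obtain ⟨O, hO, -, rfl⟩ := h.closure_open
  exact ⟨U, D, h.rΩ_pos, isClosed_closure,
    closure_mono (interior_maximal subset_closure hO), hU, hD.of_le (by norm_num), hS, heq⟩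

/-! ### Extension of the preferred direction to the whole space -/

section Extension

variable {N : ℕ}

/-- Being Lipschitz, `α` is at least `1/2` on a ball of fixed radius around each point of `F`.
Integrability makes the set `{|α| ≥ 1/2}` of finite measure, so its part far from the origin is
smaller than one such ball. -/
theorem isBounded_of_memLp_one_of_eq_one {α : EuclideanSpace ℝ (Fin N) → ℝ}
    {F : Set (EuclideanSpace ℝ (Fin N))} (hα : ContDiff ℝ 1 α) (h1 : MemLp α 1 volume)
    (hd : MemLp (fderiv ℝ α) ∞ volume) (hF : ∀ x ∈ F, α x = 1) : Bornology.IsBounded F := by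
  set L := (eLpNorm (fderiv ℝ α) ∞ volume).toReal
  have hL : 0 ≤ L := ENNReal.toReal_nonneg
  have hlip (x y : EuclideanSpace ℝ (Fin N)) : ‖α x - α y‖ ≤ L * ‖x - y‖ :=
    convex_univ.norm_image_sub_le_of_norm_fderiv_le
      (fun z _ => hα.differentiable one_ne_zero z)
      (fun z _ => norm_le_of_memLp_top (hα.continuous_fderiv one_ne_zero) hd z)
      (mem_univ _) (mem_univ _)
  set δ := 1 / (2 * (L + 1))
  have hδ : 0 < δ := by positivity
  have hLδ : L * δ ≤ 1 / 2 := by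
    rw [mul_one_div, div_le_div_iff₀ (by positivity) (by norm_num)]
    linarith
  set S : Set (EuclideanSpace ℝ (Fin N)) := {x | ((1 / 2 : NNReal)) ≤ ‖α x‖₊}
  have hS : volume S < ⊤ := h1.meas_ge_lt_top one_ne_zero ENNReal.one_ne_top (by norm_num)
  have hball {p} (hp : p ∈ F) : Metric.ball p δ ⊆ S := by
    intro x hx
    have h2 := (hlip x p).trans ((mul_le_mul_of_nonneg_left
      (by rw [← dist_eq_norm]; exact le_of_lt hx) hL).trans hLδ)
    rw [hF p hp, Real.norm_eq_abs] at h2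
    have h3 := (abs_le.1 h2).1
    change ((1 / 2 : NNReal) : ℝ) ≤ ‖α x‖
    rw [Real.norm_eq_abs]
    refine le_trans ?_ (le_abs_self _)
    push_cast
    linarith
  set T : ℕ → Set (EuclideanSpace ℝ (Fin N)) := fun n => S ∩ {x | (n : ℝ) ≤ ‖x‖}
  have hSm : MeasurableSet S :=
    (isClosed_le continuous_const hα.continuous.nnnorm).measurableSet
  have hlim := tendsto_measure_iInter_atTop (μ := volume) (s := T)
    (fun n => (hSm.inter (isClosed_le continuous_const continuous_norm).measurableSet)
      |>.nullMeasurableSet)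
    (fun m n hmn x hx => ⟨hx.1, le_trans (Nat.cast_le.2 hmn : (m : ℝ) ≤ n) hx.2⟩)
    ⟨0, ((measure_mono inter_subset_left).trans_lt hS).ne⟩
  have hempty : ⋂ n, T n = ∅ := by
    refine eq_empty_of_forall_notMem fun x hx => ?_
    obtain ⟨n, hn⟩ := exists_nat_gt ‖x‖
    exact absurd (mem_iInter.1 hx n).2 (not_le.2 hn)
  rw [hempty, measure_empty] at hlim
  have hpos : 0 < volume (Metric.ball (0 : EuclideanSpace ℝ (Fin N)) δ) :=
    Metric.measure_ball_pos _ _ hδ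
  obtain ⟨n, hn⟩ := (hlim.eventually (gt_mem_nhds hpos)).exists
  refine (Metric.isBounded_closedBall (x := (0 : EuclideanSpace ℝ (Fin N)))
    (r := n + δ)).subset fun p hp => ?_
  by_contra hpn
  rw [mem_closedBall_zero_iff, not_le] at hpn
  refine absurd hn (not_lt.2 ?_)
  rw [← Measure.addHaar_ball_center volume p δ]
  refine measure_mono fun x hx => ⟨hball hp hx, ?_⟩
  have h4 : ‖p‖ ≤ ‖x‖ + ‖p - x‖ := by
    simpa using norm_add_le x (p - x)
  have h5 : ‖p - x‖ < δ := by rw [← dist_eq_norm, dist_comm]; exact hx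
  change (n : ℝ) ≤ ‖x‖
  linarith

section Sobolev

variable {X F : Type*} [NormedAddCommGroup X] [NormedSpace ℝ X] [MeasurableSpace X]
  [BorelSpace X] [NormedAddCommGroup F] [NormedSpace ℝ F] {k : ℕ} {p : ℝ≥0∞} {μ : Measure X}
  {f g : X → F}

theorem memLp_of_eq_add {G : Type*} [NormedAddCommGroup G] {a b c : X → G} (ha : MemLp a p μ)
    (hb : MemLp b p μ) (h : ∀ x, c x = a x + b x) : MemLp c p μ :=
  funext h ▸ ha.add hb

theorem PedestrianTraffic.MemSobolev.add (hf : MemSobolev k p f μ) (hg : MemSobolev k p g μ)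
    (hfc : ContDiff ℝ k f) (hgc : ContDiff ℝ k g) :
    MemSobolev k p (fun x => f x + g x) μ := fun j hj =>
  memLp_of_eq_add (hf j hj) (hg j hj) fun _ =>
    iteratedFDeriv_add_apply (hfc.of_le (Nat.cast_le.2 hj)).contDiffAt
      (hgc.of_le (Nat.cast_le.2 hj)).contDiffAt

theorem PedestrianTraffic.MemSobolev.of_hasCompactSupport [IsFiniteMeasureOnCompacts μ]
    (hfc : ContDiff ℝ k f) (hf : HasCompactSupport f) : MemSobolev k p f μ := fun j hj =>
  (hfc.continuous_iteratedFDeriv (by exact_mod_cast hj)).memLp_of_hasCompactSupport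
    (hf.iteratedFDeriv j)

end Sobolev

theorem contDiff_divergence {u : EuclideanSpace ℝ (Fin N) → EuclideanSpace ℝ (Fin N)}
    (hu : ContDiff ℝ 2 u) : ContDiff ℝ 1 (divergence u) := by
  rw [divergence_eq_traceCLM]
  exact (traceCLM N).contDiff.comp (hu.fderiv_right (by norm_num))

theorem hasCompactSupport_divergence {u : EuclideanSpace ℝ (Fin N) → EuclideanSpace ℝ (Fin N)}
    (hu : HasCompactSupport u) : HasCompactSupport (divergence u) := by
  rw [divergence_eq_traceCLM]
  exact (hu.fderiv ℝ).comp_left (map_zero _)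

theorem divergence_add {u w : EuclideanSpace ℝ (Fin N) → EuclideanSpace ℝ (Fin N)}
    (hu : Differentiable ℝ u) (hw : Differentiable ℝ w) :
    divergence (fun x => u x + w x) = fun x => divergence u x + divergence w x := by
  simp only [divergence_eq_traceCLM]
  ext x
  rw [fderiv_fun_add (hu x) (hw x), map_add]

theorem PedestrianTraffic.HypNu.add_of_hasCompactSupport
    {g δ : EuclideanSpace ℝ (Fin N) → EuclideanSpace ℝ (Fin N)} (hg : HypNu g)
    (hδ : ContDiff ℝ 2 δ) (hδc : HasCompactSupport δ) : HypNu fun x => g x + δ x := by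
  have h1 : ContDiff ℝ 1 g := hg.contDiff.of_le (by norm_num)
  have h2 : ContDiff ℝ 1 δ := hδ.of_le (by norm_num)
  have hdiv := divergence_add (h1.differentiable one_ne_zero) (h2.differentiable one_ne_zero)
  have hg2 := contDiff_divergence hg.contDiff
  have hδ2 := contDiff_divergence hδ
  refine ⟨hg.contDiff.add hδ, hg.memW1inf.add (.of_hasCompactSupport h2 hδc) h1 h2, ?_, ?_⟩
  · rw [hdiv]
    exact hg.div_memW11.add
      (.of_hasCompactSupport hδ2 (hasCompactSupport_divergence hδc)) hg2 hδ2
  · rw [hdiv]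
    exact hg.div_memW1inf.add
      (.of_hasCompactSupport hδ2 (hasCompactSupport_divergence hδc)) hg2 hδ2

open scoped Manifold in
theorem exists_contDiff_hasCompactSupport_eq_one {K U : Set (EuclideanSpace ℝ (Fin N))}
    (hK : IsCompact K) (hU : IsOpen U) (hKU : K ⊆ U) :
    ∃ χ : EuclideanSpace ℝ (Fin N) → ℝ, ContDiff ℝ ∞ χ ∧ HasCompactSupport χ ∧
      tsupport χ ⊆ U ∧ ∀ x ∈ K, χ x = 1 := by
  obtain ⟨L, hL, hKL, hLU⟩ := exists_compact_between hK hU hKU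
  obtain ⟨f, hf1, hf0, -⟩ := exists_contMDiffMap_one_nhds_of_subset_interior
    𝓘(ℝ, EuclideanSpace ℝ (Fin N)) (n := ⊤) hK.isClosed hKL
  have hsub : tsupport f ⊆ L := closure_minimal (fun x hx => by
    by_contra hxL
    exact hx (hf0 x hxL)) hL.isClosed
  exact ⟨f, f.contMDiff.contDiff, hL.of_isClosed_subset (isClosed_tsupport _) hsub,
    hsub.trans hLU, fun x hx => hf1.self_of_nhdsSet x hx⟩

/-- The closed strip is compact and contained in the open set where the extension `D` is `C³`, so a
smooth cutoff makes the discomfort a compactly supported `C²` field without changing it on the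
strip. -/
theorem exists_hypNu_isGPlusDiscomfort {Ω : Set (EuclideanSpace ℝ (Fin N))} {r : ℝ} (lam : ℝ)
    {g : EuclideanSpace ℝ (Fin N) → EuclideanSpace ℝ (Fin N)} {α : EuclideanSpace ℝ (Fin N) → ℝ}
    (hΩ : HypOmega r Ω) (hg : HypNu g) (hα : HypAlpha r Ω α)
    (hdist : DistOfClass 3 Ω (Metric.cthickening r (frontier Ω) ∩ Ω))
    (hc : IsCompact (frontier Ω)) :
    ∃ ν, IsGPlusDiscomfort lam Ω g α ν ∧ HypNu ν := by
  obtain ⟨U, D, hU, hS, hD, heq⟩ := hdist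
  obtain ⟨_, _, hstrip⟩ := hΩ.exists_isRegularStrip
  have hsub : Metric.thickening r (frontier Ω) ∩ Ω ⊆ Metric.cthickening r (frontier Ω) ∩ Ω :=
    inter_subset_inter_left _ (Metric.thickening_subset_cthickening _ _)
  have hreg : IsRegularStrip r Ω U D := ⟨hstrip.pos, hstrip.isClosed, hstrip.subset_closure, hU,
    hD.of_le (by norm_num), hsub.trans hS, fun x hx => heq x (hsub hx)⟩
  obtain ⟨χ, hχ, hχc, hχU, hχ1⟩ := exists_contDiff_hasCompactSupport_eq_one
    (hc.cthickening.inter_right hstrip.isClosed) hU hS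
  set δ : EuclideanSpace ℝ (Fin N) → EuclideanSpace ℝ (Fin N) := fun x =>
    (lam * α x * χ x) • gradient D x
  have hδ : ContDiff ℝ 2 δ := by
    rw [contDiff_iff_contDiffAt]
    intro x
    by_cases hx : x ∈ tsupport χ
    · have h1 : ContDiffAt ℝ 3 D x := hD.contDiffAt (hU.mem_nhds (hχU hx))
      have h2 : ContDiffAt ℝ 2 (fderiv ℝ D) x := h1.fderiv_right (by norm_num)
      have h3 : ContDiffAt ℝ 2 (gradient D) x :=
        (gradientIsometry N).toContinuousLinearMap.contDiff.contDiffAt.comp x h2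
      have h4 : ContDiff ℝ 2 χ := contDiff_infty.1 hχ 2
      exact ((contDiffAt_const.mul hα.contDiff.contDiffAt).mul h4.contDiffAt).smul h3
    · have : δ =ᶠ[𝓝 x] fun _ => 0 := by
        filter_upwards [(isClosed_tsupport χ).isOpen_compl.mem_nhds hx] with y hy
        simp [δ, image_eq_zero_of_notMem_tsupport hy]
      exact contDiffAt_const.congr_of_eventuallyEq this
  have hδc : HasCompactSupport δ := by
    refine hχc.mono fun x hx => ?_
    rw [Function.mem_support] at hx ⊢
    contrapose! hx
    simp [δ, hx]
  refine ⟨fun x => g x + δ x, fun x hx => ?_, HypNu.add_of_hasCompactSupport hg hδ hδc⟩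
  by_cases hxt : x ∈ Metric.thickening r (frontier Ω)
  · rw [hreg.inwardNormal_eq ⟨hxt, hx⟩]
    simp only [δ]
    rw [hχ1 x (hsub ⟨hxt, hx⟩), mul_one]
  -- Outside the strip the factor `α` must vanish: a point of the complement within `r` of `x` would
  -- give a boundary point within `r`.
  · have hball : Metric.ball x r ⊆ Ω := by
      intro y hy
      by_contra hyΩ
      obtain ⟨z, hzf, hz⟩ := exists_mem_frontier_infDist_compl_eq_dist hx
        (ne_univ_iff_exists_notMem Ω |>.2 ⟨y, hyΩ⟩)
      have h1 : Metric.infDist x Ωᶜ ≤ dist x y := Metric.infDist_le_dist_of_mem hyΩ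
      have h2 : dist x y < r := by rw [dist_comm]; exact hy
      exact hxt (Metric.mem_thickening_iff.2 ⟨z, hzf, by linarith⟩)
    simp [δ, hα.eq_zero x hball]

end Extension

/-! ### Normal component of the velocity at the boundary -/

section NormalComponent

variable {N : ℕ}

theorem PedestrianTraffic.MemSobolev.memLp {X F : Type*} [NormedAddCommGroup X] [NormedSpace ℝ X]
    [MeasurableSpace X] [BorelSpace X] [SecondCountableTopology X] [NormedAddCommGroup F]
    [NormedSpace ℝ F] {k : ℕ} {p : ℝ≥0∞} {μ : Measure X} {f : X → F} (h : MemSobolev k p f μ)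
    (hf : ContDiff ℝ k f) : MemLp f p μ :=
  (h 0 (Nat.zero_le _)).congr_norm hf.continuous.aestronglyMeasurable
    (Eventually.of_forall fun _ => norm_iteratedFDeriv_zero)

theorem PedestrianTraffic.MemSobolev.memLp_fderiv {X F : Type*} [NormedAddCommGroup X]
    [NormedSpace ℝ X] [MeasurableSpace X] [BorelSpace X] [SecondCountableTopology X]
    [NormedAddCommGroup F] [NormedSpace ℝ F] {k : ℕ} {p : ℝ≥0∞} {μ : Measure X} {f : X → F}
    (h : MemSobolev k p f μ) (hf : ContDiff ℝ k f) (hk : 1 ≤ k) : MemLp (fderiv ℝ f) p μ := by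
  have hc : Continuous (fderiv ℝ f) := hf.continuous_fderiv (by
    have : k ≠ 0 := by omega
    exact_mod_cast this)
  exact (h 1 hk).congr_norm hc.aestronglyMeasurable
    (Eventually.of_forall fun _ => norm_iteratedFDeriv_one _)

variable {η : EuclideanSpace ℝ (Fin N) → ℝ} {φ : ℝ → ℝ}
  {g : EuclideanSpace ℝ (Fin N) → EuclideanSpace ℝ (Fin N)} {D : Set (EuclideanSpace ℝ (Fin N))}
  {C M R : ℝ}

theorem fderiv_anisotropicKernel_apply (hη : Differentiable ℝ η) (hφ : Differentiable ℝ φ)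
    (hg : Differentiable ℝ g) (x y u : EuclideanSpace ℝ (Fin N)) :
    fderiv ℝ (fun z => anisotropicKernel η φ g z y) x u =
      fderiv ℝ η (x - y) u * φ (inner ℝ (y - x) (g x)) +
        η (x - y) * (deriv φ (inner ℝ (y - x) (g x)) *
          (inner ℝ (y - x) (fderiv ℝ g x u) - inner ℝ u (g x))) := by
  have h1 : HasFDerivAt (fun z => η (z - y)) (fderiv ℝ η (x - y)) x := by
    have := (hη (x - y)).hasFDerivAt.comp x ((hasFDerivAt_id x).sub_const y)
    rw [ContinuousLinearMap.comp_id] at this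
    exact this
  have h2 := HasFDerivAt.inner ℝ ((hasFDerivAt_id x).const_sub y) (hg x).hasFDerivAt
  have h3 := ((hφ _).hasDerivAt.comp_hasFDerivAt x h2)
  have h4 := h1.mul h3
  refine (congrArg (fun l => l u) h4.fderiv).trans ?_
  simp [inner_sub_left]
  ring

/-- The derivative of the kernel along `n` has three terms. Those with `∇η` and with `(y-x)·Dg n`
are bounded, as `|y-x| ≤ ℓ` where `η(x-y) ≠ 0`; the third, `-η φ' n·g`, is nonpositive and is
dropped. -/
theorem inner_gradient_weightedAverage_le (hk : KernelBound 3 C M (anisotropicKernel η φ g))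
    (hη : HypEta η) (hφ : Differentiable ℝ φ) (hg : Differentiable ℝ g) {Φ Γ : ℝ}
    (hΦ0 : ∀ s, |φ s| ≤ Φ) (hΦ1 : ∀ s, |deriv φ s| ≤ Φ) (hΓ : ∀ x, ‖fderiv ℝ g x‖ ≤ Γ)
    (hφ' : ∀ s, 0 ≤ deriv φ s) {r : EuclideanSpace ℝ (Fin N) →₁[volume] ℝ} (hr : IsDensity R r)
    (hR : 0 ≤ R) {x n : EuclideanSpace ℝ (Fin N)} (hn : ‖n‖ = 1) (hgn : 0 ≤ inner ℝ (g x) n) :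
    inner ℝ (gradient (weightedAverage η φ g D r) x) n ≤
      R * (((∫ y, ‖η y‖) + ∫ y, ‖fderiv ℝ η y‖) * Φ *
        (1 + Metric.diam (insert 0 (tsupport η)) * Γ)) := by
  set ℓ := Metric.diam (insert 0 (tsupport η))
  have hℓ : 0 ≤ ℓ := Metric.diam_nonneg
  have hΦ : 0 ≤ Φ := (abs_nonneg _).trans (hΦ0 0)
  have hΓ0 : 0 ≤ Γ := (norm_nonneg _).trans (hΓ x)
  have hηd : Differentiable ℝ η := hη.contDiff.differentiable (by norm_num)
  have hηi : Integrable fun y => ‖η y‖ :=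
    (hη.contDiff.continuous.integrable_of_hasCompactSupport hη.hasCompactSupport).norm
  have hη'i : Integrable fun y => ‖fderiv ℝ η y‖ :=
    ((hη.contDiff.continuous_fderiv (by norm_num)).integrable_of_hasCompactSupport
      (hη.hasCompactSupport.fderiv ℝ)).norm
  set b : EuclideanSpace ℝ (Fin N) → ℝ := fun z => R * (‖fderiv ℝ η z‖ * Φ + ‖η z‖ * (Φ * (ℓ * Γ)))
  have hbi : Integrable b := ((hη'i.mul_const _).add (hηi.mul_const _)).const_mul R
  have hb0 (z) : 0 ≤ b z := by positivity
  have hpt (y : EuclideanSpace ℝ (Fin N)) :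
      fderiv ℝ (fun z => anisotropicKernel η φ g z y) x n ≤
        ‖fderiv ℝ η (x - y)‖ * Φ + ‖η (x - y)‖ * (Φ * (ℓ * Γ)) := by
    rw [fderiv_anisotropicKernel_apply hηd hφ hg]
    refine add_le_add ?_ ?_
    · refine (le_abs_self _).trans ?_
      rw [abs_mul]
      gcongr
      · have := (fderiv ℝ η (x - y)).le_opNorm n
        rwa [hn, mul_one, Real.norm_eq_abs] at this
      · exact hΦ0 _
    · rw [Real.norm_eq_abs, abs_of_nonneg (hη.nonneg _)]
      by_cases h0 : η (x - y) = 0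
      · simp [h0]
      refine mul_le_mul_of_nonneg_left ?_ (hη.nonneg _)
      have hdist : ‖y - x‖ ≤ ℓ := by
        rw [norm_sub_rev, ← dist_zero_right]
        refine Metric.dist_le_diam_of_mem ?_ (mem_insert_of_mem _ (subset_tsupport η h0))
          (mem_insert _ _)
        exact (hη.hasCompactSupport.isCompact.insert 0).isBounded
      have hin : inner ℝ (y - x) (fderiv ℝ g x n) - inner ℝ n (g x) ≤ ℓ * Γ := by
        have h1 : inner ℝ (y - x) (fderiv ℝ g x n) ≤ ‖y - x‖ * ‖fderiv ℝ g x n‖ :=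
          real_inner_le_norm _ _
        have h2 : ‖fderiv ℝ g x n‖ ≤ Γ := by
          have := (fderiv ℝ g x).le_opNorm n
          rw [hn, mul_one] at this
          exact this.trans (hΓ x)
        rw [real_inner_comm] at hgn
        have h3 : ‖y - x‖ * ‖fderiv ℝ g x n‖ ≤ ℓ * Γ := by gcongr
        linarith
      calc _ ≤ deriv φ (inner ℝ (y - x) (g x)) * (ℓ * Γ) :=
            mul_le_mul_of_nonneg_left hin (hφ' _)
        _ ≤ _ := by
          gcongr
          exact (le_abs_self _).trans (hΦ1 _)
  have hint := hk.fderiv.integrable r x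
  have h1 : inner ℝ (gradient (weightedAverage η φ g D r) x) n =
      ∫ y in D, r y * fderiv ℝ (fun z => anisotropicKernel η φ g z y) x n := by
    rw [inner_gradient_left, weightedAverage_eq_kernelOperator,
      hk.fderiv_kernelOperator, kernelOperator,
      ContinuousLinearMap.integral_apply hint.integrableOn]
    simp
  have hint' : Integrable fun y => r y * fderiv ℝ (fun z => anisotropicKernel η φ g z y) x n := by
    simpa using hint.apply_continuousLinearMap n
  rw [h1]
  calc ∫ y in D, r y * fderiv ℝ (fun z => anisotropicKernel η φ g z y) x n
      ≤ ∫ y in D, b (x - y) := by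
        refine integral_mono_ae hint'.integrableOn (hbi.comp_sub_left x).integrableOn
          (ae_restrict_of_ae ?_)
        filter_upwards [hr] with y hy
        calc _ ≤ r y * (‖fderiv ℝ η (x - y)‖ * Φ + ‖η (x - y)‖ * (Φ * (ℓ * Γ))) :=
              mul_le_mul_of_nonneg_left (hpt y) hy.1
          _ ≤ _ := mul_le_mul_of_nonneg_right hy.2 (by positivity)
    _ ≤ ∫ y, b (x - y) := setIntegral_le_integral (hbi.comp_sub_left x)
        (Eventually.of_forall fun y => hb0 _)
    _ = ∫ y, b y := integral_sub_left_eq_self b volume x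
    _ = R * ((∫ y, ‖fderiv ℝ η y‖) * Φ + (∫ y, ‖η y‖) * (Φ * (ℓ * Γ))) := by
      rw [integral_const_mul, integral_add (hη'i.mul_const _) (hηi.mul_const _),
        integral_mul_const, integral_mul_const]
    -- The terms `‖η‖ Φ` and `‖∇η‖ Φ ℓ Γ` are added only to factor the bound.
    _ ≤ _ := by
      gcongr
      have ha : 0 ≤ ∫ y, ‖η y‖ := integral_nonneg fun _ => norm_nonneg _
      have hb : 0 ≤ ∫ y, ‖fderiv ℝ η y‖ := integral_nonneg fun _ => norm_nonneg _
      have h2 : 0 ≤ (∫ y, ‖η y‖) * Φ := by positivity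
      have h3 : 0 ≤ (∫ y, ‖fderiv ℝ η y‖) * Φ * (ℓ * Γ) := by positivity
      nlinarith

/-- Under the smallness condition of the invariance theorem the nonlocal term cannot overcome
the discomfort in an inward direction `n`. -/
theorem neg_le_inner_anisotropicI {ε lam : ℝ} (hε : 0 ≤ ε) (hlam : 0 ≤ lam) (hη : HypEta η)
    (hg : ContDiff ℝ 3 g) (hgW : MemSobolev 3 ∞ g volume) (hφ : ContDiff ℝ 3 φ)
    (hφW : MemSobolev 3 ∞ φ volume) (hφ' : ∀ s, 0 ≤ deriv φ s)
    (hsmall : ENNReal.ofReal (ε * R) * normW11 η * normW1inf φ *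
      (1 + ENNReal.ofReal (Metric.diam (insert 0 (tsupport η))) * eLpNorm (fderiv ℝ g) ∞ volume)
        ≤ ENNReal.ofReal lam)
    {r : EuclideanSpace ℝ (Fin N) →₁[volume] ℝ} (hr : IsDensity R r) (hR : 0 ≤ R)
    {x n : EuclideanSpace ℝ (Fin N)} (hn : ‖n‖ = 1) (hgn : 0 ≤ inner ℝ (g x) n) :
    -lam ≤ inner ℝ (anisotropicI ε η φ g D r x) n := by
  obtain ⟨C, M, hk⟩ := exists_kernelBound_anisotropicKernel hη.contDiff hη.hasCompactSupport
    hφ hφW hg hgW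
  have hφ0 : MemLp φ ∞ volume := hφW.memLp hφ
  have hφ1 : MemLp (fderiv ℝ φ) ∞ volume := hφW.memLp_fderiv hφ (by norm_num)
  have hg1 : MemLp (fderiv ℝ g) ∞ volume := hgW.memLp_fderiv hg (by norm_num)
  have hηc := hη.contDiff.continuous
  have hη'c : Continuous (fderiv ℝ η) := hη.contDiff.continuous_fderiv (by norm_num)
  have hηi : Integrable η := hηc.integrable_of_hasCompactSupport hη.hasCompactSupport
  have hη'i : Integrable (fderiv ℝ η) :=
    hη'c.integrable_of_hasCompactSupport (hη.hasCompactSupport.fderiv ℝ)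
  have hφtop : normW1inf φ ≠ ⊤ := (max_lt hφ0.eLpNorm_lt_top hφ1.eLpNorm_lt_top).ne
  set Φ := (normW1inf φ).toReal
  set Γ := (eLpNorm (fderiv ℝ g) ∞ volume).toReal
  have hΦ0 (s) : |φ s| ≤ Φ := (norm_le_of_memLp_top hφ.continuous hφ0 s).trans
    (ENNReal.toReal_mono hφtop (le_max_left _ _))
  have hΦ1 (s) : |deriv φ s| ≤ Φ := by
    rw [← Real.norm_eq_abs, norm_deriv_eq_norm_fderiv]
    exact (norm_le_of_memLp_top (hφ.continuous_fderiv (by norm_num)) hφ1 s).trans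
      (ENNReal.toReal_mono hφtop (le_max_right _ _))
  have hΓ (x) : ‖fderiv ℝ g x‖ ≤ Γ :=
    norm_le_of_memLp_top (hg.continuous_fderiv (by norm_num)) hg1 x
  have hle := inner_gradient_weightedAverage_le (D := D) hk hη (hφ.differentiable (by norm_num))
    (hg.differentiable (by norm_num)) hΦ0 hΦ1 hΓ hφ' hr hR hn hgn
  set B := R * (((∫ y, ‖η y‖) + ∫ y, ‖fderiv ℝ η y‖) * Φ *
        (1 + Metric.diam (insert 0 (tsupport η)) * Γ))
  have ha : 0 ≤ ∫ y, ‖η y‖ := integral_nonneg fun _ => norm_nonneg _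
  have hb : 0 ≤ ∫ y, ‖fderiv ℝ η y‖ := integral_nonneg fun _ => norm_nonneg _
  have hΦnn : 0 ≤ Φ := ENNReal.toReal_nonneg
  have hΓnn : 0 ≤ Γ := ENNReal.toReal_nonneg
  have hdiam : 0 ≤ Metric.diam (insert 0 (tsupport η)) := Metric.diam_nonneg
  have hB : 0 ≤ B := by positivity
  have hεB : ε * B ≤ lam := by
    have h11 : normW11 η = ENNReal.ofReal ((∫ y, ‖η y‖) + ∫ y, ‖fderiv ℝ η y‖) := by
      rw [ENNReal.ofReal_add ha hb, ofReal_integral_norm_eq_lintegral_enorm hηi,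
        ofReal_integral_norm_eq_lintegral_enorm hη'i, normW11, eLpNorm_one_eq_lintegral_enorm,
        eLpNorm_one_eq_lintegral_enorm]
    rw [h11, ← ENNReal.ofReal_toReal hφtop, ← ENNReal.ofReal_toReal hg1.eLpNorm_ne_top,
      ← ENNReal.ofReal_one, ← ENNReal.ofReal_mul hdiam,
      ← ENNReal.ofReal_add zero_le_one (by positivity), ← ENNReal.ofReal_mul (by positivity),
      ← ENNReal.ofReal_mul (by positivity), ← ENNReal.ofReal_mul (by positivity),
      ENNReal.ofReal_le_ofReal_iff hlam] at hsmall
    refine le_trans (le_of_eq ?_) hsmall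
    simp only [B]
    ring
  rw [anisotropicI_eq_saturation, saturation, inner_neg_left, real_inner_smul_left,
    neg_le_neg_iff]
  set p := gradient (weightedAverage η φ g D r) x
  -- The saturation only shrinks the gradient, so it can be discarded against the nonnegative bound
  -- `B`.
  have hs : 1 ≤ √(1 + ‖p‖ ^ 2) := Real.one_le_sqrt.2 (by nlinarith [sq_nonneg ‖p‖])
  calc ε / √(1 + ‖p‖ ^ 2) * inner ℝ p n ≤ ε / √(1 + ‖p‖ ^ 2) * B :=
        mul_le_mul_of_nonneg_left hle (by positivity)
    _ ≤ ε * B := mul_le_mul_of_nonneg_right (div_le_self hε hs) hB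
    _ ≤ lam := hεB

theorem inner_velocity_nonneg {Ω U : Set (EuclideanSpace ℝ (Fin N))} {rΩ lam : ℝ}
    {d : EuclideanSpace ℝ (Fin N) → ℝ} (hs : IsRegularStrip rΩ Ω U d)
    {α : EuclideanSpace ℝ (Fin N) → ℝ} {ν J : EuclideanSpace ℝ (Fin N) → EuclideanSpace ℝ (Fin N)}
    (hg : HypG Ω g) (hα : HypAlpha rΩ Ω α) (hν : IsGPlusDiscomfort lam Ω g α ν)
    (hJ : ∀ x n, ‖n‖ = 1 → 0 ≤ inner ℝ (g x) n → -lam ≤ inner ℝ (J x) n)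
    {p n : EuclideanSpace ℝ (Fin N)} {t : ℝ} (hp : IsNearestPoint Ω p n t) :
    0 ≤ inner ℝ (ν p + J p) n := by
  have hpf := hp.mem_frontier
  have hn : inwardNormal Ω p = n := by
    rw [hs.inwardNormal_eq (hs.frontier_subset hpf), hs.gradient_eq_of_isNearestPoint hp]
  have hgn := hg.inward p hpf
  rw [hn] at hgn
  rw [inner_add_left, hν p (hs.isClosed.frontier_subset hpf), hα.eq_one p hpf, hn, mul_one,
    inner_add_left, real_inner_smul_left, real_inner_self_eq_norm_sq, hp.norm_eq_one]
  linarith [hJ p n hp.norm_eq_one hgn]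

end NormalComponent

/-! ### A differential inequality in weak form -/

section Gronwall

/-- The test inequality says `m' ≤ F ≤ K` weakly, with initial value at most `c`. A decreasing step
located just before a time `τ` at which the claim fails contradicts it. -/
theorem le_add_mul_of_forall_test {T : ℝ} {m F : ℝ → ℝ} {c K : ℝ}
    (hm : ContinuousOn m (Icc 0 T)) (hF : ContinuousOn F (Icc 0 T)) (hFK : ∀ t ∈ Icc 0 T, F t ≤ K)
    (h : ∀ θ : ℝ → ℝ, ContDiff ℝ ∞ θ → HasCompactSupport θ → (∀ t, 0 ≤ θ t) →
      0 ≤ (∫ t in (0 : ℝ)..T, (deriv θ t * m t + θ t * F t)) + θ 0 * c) (hT : 0 < T) :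
    ∀ t ∈ Icc 0 T, m t ≤ c + K * t := by
  suffices hI : ∀ τ ∈ Ioo 0 T, m τ ≤ c + K * τ by
    have hcl : Icc 0 T = closure (Ioo 0 T) := (closure_Ioo hT.ne).symm
    intro t ht
    exact le_on_closure (g := fun t => c + K * t) hI (hcl ▸ hm) (by fun_prop) (hcl ▸ ht)
  intro τ hτ
  by_contra! hlt
  have hTT : uIcc 0 T = Icc 0 T := uIcc_of_le hT.le
  -- The test function below will yield `c' ≤ c`.
  obtain ⟨c', hc', hc'τ⟩ : ∃ c', c < c' ∧ c' < m τ - K * τ := exists_between (by linarith)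
  have hcont : ContinuousAt (fun t => m t - K * t) τ :=
    (hm.continuousAt (Icc_mem_nhds hτ.1 hτ.2)).sub (by fun_prop)
  obtain ⟨δ₀, hδ₀, hball⟩ := Metric.eventually_nhds_iff.1 (hcont.eventually (lt_mem_nhds hc'τ))
  set δ := min (δ₀ / 2) τ
  have hδ : 0 < δ := lt_min (half_pos hδ₀) hτ.1
  have hδτ : δ ≤ τ := min_le_right _ _
  have hδδ : δ < δ₀ := (min_le_left _ _).trans_lt (half_lt_self hδ₀)
  set s : ℝ → ℝ := fun t => Real.smoothTransition ((τ - t) / δ)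
  have hs : ContDiff ℝ ∞ s := Real.smoothTransition.contDiff.comp (by fun_prop)
  -- The second factor makes the support compact and is one for `t ≥ -1`, hence invisible on `[0,
  -- T]`.
  set θ : ℝ → ℝ := fun t => s t * Real.smoothTransition (t + 2)
  have hθ : ContDiff ℝ ∞ θ :=
    hs.mul (Real.smoothTransition.contDiff.comp (by fun_prop))
  have hs0 : ∀ t, τ ≤ t → s t = 0 := fun t ht =>
    Real.smoothTransition.zero_of_nonpos (div_nonpos_of_nonpos_of_nonneg (by linarith) hδ.le)
  have hs1 : ∀ t, t ≤ τ - δ → s t = 1 := fun t ht =>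
    Real.smoothTransition.one_of_one_le (by rw [le_div_iff₀ hδ]; linarith)
  have hsanti : Antitone s := fun a b hab => Real.smoothTransition.monotone
    (div_le_div_of_nonneg_right (by linarith) hδ.le)
  have hθc : HasCompactSupport θ := by
    refine HasCompactSupport.intro (isCompact_Icc (a := -2) (b := τ)) fun t ht => ?_
    rw [mem_Icc, not_and_or, not_le, not_le] at ht
    rcases ht with ht | ht
    · simp only [θ]
      rw [Real.smoothTransition.zero_of_nonpos (by linarith), mul_zero]
    · simp only [θ]
      rw [hs0 t ht.le, zero_mul]
  have hθs : ∀ t, -1 < t → θ =ᶠ[𝓝 t] s := fun t ht => by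
    filter_upwards [lt_mem_nhds ht] with u hu
    simp only [θ]
    rw [Real.smoothTransition.one_of_one_le (by linarith), mul_one]
  have hsd : Differentiable ℝ s := hs.differentiable (by simp)
  have hsdc : Continuous (deriv s) := hs.continuous_deriv (by simp)
  have key := h θ hθ hθc fun t =>
    mul_nonneg (Real.smoothTransition.nonneg _) (Real.smoothTransition.nonneg _)
  rw [(hθs 0 (by norm_num)).self_of_nhds, hs1 0 (by linarith), one_mul] at key
  have hG : ContinuousOn (fun t => deriv s t * m t + s t * F t) (Icc 0 T) :=
    (hsdc.continuousOn.mul hm).add (hs.continuous.continuousOn.mul hF)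
  have hle : (∫ t in (0 : ℝ)..T, (deriv θ t * m t + θ t * F t)) ≤
      ∫ t in (0 : ℝ)..T, (deriv s t * c' + (deriv s t * (K * t) + s t * K)) := by
    have : (∫ t in (0 : ℝ)..T, (deriv θ t * m t + θ t * F t)) =
        ∫ t in (0 : ℝ)..T, (deriv s t * m t + s t * F t) := by
      refine intervalIntegral.integral_congr fun t ht => ?_
      rw [hTT] at ht
      have := hθs t (by linarith [ht.1])
      simp only [this.deriv_eq, this.self_of_nhds]
    rw [this]
    refine intervalIntegral.integral_mono_on hT.le ?_ ?_ fun t ht => ?_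
    · exact ContinuousOn.intervalIntegrable (hTT ▸ hG)
    · exact Continuous.intervalIntegrable (by
        have := hs.continuous
        fun_prop) _ _
    · have hst : 0 ≤ s t := Real.smoothTransition.nonneg _
      have h1 : s t * F t ≤ s t * K := mul_le_mul_of_nonneg_left (hFK t ht) hst
      have hd : deriv s t ≤ 0 := by
        exact hsanti.deriv_nonpos
      -- The derivative of `s` is nonpositive and vanishes outside `[τ - δ, τ]`, where `m t - K * t
      -- > c'`.
      have h2 : deriv s t * (m t - K * t) ≤ deriv s t * c' := by
        by_cases htτ : τ < t
        · have : s =ᶠ[𝓝 t] fun _ => 0 := by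
            filter_upwards [lt_mem_nhds htτ] with u hu using hs0 u (le_of_lt hu)
          simp [this.deriv_eq]
        · by_cases htδ : t < τ - δ
          · have : s =ᶠ[𝓝 t] fun _ => 1 := by
              filter_upwards [gt_mem_nhds htδ] with u hu using hs1 u (le_of_lt hu)
            simp [this.deriv_eq]
          · refine mul_le_mul_of_nonpos_left (hball ?_).le hd
            rw [Real.dist_eq, abs_lt]
            constructor <;> linarith
      linarith
  -- The integrand is the exact derivative of `s t * (c' + K * t)`, and `s` goes from `1` to `0`.
  have hparts : (∫ t in (0 : ℝ)..T, (deriv s t * c' + (deriv s t * (K * t) + s t * K))) = -c' := by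
    have hder : ∀ t ∈ uIcc 0 T, HasDerivAt (fun t => s t * c' + s t * (K * t))
        (deriv s t * c' + (deriv s t * (K * t) + s t * K)) t := fun t _ => by
      have h1 := (hsd t).hasDerivAt
      have h2 : HasDerivAt (fun t : ℝ => K * t) K t := by
        simpa using (hasDerivAt_id' t).const_mul K
      exact (h1.mul_const c').add (h1.mul h2)
    rw [intervalIntegral.integral_eq_sub_of_hasDerivAt hder (Continuous.intervalIntegrable (by
      have := hs.continuous
      fun_prop) _ _), hs0 T hτ.2.le, hs1 0 (by linarith)]
    ring
  linarith

end Gronwall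

/-! ### Smoothing of C¹ weights -/

section Mollification

variable {N : ℕ}

/-- Entropy test functions are smooth, the wall cutoff is only `C¹`. Convolution with a narrow bump
commutes with the derivative, and `χ` and its derivative are uniformly continuous. -/
theorem exists_contDiff_approx_of_hasCompactSupport {χ : EuclideanSpace ℝ (Fin N) → ℝ}
    (hχ : ContDiff ℝ 1 χ) (hc : HasCompactSupport χ) (h0 : ∀ x, 0 ≤ χ x) {δ : ℝ} (hδ : 0 < δ) :
    ∃ χ' : EuclideanSpace ℝ (Fin N) → ℝ, ContDiff ℝ ∞ χ' ∧ HasCompactSupport χ' ∧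
      (∀ x, 0 ≤ χ' x) ∧ (∀ x, |χ' x - χ x| ≤ δ) ∧
      ∀ x, ‖gradient χ' x - gradient χ x‖ ≤ δ := by
  have hd : Continuous (fderiv ℝ χ) := hχ.continuous_fderiv one_ne_zero
  have hu0 := hχ.continuous.uniformContinuous_of_tendsto_cocompact hc.is_zero_at_infty
  have hu1 := hd.uniformContinuous_of_tendsto_cocompact (hc.fderiv ℝ).is_zero_at_infty
  obtain ⟨a, ha, hδa⟩ := Metric.uniformContinuous_iff.1 hu0 δ hδ
  obtain ⟨b, hb, hδb⟩ := Metric.uniformContinuous_iff.1 hu1 δ hδ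
  have hab : 0 < min a b := lt_min ha hb
  let f : ContDiffBump (0 : EuclideanSpace ℝ (Fin N)) :=
    ⟨min a b / 2, min a b, half_pos hab, half_lt_self hab⟩
  have hfi : LocallyIntegrable (f.normed volume) volume := f.continuous_normed.locallyIntegrable
  have hfs : ContDiff ℝ ∞ (f.normed volume) := f.contDiff_normed
  have hsm : ContDiff ℝ ∞
      (convolution (f.normed volume) χ (ContinuousLinearMap.lsmul ℝ ℝ) volume) :=
    f.hasCompactSupport_normed.contDiff_convolution_left _ hfs hχ.continuous.locallyIntegrable
  refine ⟨_, hsm, ?_, ?_, ?_, ?_⟩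
  · exact f.hasCompactSupport_normed.convolution _ hc
  · intro x
    refine integral_nonneg fun y => ?_
    exact mul_nonneg (f.nonneg_normed _) (h0 _)
  · intro x
    rw [← Real.dist_eq]
    exact f.dist_normed_convolution_le hχ.continuous.aestronglyMeasurable fun y hy =>
      (hδa (lt_of_lt_of_le hy (min_le_left _ _))).le
  · intro x
    rw [gradient_eq_gradientIsometry, gradient_eq_gradientIsometry, ← map_sub,
      LinearIsometry.norm_map, ← dist_eq_norm,
      (hc.hasFDerivAt_convolution_right (ContinuousLinearMap.lsmul ℝ ℝ) hfi hχ x).fderiv]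
    have := f.dist_normed_convolution_le (μ := volume) (x₀ := x) (g := fderiv ℝ χ) (ε := δ)
      hd.aestronglyMeasurable fun y hy => (hδb (lt_of_lt_of_le hy (min_le_right _ _))).le
    have hL : ContinuousLinearMap.precompR (EuclideanSpace ℝ (Fin N))
        (ContinuousLinearMap.lsmul ℝ ℝ : ℝ →L[ℝ] ℝ →L[ℝ] ℝ) = ContinuousLinearMap.lsmul ℝ ℝ := rfl
    rwa [hL]

end Mollification

/-! ### Balance of weighted masses -/

section WeakFormulation

variable {N : ℕ} {R V T B W : ℝ} {v : ℝ → ℝ}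
  {ν : EuclideanSpace ℝ (Fin N) → EuclideanSpace ℝ (Fin N)}
  {J : (EuclideanSpace ℝ (Fin N) →₁[volume] ℝ) →
    EuclideanSpace ℝ (Fin N) → EuclideanSpace ℝ (Fin N)}
  {r₀ : EuclideanSpace ℝ (Fin N) →₁[volume] ℝ} {ρ : ℝ → (EuclideanSpace ℝ (Fin N) →₁[volume] ℝ)}

/-- The flux `∫ r v(r) w · ∇χ` of the density `r` transported by the velocity `v(r) w`. -/
noncomputable def massFlux (v : ℝ → ℝ) (w : EuclideanSpace ℝ (Fin N) → EuclideanSpace ℝ (Fin N))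
    (χ : EuclideanSpace ℝ (Fin N) → ℝ) (r : EuclideanSpace ℝ (Fin N) →₁[volume] ℝ) : ℝ :=
  ∫ x, r x * v (r x) * inner ℝ (w x) (gradient χ x)

theorem PedestrianTraffic.HypV.mem_Icc (hv : HypV R V v) {s : ℝ} (hs : s ∈ Icc 0 R) :
    v s ∈ Icc 0 V :=
  ⟨hv.at_R ▸ hv.antitone hs.2, hv.at_zero ▸ hv.antitone hs.1⟩

theorem PedestrianTraffic.HypV.abs_mul_le (hv : HypV R V v) {s : ℝ} (hs : s ∈ Icc 0 R) :
    |s * v s| ≤ V * s := by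
  have h := hv.mem_Icc hs
  rw [abs_of_nonneg (mul_nonneg hs.1 h.1), mul_comm]
  exact mul_le_mul_of_nonneg_right h.2 hs.1

theorem continuous_gradient {χ : EuclideanSpace ℝ (Fin N) → ℝ} (hχ : ContDiff ℝ 1 χ) :
    Continuous (gradient χ) :=
  (gradientIsometry N).continuous.comp (hχ.continuous_fderiv one_ne_zero)

theorem hasCompactSupport_gradient {χ : EuclideanSpace ℝ (Fin N) → ℝ} (hχ : HasCompactSupport χ) :
    HasCompactSupport (gradient χ) :=
  (hχ.fderiv ℝ).comp_left (map_zero (gradientIsometry N))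

theorem integrable_massFlux (hv : HypV R V v)
    {w : EuclideanSpace ℝ (Fin N) → EuclideanSpace ℝ (Fin N)} (hw : Continuous w)
    {χ : EuclideanSpace ℝ (Fin N) → ℝ} (hχ : ContDiff ℝ 1 χ) (hχc : HasCompactSupport χ)
    {r : EuclideanSpace ℝ (Fin N) →₁[volume] ℝ} (hr : IsDensity R r) :
    Integrable fun x => r x * v (r x) * inner ℝ (w x) (gradient χ x) := by
  have hc : Continuous fun x => (inner ℝ (w x) (gradient χ x) : ℝ) :=
    hw.inner (continuous_gradient hχ)
  have hcs : HasCompactSupport fun x => (inner ℝ (w x) (gradient χ x) : ℝ) :=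
    (hasCompactSupport_gradient hχc).mono fun x hx => by
      rw [Function.mem_support] at hx ⊢
      contrapose! hx
      rw [hx, inner_zero_right]
  obtain ⟨c, hcb⟩ := hcs.exists_bound_of_continuous hc
  have hrm := (L1.integrable_coeFn r).aestronglyMeasurable
  refine (((L1.integrable_coeFn r).const_mul V).mul_const c).mono'
    ((hrm.mul (hv.contDiff.continuous.comp_aestronglyMeasurable hrm)).mul
      hc.aestronglyMeasurable) ?_
  filter_upwards [hr] with x hx
  rw [norm_mul]
  exact mul_le_mul (hv.abs_mul_le hx) (hcb x) (norm_nonneg _) (mul_nonneg hv.V_pos.le hx.1)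

/-- Two changes add up: `s ↦ s v(s)` is Lipschitz on `[0, R]`, and the nonlocal field is Lipschitz
in the sup norm. It is needed for continuity of the flux in time. -/
theorem exists_massFlux_sub_le (hv : HypV R V v) (hν : Continuous ν)
    (hJc : ∀ r, IsDensity R r → Continuous (J r))
    (hW : ∀ r, IsDensity R r → ∀ x, ‖ν x + J r x‖ ≤ W)
    (hJl : ∃ K, ∀ r₁ r₂, IsDensity R r₁ → IsDensity R r₂ → ∀ x,
      ‖J r₁ x - J r₂ x‖ ≤ K * ‖r₁ - r₂‖)
    {χ : EuclideanSpace ℝ (Fin N) → ℝ} (hχ : ContDiff ℝ 1 χ) (hχc : HasCompactSupport χ) :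
    ∃ K : ℝ, ∀ r₁ r₂, IsDensity R r₁ → IsDensity R r₂ →
      |massFlux v (fun x => ν x + J r₁ x) χ r₁ - massFlux v (fun x => ν x + J r₂ x) χ r₂| ≤
        K * ‖r₁ - r₂‖ := by
  obtain ⟨K, hK⟩ := hJl
  obtain ⟨L, hL, -, -, -, hq, -⟩ := exists_contDiff_bounds_on_closedBall
    (Φ := fun s : ℝ => s * v s) (contDiff_id.mul hv.contDiff) R
  have hgc := continuous_gradient hχ
  obtain ⟨X, hX⟩ := (hasCompactSupport_gradient hχc).exists_bound_of_continuous hgc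
  have hX0 : 0 ≤ X := (norm_nonneg _).trans (hX 0)
  have hgi : Integrable fun x => ‖gradient χ x‖ :=
    (hgc.integrable_of_hasCompactSupport (hasCompactSupport_gradient hχc)).norm
  have hV := hv.V_pos.le
  have hR := hv.R_pos.le
  refine ⟨L * (W * X) + V * R * K * ∫ x, ‖gradient χ x‖, fun r₁ r₂ h₁ h₂ => ?_⟩
  have hi₁ := integrable_massFlux (w := fun x => ν x + J r₁ x) hv (hν.add (hJc r₁ h₁)) hχ hχc h₁
  have hi₂ := integrable_massFlux (w := fun x => ν x + J r₂ x) hv (hν.add (hJc r₂ h₂)) hχ hχc h₂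
  have hnorm : ∫ x, |r₁ x - r₂ x| = ‖r₁ - r₂‖ := by
    rw [L1.norm_eq_integral_norm]
    refine integral_congr_ae ?_
    filter_upwards [Lp.coeFn_sub r₁ r₂] with x hx
    rw [hx]
    rfl
  have hi : Integrable fun x => |r₁ x - r₂ x| :=
    ((L1.integrable_coeFn r₁).sub (L1.integrable_coeFn r₂)).abs
  rw [massFlux, massFlux, ← integral_sub hi₁ hi₂, ← Real.norm_eq_abs]
  refine (norm_integral_le_integral_norm _).trans ?_
  calc _ ≤ ∫ x, (L * (W * X) * |r₁ x - r₂ x| + V * R * K * ‖r₁ - r₂‖ * ‖gradient χ x‖) := by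
        refine integral_mono_ae (hi₁.sub hi₂).norm ((hi.const_mul _).add (hgi.const_mul _)) ?_
        filter_upwards [h₁, h₂] with x hx₁ hx₂
        have e : r₁ x * v (r₁ x) * inner ℝ (ν x + J r₁ x) (gradient χ x) -
            r₂ x * v (r₂ x) * inner ℝ (ν x + J r₂ x) (gradient χ x) =
            (r₁ x * v (r₁ x) - r₂ x * v (r₂ x)) * inner ℝ (ν x + J r₁ x) (gradient χ x) +
            r₂ x * v (r₂ x) * inner ℝ (J r₁ x - J r₂ x) (gradient χ x) := by
          simp only [inner_add_left, inner_sub_left]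
          ring
        rw [e]
        refine (norm_add_le _ _).trans (add_le_add ?_ ?_)
        · rw [norm_mul]
          have hb (s : ℝ) (hs : s ∈ Icc 0 R) : ‖s‖ ≤ R := by
            rw [Real.norm_eq_abs, abs_of_nonneg hs.1]
            exact hs.2
          have h3 := hq (r₁ x) (r₂ x) (hb _ hx₁) (hb _ hx₂)
          have h4 : ‖(inner ℝ (ν x + J r₁ x) (gradient χ x) : ℝ)‖ ≤ W * X :=
            (norm_inner_le_norm _ _).trans
              (mul_le_mul (hW r₁ h₁ x) (hX x) (norm_nonneg _)
                ((norm_nonneg _).trans (hW r₁ h₁ x)))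
          calc _ ≤ L * ‖r₁ x - r₂ x‖ * (W * X) :=
                mul_le_mul h3 h4 (norm_nonneg _) (by positivity)
            _ = _ := by
              rw [Real.norm_eq_abs]
              ring
        · rw [norm_mul]
          have h3 : ‖r₂ x * v (r₂ x)‖ ≤ V * R :=
            (hv.abs_mul_le hx₂).trans (mul_le_mul_of_nonneg_left hx₂.2 hV)
          have h4 : ‖(inner ℝ (J r₁ x - J r₂ x) (gradient χ x) : ℝ)‖ ≤
              K * ‖r₁ - r₂‖ * ‖gradient χ x‖ :=
            (norm_inner_le_norm _ _).trans
              (mul_le_mul_of_nonneg_right (hK r₁ r₂ h₁ h₂ x) (norm_nonneg _))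
          calc _ ≤ V * R * (K * ‖r₁ - r₂‖ * ‖gradient χ x‖) :=
                mul_le_mul h3 h4 (norm_nonneg _) (by positivity)
            _ = _ := by ring
    _ = _ := by
      rw [integral_add (hi.const_mul _) (hgi.const_mul _), integral_const_mul,
        integral_const_mul, hnorm]
      ring

theorem continuousOn_massFlux (hv : HypV R V v) (hν : Continuous ν)
    (hJc : ∀ r, IsDensity R r → Continuous (J r))
    (hW : ∀ r, IsDensity R r → ∀ x, ‖ν x + J r x‖ ≤ W)
    (hJl : ∃ K, ∀ r₁ r₂, IsDensity R r₁ → IsDensity R r₂ → ∀ x,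
      ‖J r₁ x - J r₂ x‖ ≤ K * ‖r₁ - r₂‖)
    {χ : EuclideanSpace ℝ (Fin N) → ℝ} (hχ : ContDiff ℝ 1 χ) (hχc : HasCompactSupport χ)
    {s : Set ℝ} (hρ : ContinuousOn ρ s) (hd : ∀ t ∈ s, IsDensity R (ρ t)) :
    ContinuousOn (fun t => massFlux v (fun x => ν x + J (ρ t) x) χ (ρ t)) s := by
  obtain ⟨K, hK⟩ := exists_massFlux_sub_le hv hν hJc hW hJl hχ hχc
  intro t ht
  rw [ContinuousWithinAt, tendsto_iff_norm_sub_tendsto_zero]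
  have h1 : Tendsto (fun u => K * ‖ρ u - ρ t‖) (𝓝[s] t) (𝓝 0) := by
    have := (tendsto_iff_norm_sub_tendsto_zero.1 (hρ t ht)).const_mul K
    rwa [mul_zero] at this
  refine squeeze_zero' (Eventually.of_forall fun _ => norm_nonneg _) ?_ h1
  filter_upwards [self_mem_nhdsWithin] with u hu using hK _ _ (hd u hu) (hd t ht)

theorem integrable_mul_of_continuous_hasCompactSupport {χ : EuclideanSpace ℝ (Fin N) → ℝ}
    (hχ : Continuous χ) (hχc : HasCompactSupport χ) (r : EuclideanSpace ℝ (Fin N) →₁[volume] ℝ) :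
    Integrable fun x => r x * χ x := by
  obtain ⟨c, hc⟩ := hχc.exists_bound_of_continuous hχ
  exact (L1.integrable_coeFn r).mul_bdd (c := c) hχ.aestronglyMeasurable (Eventually.of_forall hc)

theorem continuousOn_integral_mul {χ : EuclideanSpace ℝ (Fin N) → ℝ}
    (hχ : Continuous χ) (hχc : HasCompactSupport χ) {s : Set ℝ} (hρ : ContinuousOn ρ s) :
    ContinuousOn (fun t => ∫ x, ρ t x * χ x) s := by
  obtain ⟨c, hc⟩ := hχc.exists_bound_of_continuous hχ
  intro t ht
  rw [ContinuousWithinAt, tendsto_iff_norm_sub_tendsto_zero]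
  have h1 : Tendsto (fun u => ‖ρ u - ρ t‖ * c) (𝓝[s] t) (𝓝 0) := by
    have := (tendsto_iff_norm_sub_tendsto_zero.1 (hρ t ht)).mul_const c
    rwa [zero_mul] at this
  refine squeeze_zero (fun _ => norm_nonneg _) (fun u => ?_) h1
  rw [← integral_sub (integrable_mul_of_continuous_hasCompactSupport hχ hχc _)
    (integrable_mul_of_continuous_hasCompactSupport hχ hχc _), L1.norm_eq_integral_norm,
    ← integral_mul_const]
  refine (norm_integral_le_integral_norm _).trans (integral_mono_of_nonneg
    (Eventually.of_forall fun _ => norm_nonneg _)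
    ((L1.integrable_coeFn (ρ u - ρ t)).norm.mul_const c) ?_)
  filter_upwards [Lp.coeFn_sub (ρ u) (ρ t)] with x hx
  rw [hx, Pi.sub_apply, ← sub_mul, norm_mul]
  exact mul_le_mul_of_nonneg_left (hc x) (norm_nonneg _)

/-- The Kružkov inequality with `k = 0` and a product test function; for nonnegative densities the
absolute value and the sign disappear. -/
theorem PedestrianTraffic.IsWeakEntropySolution.nonneg_of_test (hT : 0 ≤ T) (hv : HypV R V v)
    (h : IsWeakEntropySolution R T v ν J r₀ ρ) (hr₀ : IsDensity R r₀)
    (hν : Continuous ν) (hJc : ∀ r, IsDensity R r → Continuous (J r))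
    {χ : EuclideanSpace ℝ (Fin N) → ℝ} (hχ : ContDiff ℝ ∞ χ) (hχc : HasCompactSupport χ)
    (hχ0 : ∀ x, 0 ≤ χ x) {θ : ℝ → ℝ} (hθ : ContDiff ℝ ∞ θ) (hθc : HasCompactSupport θ)
    (hθ0 : ∀ t, 0 ≤ θ t) :
    0 ≤ (∫ t in (0 : ℝ)..T, (deriv θ t * (∫ x, ρ t x * χ x) +
      θ t * massFlux v (fun x => ν x + J (ρ t) x) χ (ρ t))) + θ 0 * ∫ x, r₀ x * χ x := by
  have hχ1 : ContDiff ℝ 1 χ := contDiff_infty.1 hχ 1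
  have key := h.entropy 0 (fun p => θ p.1 * χ p.2)
    ((hθ.comp contDiff_fst).mul (hχ.comp contDiff_snd)) (by
      refine HasCompactSupport.intro (hθc.isCompact.prod hχc.isCompact) fun p hp => ?_
      rw [mem_prod, not_and_or] at hp
      rcases hp with hp | hp
      · rw [image_eq_zero_of_notMem_tsupport hp, zero_mul]
      · rw [image_eq_zero_of_notMem_tsupport hp, mul_zero])
    fun t _ x => mul_nonneg (hθ0 t) (hχ0 x)
  refine key.trans_eq (congrArg₂ _ ?_ ?_)
  · refine intervalIntegral.integral_congr fun t ht => ?_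
    rw [uIcc_of_le hT] at ht
    have hd := h.isDensity t ht
    have hi1 := integrable_mul_of_continuous_hasCompactSupport hχ.continuous hχc (ρ t)
    have hi2 := integrable_massFlux (w := fun x => ν x + J (ρ t) x) hv (hν.add (hJc _ hd))
      hχ1 hχc hd
    simp only [massFlux]
    rw [← integral_const_mul, ← integral_const_mul, ← integral_add (hi1.const_mul _)
      (hi2.const_mul _)]
    refine integral_congr_ae ?_
    filter_upwards [hd] with x hx
    have hgrad : gradient (fun y => θ t * χ y) x = θ t • gradient χ x := by
      rw [gradient_eq_gradientIsometry, gradient_eq_gradientIsometry,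
        fderiv_const_mul (hχ1.differentiable one_ne_zero x), map_smul]
    have hder : deriv (fun s => θ s * χ x) t = deriv θ t * χ x :=
      deriv_mul_const (hθ.differentiable (by simp) t) _
    have hsign : ρ t x * Real.sign (ρ t x) = ρ t x := by
      rcases hx.1.eq_or_lt with h0 | h0
      · rw [← h0, zero_mul]
      · rw [Real.sign_of_pos h0, mul_one]
    simp only [sub_zero, zero_mul, hgrad, hder, abs_of_nonneg hx.1, real_inner_smul_right]
    calc _ = deriv θ t * (ρ t x * χ x) + θ t * ((ρ t x * Real.sign (ρ t x)) * v (ρ t x) *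
          inner ℝ (ν x + J (ρ t) x) (gradient χ x)) := by ring
      _ = _ := by rw [hsign]
  · rw [← integral_const_mul]
    refine integral_congr_ae ?_
    filter_upwards [hr₀] with x hx
    simp only [sub_zero, abs_of_nonneg hx.1]
    ring

/-- If the flux through the weight `χ` is at most `K`, then the weighted mass grows at most at the
rate `K`. -/
theorem PedestrianTraffic.IsWeakEntropySolution.integral_mul_le (hT : 0 < T) (hv : HypV R V v)
    (h : IsWeakEntropySolution R T v ν J r₀ ρ) (hr₀ : IsDensity R r₀)
    (hν : Continuous ν) (hJc : ∀ r, IsDensity R r → Continuous (J r))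
    (hW : ∀ r, IsDensity R r → ∀ x, ‖ν x + J r x‖ ≤ W)
    (hJl : ∃ K, ∀ r₁ r₂, IsDensity R r₁ → IsDensity R r₂ → ∀ x,
      ‖J r₁ x - J r₂ x‖ ≤ K * ‖r₁ - r₂‖)
    {χ : EuclideanSpace ℝ (Fin N) → ℝ} (hχ : ContDiff ℝ 1 χ) (hχc : HasCompactSupport χ)
    (hχ0 : ∀ x, 0 ≤ χ x) {K : ℝ}
    (hK : ∀ t ∈ Icc 0 T, massFlux v (fun x => ν x + J (ρ t) x) χ (ρ t) ≤ K) :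
    ∀ t ∈ Icc 0 T, ∫ x, ρ t x * χ x ≤ (∫ x, r₀ x * χ x) + K * t := by
  intro t ht
  obtain ⟨P, hP⟩ := isCompact_Icc.exists_bound_of_continuousOn h.continuousOn
  have hW0 : 0 ≤ W := (norm_nonneg _).trans (hW r₀ hr₀ 0)
  have hV := hv.V_pos.le
  have hP0 : 0 ≤ P := (norm_nonneg _).trans (hP t ht)
  have hclose (r : EuclideanSpace ℝ (Fin N) →₁[volume] ℝ) {χ' : EuclideanSpace ℝ (Fin N) → ℝ}
      (hχ' : Continuous χ') (hχ'c : HasCompactSupport χ') {δ : ℝ} (hδ : ∀ x, |χ' x - χ x| ≤ δ) :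
      |(∫ x, r x * χ' x) - ∫ x, r x * χ x| ≤ δ * ‖r‖ := by
    rw [← integral_sub (integrable_mul_of_continuous_hasCompactSupport hχ' hχ'c r)
      (integrable_mul_of_continuous_hasCompactSupport hχ.continuous hχc r),
      L1.norm_eq_integral_norm, ← integral_const_mul]
    refine (norm_integral_le_integral_norm _).trans (integral_mono_of_nonneg
      (Eventually.of_forall fun x => norm_nonneg (r x * χ' x - r x * χ x))
      ((L1.integrable_coeFn r).norm.const_mul δ) (Eventually.of_forall fun x => ?_))
    dsimp only
    rw [← mul_sub, norm_mul, mul_comm]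
    exact mul_le_mul_of_nonneg_right (hδ x) (norm_nonneg _)
  -- Errors from replacing `χ` by a smooth weight `δ`-close to it in `C¹`: `δ P` and `δ ‖r₀‖` in the
  -- masses, `V P W δ` in the flux.
  suffices hs : ∀ δ > 0, ∫ x, ρ t x * χ x ≤
      (∫ x, r₀ x * χ x) + K * t + δ * (P + ‖r₀‖ + V * P * W * t) by
    have hlim : Tendsto (fun δ : ℝ => (∫ x, r₀ x * χ x) + K * t + δ * (P + ‖r₀‖ + V * P * W * t))
        (𝓝[>] 0) (𝓝 ((∫ x, r₀ x * χ x) + K * t)) := by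
      have : Continuous fun δ : ℝ =>
          (∫ x, r₀ x * χ x) + K * t + δ * (P + ‖r₀‖ + V * P * W * t) := by fun_prop
      have := this.tendsto 0
      rw [zero_mul, add_zero] at this
      exact this.mono_left nhdsWithin_le_nhds
    refine ge_of_tendsto hlim ?_
    filter_upwards [self_mem_nhdsWithin] with δ hδ using hs δ hδ
  intro δ hδ
  obtain ⟨χ', hχ', hχ'c, hχ'0, hχχ', hgrad⟩ :=
    exists_contDiff_approx_of_hasCompactSupport hχ hχc hχ0 hδ
  have hχ'1 : ContDiff ℝ 1 χ' := contDiff_infty.1 hχ' 1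
  have hflux : ∀ s ∈ Icc 0 T, massFlux v (fun x => ν x + J (ρ s) x) χ' (ρ s) ≤
      K + V * P * W * δ := by
    intro s hs
    have hd := h.isDensity s hs
    have hw : Continuous fun x => ν x + J (ρ s) x := hν.add (hJc _ hd)
    have hi' := integrable_massFlux hv hw hχ'1 hχ'c hd
    have hi := integrable_massFlux hv hw hχ hχc hd
    have hdiff : massFlux v (fun x => ν x + J (ρ s) x) χ' (ρ s) -
        massFlux v (fun x => ν x + J (ρ s) x) χ (ρ s) ≤ V * (W * δ) * ‖ρ s‖ := by
      rw [massFlux, massFlux, ← integral_sub hi' hi, L1.norm_eq_integral_norm,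
        ← integral_const_mul]
      refine integral_mono_ae (hi'.sub hi) ((L1.integrable_coeFn (ρ s)).norm.const_mul _) ?_
      filter_upwards [hd] with x hx
      rw [← mul_sub, ← inner_sub_right]
      refine (le_abs_self _).trans ?_
      rw [abs_mul, Real.norm_eq_abs, abs_of_nonneg hx.1]
      have h4 : |(inner ℝ (ν x + J (ρ s) x) (gradient χ' x - gradient χ x) : ℝ)| ≤ W * δ :=
        (abs_real_inner_le_norm _ _).trans
          (mul_le_mul (hW _ hd x) (hgrad x) (norm_nonneg _) hW0)
      calc _ ≤ V * ρ s x * (W * δ) := mul_le_mul (hv.abs_mul_le hx) h4 (abs_nonneg _)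
            (mul_nonneg hV hx.1)
        _ = _ := by ring
    have h5 : V * (W * δ) * ‖ρ s‖ ≤ V * (W * δ) * P :=
      mul_le_mul_of_nonneg_left (hP s hs) (by positivity)
    have := hK s hs
    linarith
  have hmain := le_add_mul_of_forall_test
    (continuousOn_integral_mul hχ'.continuous hχ'c h.continuousOn)
    (continuousOn_massFlux hv hν hJc hW hJl hχ'1 hχ'c h.continuousOn h.isDensity) hflux
    (fun θ hθ hθc hθ0 => h.nonneg_of_test hT.le hv hr₀ hν hJc hχ' hχ'c hχ'0 hθ hθc hθ0) hT t ht
  have h1 := (abs_le.1 (hclose (ρ t) hχ'.continuous hχ'c hχχ')).1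
  have h2 := (abs_le.1 (hclose r₀ hχ'.continuous hχ'c hχχ')).2
  have h3 := mul_le_mul_of_nonneg_left (hP t ht) hδ.le
  have h4 : (K + V * P * W * δ) * t = K * t + δ * (V * P * W * t) := by ring
  linarith

end WeakFormulation

/-! ### Cutoffs along the wall and at infinity -/

section Cutoff

variable {N : ℕ} {Ω U : Set (EuclideanSpace ℝ (Fin N))} {D : EuclideanSpace ℝ (Fin N) → ℝ}
  {r h : ℝ}

/-- A smooth decreasing function, equal to `1` on `(-∞, 1/3]` and to `0` on `[2/3, ∞)`. -/
noncomputable def smoothStep (u : ℝ) : ℝ := 1 - Real.smoothTransition (3 * u - 1)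

theorem contDiff_smoothStep : ContDiff ℝ ∞ smoothStep :=
  contDiff_const.sub (Real.smoothTransition.contDiff.comp (by fun_prop))

theorem smoothStep_eq_one {u : ℝ} (hu : u ≤ 1 / 3) : smoothStep u = 1 := by
  rw [smoothStep, Real.smoothTransition.zero_of_nonpos (by linarith), sub_zero]

theorem smoothStep_eq_zero {u : ℝ} (hu : 2 / 3 ≤ u) : smoothStep u = 0 := by
  rw [smoothStep, Real.smoothTransition.one_of_one_le (by linarith), sub_self]

theorem smoothStep_mem_Icc (u : ℝ) : smoothStep u ∈ Icc (0 : ℝ) 1 :=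
  ⟨sub_nonneg.2 (Real.smoothTransition.le_one _),
    sub_le_self _ (Real.smoothTransition.nonneg _)⟩

theorem deriv_smoothStep_nonpos (u : ℝ) : deriv smoothStep u ≤ 0 := by
  have : Antitone smoothStep := fun a b hab =>
    sub_le_sub_left (Real.smoothTransition.monotone (by linarith)) 1
  exact this.deriv_nonpos

theorem exists_neg_deriv_smoothStep_le :
    ∃ S, 0 ≤ S ∧ ∀ u ∈ Icc (0 : ℝ) 1, -deriv smoothStep u ≤ S := by
  obtain ⟨S, hS⟩ := isCompact_Icc.exists_bound_of_continuousOn (s := Icc (0 : ℝ) 1)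
    (contDiff_smoothStep.continuous_deriv (by simp)).continuousOn
  exact ⟨S, (norm_nonneg _).trans (hS 0 (by simp)), fun u hu => (neg_le_abs _).trans (hS u hu)⟩

/-- The function equal to `1` outside `Ω` and to `0` at distance at least `h` inside `Ω`. -/
noncomputable def wallCutoff (Ω : Set (EuclideanSpace ℝ (Fin N))) (h : ℝ)
    (x : EuclideanSpace ℝ (Fin N)) : ℝ :=
  smoothStep (Metric.infDist x Ωᶜ / h)

theorem wallCutoff_eventuallyEq_one (hh : 0 < h) {x : EuclideanSpace ℝ (Fin N)}
    (hx : Metric.infDist x Ωᶜ < h / 3) : wallCutoff Ω h =ᶠ[𝓝 x] fun _ => 1 := by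
  have hc : Continuous fun y : EuclideanSpace ℝ (Fin N) => Metric.infDist y Ωᶜ :=
    Metric.continuous_infDist_pt _
  filter_upwards [hc.continuousAt.eventually (gt_mem_nhds hx)] with y hy
  exact smoothStep_eq_one (by rw [div_le_iff₀ hh]; linarith)

theorem wallCutoff_eventuallyEq_zero (hh : 0 < h) {x : EuclideanSpace ℝ (Fin N)}
    (hx : 2 * h / 3 < Metric.infDist x Ωᶜ) : wallCutoff Ω h =ᶠ[𝓝 x] fun _ => 0 := by
  have hc : Continuous fun y : EuclideanSpace ℝ (Fin N) => Metric.infDist y Ωᶜ :=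
    Metric.continuous_infDist_pt _
  filter_upwards [hc.continuousAt.eventually (lt_mem_nhds hx)] with y hy
  exact smoothStep_eq_zero (by rw [le_div_iff₀ hh]; linarith)

/-- The plateaus of the step hide the places where the distance is not known to be smooth: the
boundary and the exterior, and depths beyond the strip. -/
theorem contDiff_wallCutoff (hs : IsRegularStrip r Ω U D) (hh : 0 < h) (hr : h < r) :
    ContDiff ℝ 1 (wallCutoff Ω h) := by
  rw [contDiff_iff_contDiffAt]
  intro x
  by_cases h1 : Metric.infDist x Ωᶜ < h / 3
  · exact contDiffAt_const.congr_of_eventuallyEq (wallCutoff_eventuallyEq_one hh h1)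
  by_cases h2 : 2 * h / 3 < Metric.infDist x Ωᶜ
  · exact contDiffAt_const.congr_of_eventuallyEq (wallCutoff_eventuallyEq_zero hh h2)
  have he := hs.contDiffAt_infDist (x := x) (by linarith) (by linarith)
  exact (contDiff_infty.1 contDiff_smoothStep 1).contDiffAt.comp x (he.div_const h)

theorem gradient_wallCutoff (hs : IsRegularStrip r Ω U D) {p n : EuclideanSpace ℝ (Fin N)}
    {d : ℝ} (hp : IsNearestPoint Ω p n d) (hd : d < r) :
    gradient (wallCutoff Ω h) (p + d • n) = (deriv smoothStep (d / h) / h) • n := by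
  have he := (hs.contDiffAt_infDist (x := p + d • n) (hp.infDist_eq.symm ▸ hp.pos)
    (hp.infDist_eq.symm ▸ hd)).differentiableAt one_ne_zero
  have hg := hp.gradient_infDist_segment hp.pos le_rfl he
  have h1 : HasDerivAt (fun u => smoothStep (u / h)) (deriv smoothStep (d / h) / h)
      (Metric.infDist (p + d • n) Ωᶜ) := by
    rw [hp.infDist_eq]
    have h2 := (contDiff_smoothStep.differentiable (by simp) (d / h)).hasDerivAt
    have h3 : HasDerivAt (fun u : ℝ => u / h) (1 / h) d := (hasDerivAt_id' d).div_const h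
    have := h2.comp d h3
    rwa [mul_one_div] at this
  have h4 := h1.comp_hasFDerivAt (p + d • n) he.hasFDerivAt
  have h5 : fderiv ℝ (wallCutoff Ω h) (p + d • n) = (deriv smoothStep (d / h) / h) •
      fderiv ℝ (fun y => Metric.infDist y Ωᶜ) (p + d • n) := h4.fderiv
  rw [gradient_eq_gradientIsometry] at hg ⊢
  rw [h5, map_smul, hg]

/-- The flux of an inward velocity through the wall cutoff is bounded, uniformly in the width. -/
theorem inner_gradient_wallCutoff_le (hs : IsRegularStrip r Ω U D) (hne : Ωᶜ.Nonempty)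
    (hh : 0 < h) (hr : h < r) {S Λ M : ℝ} (hS0 : 0 ≤ S)
    (hS : ∀ u ∈ Icc (0 : ℝ) 1, -deriv smoothStep u ≤ S)
    {w : EuclideanSpace ℝ (Fin N) → EuclideanSpace ℝ (Fin N)} (hΛ : 0 ≤ Λ)
    (hw : ∀ x ∈ Metric.closedBall 0 (M + r), ∀ y ∈ Metric.closedBall 0 (M + r),
      ‖w x - w y‖ ≤ Λ * ‖x - y‖)
    (hin : ∀ p n d, IsNearestPoint Ω p n d → 0 ≤ inner ℝ (w p) n)
    {x : EuclideanSpace ℝ (Fin N)} (hx : x ∈ Metric.closedBall 0 M) :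
    inner ℝ (w x) (gradient (wallCutoff Ω h) x) ≤
      {y | 0 < Metric.infDist y Ωᶜ ∧ Metric.infDist y Ωᶜ < h}.indicator (fun _ => S * Λ) x := by
  by_cases h1 : 0 < Metric.infDist x Ωᶜ
  swap
  · rw [indicator_of_notMem fun hc => h1 hc.1, gradient_eq_gradientIsometry,
      (wallCutoff_eventuallyEq_one hh (by linarith)).fderiv_eq]
    simp
  by_cases h2 : Metric.infDist x Ωᶜ < h
  swap
  · rw [indicator_of_notMem fun hc => h2 hc.2, gradient_eq_gradientIsometry,
      (wallCutoff_eventuallyEq_zero hh (by linarith)).fderiv_eq]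
    simp
  rw [indicator_of_mem (show x ∈ {y | 0 < Metric.infDist y Ωᶜ ∧ Metric.infDist y Ωᶜ < h} from
    ⟨h1, h2⟩)]
  obtain ⟨p, n, hp, hxp⟩ := exists_isNearestPoint hne h1
  set d := Metric.infDist x Ωᶜ
  have hg : gradient (wallCutoff Ω h) x = (deriv smoothStep (d / h) / h) • n := by
    have := gradient_wallCutoff (h := h) hs hp (h2.trans hr)
    rwa [← hxp] at this
  have hxpn : ‖x - p‖ = d := by
    rw [hxp, add_sub_cancel_left, norm_smul, hp.norm_eq_one, mul_one, Real.norm_eq_abs,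
      abs_of_pos h1]
  have hxM : ‖x‖ ≤ M := by simpa using hx
  -- The nearest boundary point may leave the ball of radius `M`, but by less than `r`.
  have hpM : ‖p‖ ≤ M + r := by
    have : ‖p‖ ≤ ‖x‖ + ‖x - p‖ := by
      simpa using norm_sub_le x (x - p)
    linarith
  have hlip := hw x (by rw [mem_closedBall_zero_iff]; linarith [hs.pos]) p (by simpa using hpM)
  -- The velocity points inwards at `p`, so at `x` it can point outwards by at most `Λ` times the
  -- distance `d` to `p`.
  have hwn : -inner ℝ (w x) n ≤ Λ * d := by
    have e : inner ℝ (w x) n = inner ℝ (w x - w p) n + inner ℝ (w p) n := by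
      rw [inner_sub_left]; ring
    have h3 := (abs_le.1 (abs_real_inner_le_norm (w x - w p) n)).1
    rw [hp.norm_eq_one, mul_one] at h3
    rw [hxpn] at hlip
    have := hin p n d hp
    linarith
  have hdS : -deriv smoothStep (d / h) ≤ S :=
    hS _ ⟨div_nonneg h1.le hh.le, (div_le_one hh).2 h2.le⟩
  have hd0 : 0 ≤ -deriv smoothStep (d / h) / h :=
    div_nonneg (neg_nonneg.2 (deriv_smoothStep_nonpos _)) hh.le
  rw [hg, real_inner_smul_right]
  calc deriv smoothStep (d / h) / h * inner ℝ (w x) n =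
        -deriv smoothStep (d / h) / h * -inner ℝ (w x) n := by ring
    _ ≤ -deriv smoothStep (d / h) / h * (Λ * d) := mul_le_mul_of_nonneg_left hwn hd0
    -- The `1 / h` of the gradient meets the `d` of the velocity, and `d ≤ h`.
    _ = -deriv smoothStep (d / h) * Λ * (d / h) := by ring
    _ ≤ S * Λ * 1 := by
      refine mul_le_mul (mul_le_mul_of_nonneg_right hdS hΛ) ((div_le_one hh).2 h2.le)
        (div_nonneg h1.le hh.le) (by positivity)
    _ = S * Λ := mul_one _

/-- Dilations of one fixed bump, so that the gradient decays like `1 / M` with `c` independent of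
`M`. -/
theorem exists_radial_cutoff (N : ℕ) : ∃ c : ℝ, 0 ≤ c ∧ ∀ M : ℝ, 0 < M →
    ∃ ζ : EuclideanSpace ℝ (Fin N) → ℝ, ContDiff ℝ 1 ζ ∧ HasCompactSupport ζ ∧
      (∀ x, ζ x ∈ Icc (0 : ℝ) 1) ∧ (∀ x ∈ Metric.closedBall 0 M, ζ x = 1) ∧
      (∀ x ∉ Metric.closedBall 0 (2 * M), ζ x = 0) ∧ ∀ x, ‖gradient ζ x‖ ≤ c / M := by
  let f : ContDiffBump (0 : EuclideanSpace ℝ (Fin N)) := ⟨1, 2, one_pos, one_lt_two⟩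
  have hf : ContDiff ℝ 1 f := f.contDiff
  obtain ⟨c, hc⟩ := (f.hasCompactSupport.fderiv ℝ).exists_bound_of_continuous
    (hf.continuous_fderiv one_ne_zero)
  refine ⟨c, (norm_nonneg _).trans (hc 0), fun M hM => ?_⟩
  have hnorm (x : EuclideanSpace ℝ (Fin N)) : ‖M⁻¹ • x‖ = ‖x‖ / M := by
    rw [norm_smul, norm_inv, Real.norm_eq_abs, abs_of_pos hM, inv_mul_eq_div]
  have hzero : ∀ x ∉ Metric.closedBall (0 : EuclideanSpace ℝ (Fin N)) (2 * M),
      f (M⁻¹ • x) = 0 := fun x hx => by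
    rw [mem_closedBall_zero_iff, not_le] at hx
    refine f.zero_of_le_dist ?_
    rw [dist_zero_right, hnorm, le_div_iff₀ hM]
    exact hx.le
  refine ⟨fun x => f (M⁻¹ • x), hf.comp (contDiff_const_smul _), ?_, fun x => ⟨f.nonneg, f.le_one⟩,
    fun x hx => ?_, hzero, fun x => ?_⟩
  · exact HasCompactSupport.intro (isCompact_closedBall 0 (2 * M)) hzero
  · refine f.one_of_mem_closedBall ?_
    rw [mem_closedBall_zero_iff] at hx ⊢
    rw [hnorm, div_le_iff₀ hM]
    simpa [f] using hx
  · rw [gradient_eq_gradientIsometry, LinearIsometry.norm_map]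
    have h1 := ((hf.differentiable one_ne_zero (M⁻¹ • x)).hasFDerivAt).comp x
      ((hasFDerivAt_id x).const_smul M⁻¹)
    have h2 : fderiv ℝ (fun x => f (M⁻¹ • x)) x = M⁻¹ • fderiv ℝ f (M⁻¹ • x) := by
      refine h1.fderiv.trans ?_
      ext u
      simp
    rw [h2, norm_smul, norm_inv, Real.norm_eq_abs, abs_of_pos hM, inv_mul_eq_div]
    gcongr
    exact hc _

/-- The inner strip of width `h` in the ball of radius `M`. -/
def innerStrip (Ω : Set (EuclideanSpace ℝ (Fin N))) (M h : ℝ) : Set (EuclideanSpace ℝ (Fin N)) :=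
  {x | 0 < Metric.infDist x Ωᶜ ∧ Metric.infDist x Ωᶜ < h} ∩ Metric.closedBall 0 M

theorem measurableSet_innerStrip (M h : ℝ) : MeasurableSet (innerStrip Ω M h) := by
  have hc : Continuous fun y : EuclideanSpace ℝ (Fin N) => Metric.infDist y Ωᶜ :=
    Metric.continuous_infDist_pt _
  exact ((isOpen_lt continuous_const hc).inter (isOpen_lt hc continuous_const)).measurableSet.inter
    measurableSet_closedBall

theorem volume_innerStrip_lt_top (M h : ℝ) : volume (innerStrip Ω M h) < ⊤ :=
  (measure_mono inter_subset_right).trans_lt measure_closedBall_lt_top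

/-- Strips of finite volume that decrease to the empty set, because boundary points are excluded
from them. -/
theorem exists_volume_innerStrip_lt (M : ℝ) (hr : 0 < r) {δ : ℝ} (hδ : 0 < δ) :
    ∃ h, 0 < h ∧ h < r ∧ volume.real (innerStrip Ω M h) < δ := by
  have hpos (n : ℕ) : 0 < r / ((n : ℝ) + 2) := by positivity
  have hlim := tendsto_measure_iInter_atTop (μ := volume)
    (s := fun n : ℕ => innerStrip Ω M (r / ((n : ℝ) + 2)))
    (fun n => (measurableSet_innerStrip M _).nullMeasurableSet)
    (fun m n hmn x hx => ⟨⟨hx.1.1, hx.1.2.trans_le (by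
      have : (m : ℝ) ≤ n := Nat.cast_le.2 hmn
      gcongr)⟩, hx.2⟩)
    ⟨0, (volume_innerStrip_lt_top M _).ne⟩
  have hempty : ⋂ n : ℕ, innerStrip Ω M (r / ((n : ℝ) + 2)) = ∅ := by
    refine eq_empty_of_forall_notMem fun x hx => ?_
    rw [mem_iInter] at hx
    have h0 := (hx 0).1.1
    obtain ⟨n, hn⟩ := exists_nat_gt (r / Metric.infDist x Ωᶜ)
    have h1 := (hx n).1.2
    rw [lt_div_iff₀ (by positivity)] at h1
    rw [div_lt_iff₀ h0] at hn
    linarith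
  rw [hempty, measure_empty] at hlim
  obtain ⟨n, hn⟩ := (hlim.eventually (gt_mem_nhds (ENNReal.ofReal_pos.2 hδ))).exists
  refine ⟨r / ((n : ℝ) + 2), hpos n, ?_, ?_⟩
  · refine div_lt_self hr ?_
    have : (0 : ℝ) ≤ n := Nat.cast_nonneg n
    linarith
  · exact ENNReal.toReal_lt_of_lt_ofReal hn

end Cutoff

/-! ### The essential support -/

section Support

variable {N : ℕ} {Ω : Set (EuclideanSpace ℝ (Fin N))}

/-- Locally null sets are null, so vanishing near each point of the open complement is vanishing
almost everywhere on it. -/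
theorem spt_subset_iff (hΩ : IsClosed Ω) (r : EuclideanSpace ℝ (Fin N) →₁[volume] ℝ) :
    spt r ⊆ Ω ↔ ∀ᵐ x, x ∉ Ω → r x = 0 := by
  constructor
  · intro h
    have h1 : volume {x | x ∉ Ω ∧ r x ≠ 0} = 0 := by
      refine measure_null_of_locally_null _ fun x hx => ?_
      have hxs : x ∉ spt r := fun hc => hx.1 (h hc)
      simp only [spt, mem_ofPred_eq, not_forall, not_not] at hxs
      obtain ⟨A, hA, hA0⟩ := hxs
      obtain ⟨A', hA'A, hA'o, hxA'⟩ := mem_nhds_iff.1 hA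
      refine ⟨{x | r x ≠ 0} ∩ A', ?_, ?_⟩
      · rw [inter_comm]
        refine mem_nhdsWithin.2 ⟨A', hA'o, hxA', fun y hy => ⟨hy.1, hy.2.2⟩⟩
      · have := ae_restrict_of_ae_restrict_of_subset hA'A hA0
        rw [ae_restrict_iff' hA'o.measurableSet] at this
        refine measure_mono_null (fun y hy => ?_) this
        simp only [mem_compl_iff, mem_ofPred_eq, Classical.not_imp]
        exact ⟨hy.2, hy.1⟩
    refine measure_mono_null (fun y hy => ?_) h1
    simpa [Classical.not_imp] using hy
  · intro h x hx
    by_contra hxΩ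
    refine hx Ωᶜ (hΩ.isOpen_compl.mem_nhds hxΩ) ?_
    rw [ae_restrict_iff' hΩ.measurableSet.compl]
    exact h

end Support

/-! ### Invariance of the domain -/

section Invariance

variable {N : ℕ} {Ω U : Set (EuclideanSpace ℝ (Fin N))} {D : EuclideanSpace ℝ (Fin N) → ℝ}
  {R V B rΩ : ℝ} {v : ℝ → ℝ} {ν : EuclideanSpace ℝ (Fin N) → EuclideanSpace ℝ (Fin N)}
  {J : (EuclideanSpace ℝ (Fin N) →₁[volume] ℝ) →
    EuclideanSpace ℝ (Fin N) → EuclideanSpace ℝ (Fin N)}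

theorem PedestrianTraffic.HypI.exists_norm_sub_le (hI : HypI R J) :
    ∃ K, ∀ r₁ r₂, IsDensity R r₁ → IsDensity R r₂ → ∀ x,
      ‖J r₁ x - J r₂ x‖ ≤ K * ‖r₁ - r₂‖ := by
  obtain ⟨K, hK⟩ := hI.I3
  refine ⟨max K 0, fun r₁ r₂ h₁ h₂ x => ?_⟩
  have hc : Continuous fun x => J r₁ x - J r₂ x :=
    (hI.contDiff r₁ h₁).continuous.sub (hI.contDiff r₂ h₂).continuous
  have hle := (hK r₁ r₂ h₁ h₂).1
  have hm : MemLp (fun x => J r₁ x - J r₂ x) ∞ volume :=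
    ⟨hc.aestronglyMeasurable, hle.trans_lt ENNReal.ofReal_lt_top⟩
  refine (norm_le_of_memLp_top hc hm x).trans ?_
  refine ENNReal.toReal_le_of_le_ofReal (by positivity) (hle.trans (ENNReal.ofReal_le_ofReal ?_))
  gcongr
  exact le_max_left _ _

theorem PedestrianTraffic.HypI.exists_norm_fderiv_le (hI : HypI R J) (P : ℝ) :
    ∃ L, 0 ≤ L ∧ ∀ r, IsDensity R r → ‖r‖ ≤ P → ∀ x, ‖fderiv ℝ (J r) x‖ ≤ L := by
  obtain ⟨C, hmono, hC0, hC⟩ := hI.I1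
  refine ⟨C (max P 0), hC0 _ (le_max_right _ _), fun r hr hP x => ?_⟩
  have hc : Continuous (fderiv ℝ (J r)) := (hI.contDiff r hr).continuous_fderiv (by norm_num)
  have hle : eLpNorm (fderiv ℝ (J r)) ∞ volume ≤ ENNReal.ofReal (C (max P 0)) := by
    refine (le_max_right _ _).trans ((hC r hr).1.trans (ENNReal.ofReal_le_ofReal ?_))
    exact hmono (norm_nonneg r) (mem_Ici.2 (le_max_right P 0)) (hP.trans (le_max_left _ _))
  have hm : MemLp (fderiv ℝ (J r)) ∞ volume :=
    ⟨hc.aestronglyMeasurable, hle.trans_lt ENNReal.ofReal_lt_top⟩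
  exact (norm_le_of_memLp_top hc hm x).trans
    (ENNReal.toReal_le_of_le_ofReal (hC0 _ (le_max_right _ _)) hle)

/-- If the velocity points inwards along the walls, then `Ω` is invariant. -/
theorem invariant_of_inner_nonneg (hv : HypV R V v) (hs : IsRegularStrip rΩ Ω U D)
    (hν : ContDiff ℝ 1 ν) (hνb : MemLp ν ∞ volume) (hI : HypI R J)
    (hJb : ∀ r x, ‖J r x‖ ≤ B)
    (hin : ∀ r, IsDensity R r → ∀ p n d, IsNearestPoint Ω p n d → 0 ≤ inner ℝ (ν p + J r p) n) :
    Invariant R v ν J Ω := by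
  intro T hT r₀ hr₀ ρ hρ hspt t ht
  rw [spt_subset_iff hs.isClosed] at hspt ⊢
  rcases Ωᶜ.eq_empty_or_nonempty with hempty | hne
  · rw [compl_empty_iff] at hempty
    simp [hempty]
  have hW (r) (_ : IsDensity R r) (x) : ‖ν x + J r x‖ ≤ (eLpNorm ν ∞ volume).toReal + B :=
    (norm_add_le _ _).trans (add_le_add (norm_le_of_memLp_top hν.continuous hνb x) (hJb r x))
  set W := (eLpNorm ν ∞ volume).toReal + B
  have hW0 : 0 ≤ W := (norm_nonneg _).trans (hW r₀ hr₀ 0)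
  have hJc (r) (hr : IsDensity R r) : Continuous (J r) := (hI.contDiff r hr).continuous
  obtain ⟨P, hP⟩ := isCompact_Icc.exists_bound_of_continuousOn hρ.continuousOn
  have hP0 : 0 ≤ P := (norm_nonneg _).trans (hP t ht)
  -- The norms of `ρ` are bounded on `[0, T]`, hence the nonlocal fields have a Lipschitz constant
  -- independent of time.
  obtain ⟨L, hL0, hL⟩ := hI.exists_norm_fderiv_le P
  obtain ⟨S, hS0, hS⟩ := exists_neg_deriv_smoothStep_le
  obtain ⟨c, hc0, hζ⟩ := exists_radial_cutoff N
  have hV := hv.V_pos.le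
  have hR := hv.R_pos.le
  have hdens := hρ.isDensity t ht
  have hρi := L1.integrable_coeFn (ρ t)
  have hmeas (M : ℝ) : MeasurableSet (Ωᶜ ∩ Metric.closedBall 0 M) :=
    hs.isClosed.measurableSet.compl.inter measurableSet_closedBall
  -- The mass outside `Ω` in a large ball is bounded by the flux at infinity.
  have hmain : ∀ M > 0, ∫ x in Ωᶜ ∩ Metric.closedBall 0 M, ρ t x ≤ V * P * W * c * T / M := by
    intro M hM
    obtain ⟨ζ, hζ1, hζc, hζI, hζ_one, hζ_zero, hζg⟩ := hζ M hM
    obtain ⟨Λ₀, hΛ₀⟩ := (isCompact_closedBall (0 : EuclideanSpace ℝ (Fin N))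
      (2 * M + rΩ)).exists_bound_of_continuousOn (hν.continuous_fderiv one_ne_zero).continuousOn
    have hΛ₀0 : 0 ≤ Λ₀ := (norm_nonneg _).trans (hΛ₀ 0 (by
      have := hs.pos
      simp
      linarith))
    have hlip (s) (hs : s ∈ Icc 0 T) : ∀ x ∈ Metric.closedBall 0 (2 * M + rΩ),
        ∀ y ∈ Metric.closedBall 0 (2 * M + rΩ),
        ‖(ν x + J (ρ s) x) - (ν y + J (ρ s) y)‖ ≤ (Λ₀ + L) * ‖x - y‖ := fun x hx y hy => by
      have hd := hρ.isDensity s hs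
      have hJd : Differentiable ℝ (J (ρ s)) := (hI.contDiff _ hd).differentiable (by norm_num)
      have hνd : Differentiable ℝ ν := hν.differentiable one_ne_zero
      refine (convex_closedBall (0 : EuclideanSpace ℝ (Fin N))
        (2 * M + rΩ)).norm_image_sub_le_of_norm_fderiv_le (f := fun x => ν x + J (ρ s) x)
        (fun z _ => (hνd z).add (hJd z)) (fun z hz => ?_) hy hx
      rw [fderiv_fun_add (hνd z) (hJd z)]
      exact (norm_add_le _ _).trans (add_le_add (hΛ₀ z hz) (hL _ hd (hP s hs) z))
    set A := fun h => volume.real (innerStrip Ω (2 * M) h)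
    -- The strip accounts for the initial mass and for the flux through the wall; the remaining term
    -- is the flux through the radial cutoff and does not depend on `h`.
    have hstep : ∀ h, 0 < h → h < rΩ → ∫ x in Ωᶜ ∩ Metric.closedBall 0 M, ρ t x ≤
        (R + R * V * (S * (Λ₀ + L)) * T) * A h + V * P * W * c * T / M := by
      intro h hh hhr
      set χ : EuclideanSpace ℝ (Fin N) → ℝ := fun x => wallCutoff Ω h x * ζ x
      have hw1 := contDiff_wallCutoff hs hh hhr
      have hχ : ContDiff ℝ 1 χ := hw1.mul hζ1
      have hχc : HasCompactSupport χ := hζc.mul_left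
      have hwI (x) : wallCutoff Ω h x ∈ Icc (0 : ℝ) 1 := smoothStep_mem_Icc _
      have hχ0 (x) : 0 ≤ χ x := mul_nonneg (hwI x).1 (hζI x).1
      have hgrad (x) : gradient χ x =
          wallCutoff Ω h x • gradient ζ x + ζ x • gradient (wallCutoff Ω h) x := by
        simp only [gradient_eq_gradientIsometry]
        rw [fderiv_fun_mul (hw1.differentiable one_ne_zero x) (hζ1.differentiable one_ne_zero x),
          map_add, map_smul, map_smul]
      have hAi : Integrable ((innerStrip Ω (2 * M) h).indicator fun _ => (1 : ℝ)) :=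
        (integrable_indicator_iff (measurableSet_innerStrip _ _)).2
          (integrableOn_const (volume_innerStrip_lt_top _ _).ne)
      have hA1 : ∫ x, (innerStrip Ω (2 * M) h).indicator (fun _ => (1 : ℝ)) x = A h := by
        rw [integral_indicator (measurableSet_innerStrip _ _), setIntegral_const, smul_eq_mul,
          mul_one]
      have hflux : ∀ s ∈ Icc 0 T, massFlux v (fun x => ν x + J (ρ s) x) χ (ρ s) ≤
          R * V * (S * (Λ₀ + L)) * A h + V * W * (c / M) * P := by
        intro s hsT
        have hd := hρ.isDensity s hsT
        have hi := integrable_massFlux (w := fun x => ν x + J (ρ s) x) hv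
          (hν.continuous.add (hJc _ hd)) hχ hχc hd
        have hn : ∫ x, ‖ρ s x‖ ≤ P := by
          rw [← L1.norm_eq_integral_norm]
          exact hP s hsT
        calc massFlux v (fun x => ν x + J (ρ s) x) χ (ρ s) ≤
            ∫ x, (R * V * (S * (Λ₀ + L)) * (innerStrip Ω (2 * M) h).indicator (fun _ => (1 : ℝ)) x
              + V * W * (c / M) * ‖ρ s x‖) := by
              refine integral_mono_ae hi ((hAi.const_mul _).add
                ((L1.integrable_coeFn (ρ s)).norm.const_mul _)) ?_
              filter_upwards [hd] with x hx
              have hq0 : 0 ≤ ρ s x * v (ρ s x) := mul_nonneg hx.1 (hv.mem_Icc hx).1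
              have hq1 : ρ s x * v (ρ s x) ≤ V * ρ s x := (le_abs_self _).trans (hv.abs_mul_le hx)
              have hq2 : ρ s x * v (ρ s x) ≤ R * V := by
                refine hq1.trans ?_
                rw [mul_comm]
                exact mul_le_mul_of_nonneg_right hx.2 hV
              have h1 : inner ℝ (ν x + J (ρ s) x) (wallCutoff Ω h x • gradient ζ x) ≤
                  W * (c / M) := by
                rw [real_inner_smul_right]
                calc _ ≤ 1 * (W * (c / M)) := by
                      refine mul_le_mul_of_nonneg (hwI x).2 ?_ (hwI x).1 (by positivity)
                      exact (real_inner_le_norm _ _).trans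
                        (mul_le_mul (hW _ hd x) (hζg x) (norm_nonneg _) hW0)
                  _ = _ := one_mul _
              have h2 : inner ℝ (ν x + J (ρ s) x) (ζ x • gradient (wallCutoff Ω h) x) ≤
                  S * (Λ₀ + L) * (innerStrip Ω (2 * M) h).indicator (fun _ => (1 : ℝ)) x := by
                have hind : 0 ≤ (innerStrip Ω (2 * M) h).indicator (fun _ => (1 : ℝ)) x :=
                  indicator_nonneg (fun _ _ => zero_le_one) x
                by_cases hxM : x ∈ Metric.closedBall 0 (2 * M)
                · have h3 := inner_gradient_wallCutoff_le hs hne hh hhr hS0 hS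
                    (add_nonneg hΛ₀0 hL0) (hlip s hsT) (hin _ hd) hxM
                  have h4 : {y | 0 < Metric.infDist y Ωᶜ ∧ Metric.infDist y Ωᶜ < h}.indicator
                      (fun _ => S * (Λ₀ + L)) x = S * (Λ₀ + L) *
                      (innerStrip Ω (2 * M) h).indicator (fun _ => (1 : ℝ)) x := by
                    by_cases hxs : x ∈ {y | 0 < Metric.infDist y Ωᶜ ∧ Metric.infDist y Ωᶜ < h}
                    · rw [indicator_of_mem hxs, indicator_of_mem (show x ∈ innerStrip Ω (2 * M) h
                        from ⟨hxs, hxM⟩), mul_one]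
                    · rw [indicator_of_notMem hxs,
                        indicator_of_notMem (fun hc => hxs hc.1), mul_zero]
                  rw [h4] at h3
                  rw [real_inner_smul_right]
                  calc _ ≤ ζ x * (S * (Λ₀ + L) *
                        (innerStrip Ω (2 * M) h).indicator (fun _ => (1 : ℝ)) x) :=
                        mul_le_mul_of_nonneg_left h3 (hζI x).1
                    _ ≤ 1 * (S * (Λ₀ + L) *
                        (innerStrip Ω (2 * M) h).indicator (fun _ => (1 : ℝ)) x) :=
                        mul_le_mul_of_nonneg_right (hζI x).2 (by positivity)
                    _ = _ := one_mul _
                · rw [hζ_zero x hxM, zero_smul, inner_zero_right]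
                  positivity
              rw [hgrad, inner_add_right, mul_add, add_comm, Real.norm_eq_abs,
                abs_of_nonneg hx.1]
              have hind : 0 ≤ (innerStrip Ω (2 * M) h).indicator (fun _ => (1 : ℝ)) x :=
                indicator_nonneg (fun _ _ => zero_le_one) x
              refine add_le_add ?_ ?_
              · calc _ ≤ ρ s x * v (ρ s x) * (S * (Λ₀ + L) *
                      (innerStrip Ω (2 * M) h).indicator (fun _ => (1 : ℝ)) x) :=
                      mul_le_mul_of_nonneg_left h2 hq0
                  _ ≤ R * V * (S * (Λ₀ + L) *
                      (innerStrip Ω (2 * M) h).indicator (fun _ => (1 : ℝ)) x) :=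
                      mul_le_mul_of_nonneg_right hq2 (by positivity)
                  _ = _ := by ring
              · calc _ ≤ ρ s x * v (ρ s x) * (W * (c / M)) := mul_le_mul_of_nonneg_left h1 hq0
                  _ ≤ V * ρ s x * (W * (c / M)) := mul_le_mul_of_nonneg_right hq1 (by positivity)
                  _ = _ := by ring
          _ = R * V * (S * (Λ₀ + L)) * A h + V * W * (c / M) * ∫ x, ‖ρ s x‖ := by
            rw [integral_add (hAi.const_mul _) ((L1.integrable_coeFn (ρ s)).norm.const_mul _),
              integral_const_mul, integral_const_mul, hA1]
          _ ≤ _ := by gcongr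
      have hmass := hρ.integral_mul_le hT hv hr₀ hν.continuous hJc hW hI.exists_norm_sub_le
        hχ hχc hχ0 hflux t ht
      have hlow : ∫ x in Ωᶜ ∩ Metric.closedBall 0 M, ρ t x ≤ ∫ x, ρ t x * χ x := by
        rw [← integral_indicator (hmeas M)]
        refine integral_mono_ae (hρi.indicator (hmeas M))
          (integrable_mul_of_continuous_hasCompactSupport hχ.continuous hχc _) ?_
        filter_upwards [hdens] with x hx
        by_cases hxm : x ∈ Ωᶜ ∩ Metric.closedBall 0 M
        · rw [indicator_of_mem hxm]
          have h1 : wallCutoff Ω h x = 1 := (wallCutoff_eventuallyEq_one hh (by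
            rw [Metric.infDist_zero_of_mem hxm.1]
            positivity)).self_of_nhds
          simp [χ, h1, hζ_one x hxm.2]
        · rw [indicator_of_notMem hxm]
          exact mul_nonneg hx.1 (hχ0 x)
      -- The initial density vanishes outside `Ω`, the boundary is null and `χ` vanishes beyond
      -- depth `h`, so only the strip contributes.
      have hinit : ∫ x, r₀ x * χ x ≤ R * A h := by
        rw [← hA1, ← integral_const_mul]
        refine integral_mono_ae
          (integrable_mul_of_continuous_hasCompactSupport hχ.continuous hχc _)
          (hAi.const_mul R) ?_
        have hfr : ∀ᵐ x, x ∉ frontier Ω := measure_eq_zero_iff_ae_notMem.1 hs.volume_frontier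
        filter_upwards [hr₀, hspt, hfr] with x hx hxΩ hxf
        by_cases hxs : x ∈ innerStrip Ω (2 * M) h
        · rw [indicator_of_mem hxs]
          exact mul_le_mul hx.2 (mul_le_one₀ (hwI x).2 (hζI x).1 (hζI x).2) (hχ0 x) hR
        · rw [indicator_of_notMem hxs, mul_zero]
          refine le_of_eq ?_
          by_cases hxin : x ∈ Ω
          swap
          · rw [hxΩ hxin, zero_mul]
          have hpos : 0 < Metric.infDist x Ωᶜ := by
            rw [← mem_interior_iff_infDist_compl_pos hne]
            by_contra hni
            exact hxf ⟨subset_closure hxin, hni⟩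
          by_cases hxM : x ∈ Metric.closedBall 0 (2 * M)
          · have hge : h ≤ Metric.infDist x Ωᶜ := by
              by_contra! hlt
              exact hxs ⟨⟨hpos, hlt⟩, hxM⟩
            have h1 : wallCutoff Ω h x = 0 :=
              (wallCutoff_eventuallyEq_zero hh (by linarith)).self_of_nhds
            simp [χ, h1]
          · simp [χ, hζ_zero x hxM]
      have hAnn : 0 ≤ A h := measureReal_nonneg
      have hKt : (R * V * (S * (Λ₀ + L)) * A h + V * W * (c / M) * P) * t ≤
          (R * V * (S * (Λ₀ + L)) * A h + V * W * (c / M) * P) * T :=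
        mul_le_mul_of_nonneg_left ht.2 (by positivity)
      calc _ ≤ R * A h + (R * V * (S * (Λ₀ + L)) * A h + V * W * (c / M) * P) * T := by linarith
        _ = _ := by ring
    refine le_of_forall_pos_le_add fun δ hδ => ?_
    set Q := R + R * V * (S * (Λ₀ + L)) * T
    have hQ : 0 ≤ Q := by positivity
    -- The limit of vanishing width at fixed `M`; `Q + 1` avoids a division by zero.
    obtain ⟨h, hh, hhr, hA⟩ := exists_volume_innerStrip_lt (Ω := Ω) (2 * M) hs.pos
      (show 0 < δ / (Q + 1) by positivity)
    have h1 := hstep h hh hhr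
    have h2 : Q * A h ≤ δ := by
      calc Q * A h ≤ (Q + 1) * (δ / (Q + 1)) := by
            gcongr
            linarith
        _ = δ := by field_simp
    linarith
  -- The mass in a fixed ball is at most the mass in any larger one, whose bound tends to zero with
  -- growing radius.
  have hzero : ∀ M : ℕ, ∫ x in Ωᶜ ∩ Metric.closedBall 0 (M : ℝ), ρ t x = 0 := by
    intro M
    refine le_antisymm ?_ (setIntegral_nonneg_of_ae (hdens.mono fun x hx => hx.1))
    have hlim : Tendsto (fun n : ℕ => V * P * W * c * T / (n : ℝ)) atTop (𝓝 0) :=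
      tendsto_const_div_atTop_nhds_zero_nat _
    refine ge_of_tendsto hlim ?_
    filter_upwards [eventually_ge_atTop (max M 1)] with n hn
    have hMn : M ≤ n := (le_max_left _ _).trans hn
    have hn1 : 1 ≤ n := (le_max_right _ _).trans hn
    refine le_trans ?_ (hmain n (by exact_mod_cast hn1))
    refine setIntegral_mono_set hρi.integrableOn
      (ae_restrict_of_ae (hdens.mono fun x hx => hx.1)) (Eventually.of_forall ?_)
    exact inter_subset_inter_right _ (Metric.closedBall_subset_closedBall (Nat.cast_le.2 hMn))
  have hae : ∀ M : ℕ, ∀ᵐ x, x ∈ Ωᶜ ∩ Metric.closedBall 0 (M : ℝ) → ρ t x = 0 := by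
    intro M
    have := (setIntegral_eq_zero_iff_of_nonneg_ae
      (ae_restrict_of_ae (hdens.mono fun x hx => hx.1)) hρi.integrableOn).1 (hzero M)
    rw [Filter.EventuallyEq, ae_restrict_iff' (hmeas M)] at this
    exact this
  filter_upwards [ae_all_iff.2 hae] with x hx hxΩ
  obtain ⟨M, hM⟩ := exists_nat_ge ‖x‖
  exact hx M ⟨hxΩ, by simpa using hM⟩

end Invariance

/-! ### The main theorem -/

theorem proposition3p5 (N : ℕ) (hN : 0 < N) (R V ε lam rΩ : ℝ)
    (v φ : ℝ → ℝ) (Ω : Set (EuclideanSpace ℝ (Fin N)))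
    (η α : EuclideanSpace ℝ (Fin N) → ℝ)
    (g : EuclideanSpace ℝ (Fin N) → EuclideanSpace ℝ (Fin N))
    (hε : 0 < ε) (hlam : 0 ≤ lam) (hv : HypV R V v) (hΩ : HypOmega rΩ Ω) (hη : HypEta η)
    (hg : HypG Ω g) (hg3 : ContDiff ℝ 3 g) (hgW : MemSobolev 3 ∞ g volume)
    (hα : HypAlpha rΩ Ω α) (hφ3 : ContDiff ℝ 3 φ) (hφW : MemSobolev 3 ∞ φ volume) :
    -- condition (I), with the integrals over the whole space or restricted to `Ω`
    (∀ D : Set (EuclideanSpace ℝ (Fin N)), D = univ ∨ D = Ω →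
      HypI R (anisotropicI ε η φ g D)) ∧
    -- the assumptions of the existence and stability theorems
    (DistOfClass 3 Ω (Metric.cthickening rΩ (frontier Ω) ∩ Ω) →
      (IsCompact (frontier Ω) ∨
        (MemSobolev 2 1 α volume ∧ MemSobolev 2 ∞ α volume ∧
          ∀ p : ℝ≥0∞, p = 1 ∨ p = (⊤ : ℝ≥0∞) →
            MemSobolev 3 p (fun x => Metric.infDist x (frontier Ω))
              (volume.restrict (Metric.thickening rΩ (frontier Ω) ∩ interior Ω)))) →
      ∃ ν, IsGPlusDiscomfort lam Ω g α ν ∧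
        ∀ D : Set (EuclideanSpace ℝ (Fin N)), D = univ ∨ D = Ω →
          ModelAssumptions R V v ν (anisotropicI ε η φ g D)) ∧
    -- invariance
    ((∀ s, 0 ≤ deriv φ s) →
      ENNReal.ofReal (ε * R) * normW11 η * normW1inf φ *
          (1 + ENNReal.ofReal (Metric.diam (insert 0 (tsupport η))) *
            eLpNorm (fderiv ℝ g) ∞ volume)
        ≤ ENNReal.ofReal lam →
      ∀ ν, ContDiff ℝ 1 ν → MemLp ν ∞ volume → IsGPlusDiscomfort lam Ω g α ν →
        ∀ D : Set (EuclideanSpace ℝ (Fin N)), D = univ ∨ D = Ω →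
          Invariant R v ν (anisotropicI ε η φ g D) Ω) := by
  have hR := hv.R_pos.le
  obtain ⟨C, M, hk⟩ := exists_kernelBound_anisotropicKernel hη.contDiff hη.hasCompactSupport
    hφ3 hφW hg3 hgW
  have hI (D : Set (EuclideanSpace ℝ (Fin N))) : HypI R (anisotropicI ε η φ g D) :=
    hypI_anisotropicI hR ε hk
  obtain ⟨U, d, hs⟩ := hΩ.exists_isRegularStrip
  refine ⟨fun D _ => hI D, fun hdist hor => ?_, fun hφ' hsmall ν hν hνb hνg D _ => ?_⟩
  -- The second alternative is contained in the first: integrability of `α` bounds the boundary.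
  · have hcompact : IsCompact (frontier Ω) := by
      rcases hor with hc | ⟨hα1, hα2, -⟩
      · exact hc
      · exact Metric.isCompact_of_isClosed_isBounded isClosed_frontier
          (isBounded_of_memLp_one_of_eq_one (hα.contDiff.of_le (by norm_num))
            (hα1.memLp hα.contDiff) (hα2.memLp_fderiv hα.contDiff (by norm_num)) hα.eq_one)
    have hgν : HypNu g := ⟨hg.contDiff, fun j hj => hgW j (by omega), hg.div_memW11,
      hg.div_memW1inf⟩
    obtain ⟨ν, hνg, hν⟩ := exists_hypNu_isGPlusDiscomfort lam hΩ hgν hα hdist hcompact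
    exact ⟨ν, hνg, fun D _ => ⟨hv, hν, hI D⟩⟩
  · refine invariant_of_inner_nonneg hv hs hν hνb (hI D) (B := ε)
      (fun r x => norm_saturation_le hε.le _) fun r hr p n t hp => ?_
    exact inner_velocity_nonneg hs hg hα hνg (fun x n hn hgn => neg_le_inner_anisotropicI hε.le
      hlam hη hg3 hgW hφ3 hφW hφ' hsmall hr hR hn hgn) hp
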